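/- Let $\Delta$ be the category of the ordinals $[n]=\{0,\dots,n\}$, $n\ge 0$, and order-preserving maps. A \emph{2-category} (in the sense of Segal) is a fibration $\mathcal{C}\to\Delta$ such that the fiber $\mathcal{C}_{[0]}$ is discrete (all its morphisms are identities) and such that for all $n\ge l\ge 0$ the functor $$s^*\times t^*:\mathcal{C}_{[n]}\to\mathcal{C}_{[l]}\times_{\mathcal{C}_{[0]}}\mathcal{C}_{[n-l]}$$ is an equivalence of categories, where $s:[l]\to[n]$ and $t:[n-l]\to[n]$ are the embeddings onto the initial and the terminal segment, $f^*$ denotes the transition functor of the fibration along $f$, and the target consists of triples $\langle a,b,\alpha\rangle$ with $\alpha$ an isomorphism between the restriction of $a$ to the last vertex of $[l]$ and the restriction of $b$ to the first vertex of $[n-l]$. A \emph{2-functor} between such 2-categories is a functor over $\Delta$ that sends cartesian morphisms to cartesian morphisms, and it is an \emph{equivalence} if it is an equivalence of categories. A \emph{2-functor} $\gamma$ between strict 2-categories preserves identity 1-morphisms and compositions of 1-morphisms up to specified coherent isomorphisms $\mathrm{id}_{\gamma(c)}\cong\gamma(\mathrm{id}_c)$ and $\gamma(f)\circ\gamma(g)\cong\gamma(f\circ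 g)$ (a pseudofunctor). For 2-functors $\gamma,\gamma'$ from $A$ to $B$ that agree on objects, a \emph{2-morphism} $\gamma\to\gamma'$ is a collection of natural transformations $\gamma_{c,c'}\to\gamma'_{c,c'}$ of functors $A(c,c')\to B(\gamma(c),\gamma(c'))$ compatible with these isomorphisms; it is \emph{invertible} if all the $\gamma_{c,c'}\to\gamma'_{c,c'}$ are isomorphisms. Strict 2-categories $A$, $B$ are \emph{strongly equivalent} if there are 2-functors $\gamma:A\to B$, $\gamma':B\to A$ and invertible 2-morphisms $\mathrm{id}\to\gamma'\circ\gamma$, $\gamma\circ\gamma'\to\mathrm{id}$. The \emph{simplicial replacement} $\Delta A\to\Delta$ of a strict 2-category $A$ is the fibration whose fiber over $[n]$ is the category $\mathrm{Fun}^2([n],A)$ of 2-functors $[n]\to A$ that preserve identity 1-morphisms strictly, and 2-morphisms between them, and whose transition functors are given by precomposition. \textbf{Theorem.} For any small 2-category $\mathcal{C}\to\Delta$ in the sense of Segal there exist a small strict 2-category $R(\mathcal{C})$ and an equivalence $\mathcal{C}\cong\Delta R(\mathcal{C})$ over $\Delta$. Moreover, $R(\mathcal{C})$ is unique up to a strong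 equivalence: if $R$ and $R'$ are small strict 2-categories such that both $\Delta R$ and $\Delta R'$ are equivalent to $\mathcal{C}$ over $\Delta$, then $R$ and $R'$ are strongly equivalent. -/

import Mathlib

open CategoryTheory Bicategory
open scoped Simplicial

universe u w₁ w₂ v₁ v₂ v₃ u₁ u₂ u₃

namespace SegalTwoCat

section Transport

variable {C : Type u₂} [Bicategory.{w₂, v₂} C]

/-- The identification of categories of morphisms `C(a', b') = C(a, b)` when `a = a'`, `b = b'`. -/
def homCast {a a' b b' : C} (ha : a = a') (hb : b = b') : (a' ⟶ b') ⥤ (a ⟶ b) :=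
  match ha, hb with
  | rfl, rfl => 𝟭 _

@[simp]
theorem homCast_refl {a b : C} (ha : a = a) (hb : b = b) :
    homCast ha hb = 𝟭 (a ⟶ b) := rfl

theorem homCast_id {a a' : C} (ha : a = a') : 𝟙 a = (homCast ha ha).obj (𝟙 a') := by
  subst ha; rfl

theorem homCast_comp {a a' b b' c c' : C} (ha : a = a') (hb : b = b') (hc : c = c')
    (f : a' ⟶ b') (g : b' ⟶ c') :
    (homCast ha hb).obj f ≫ (homCast hb hc).obj g = (homCast ha hc).obj (f ≫ g) := by
  subst ha; subst hb; subst hc; rfl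

theorem homCast_trans {a a' a'' b b' b'' : C} (ha : a = a') (hb : b = b') (ha' : a' = a'')
    (hb' : b' = b'') (f : a'' ⟶ b'') :
    (homCast ha hb).obj ((homCast ha' hb').obj f) =
      (homCast (ha.trans ha') (hb.trans hb')).obj f := by
  subst ha; subst hb; subst ha'; subst hb'; rfl

theorem homCast_map_trans {a a' a'' b b' b'' : C} (ha : a = a') (hb : b = b') (ha' : a' = a'')
    (hb' : b' = b'') {f g : a'' ⟶ b''} (θ : f ⟶ g) :
    (homCast ha hb).map ((homCast ha' hb').map θ) =
      eqToHom (homCast_trans ha hb ha' hb' f) ≫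
        (homCast (ha.trans ha') (hb.trans hb')).map θ ≫
          eqToHom (homCast_trans ha hb ha' hb' g).symm := by
  subst ha; subst hb; subst ha'; subst hb'
  change θ = 𝟙 _ ≫ θ ≫ 𝟙 _
  simp

theorem homCast_map_whiskerRight {a a' b b' c c' : C} (ha : a = a') (hb : b = b') (hc : c = c')
    {f f' : a' ⟶ b'} (θ : f ⟶ f') (g : b' ⟶ c') :
    (homCast ha hc).map (θ ▷ g) =
      eqToHom (homCast_comp ha hb hc f g).symm ≫
        (homCast ha hb).map θ ▷ (homCast hb hc).obj g ≫
          eqToHom (homCast_comp ha hb hc f' g) := by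
  subst ha; subst hb; subst hc
  change θ ▷ g = 𝟙 _ ≫ θ ▷ g ≫ 𝟙 _
  simp

theorem homCast_map_whiskerLeft {a a' b b' c c' : C} (ha : a = a') (hb : b = b') (hc : c = c')
    (f : a' ⟶ b') {g g' : b' ⟶ c'} (θ : g ⟶ g') :
    (homCast ha hc).map (f ◁ θ) =
      eqToHom (homCast_comp ha hb hc f g).symm ≫
        (homCast ha hb).obj f ◁ (homCast hb hc).map θ ≫
          eqToHom (homCast_comp ha hb hc f g') := by
  subst ha; subst hb; subst hc
  change f ◁ θ = 𝟙 _ ≫ f ◁ θ ≫ 𝟙 _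
  simp

theorem homCast_map_eqToHom {a a' b b' : C} (ha : a = a') (hb : b = b') {f g : a' ⟶ b'}
    (h : f = g) : (homCast ha hb).map (eqToHom h) = eqToHom (by rw [h]) := by
  subst h; simp

theorem eqToHom_comp_whiskerLeft {a b c : C} {f f' : a ⟶ b} (h : f = f') {g g' : b ⟶ c}
    (θ : g ⟶ g') :
    eqToHom (show f ≫ g = f' ≫ g by rw [h]) ≫ f' ◁ θ = f ◁ θ ≫ eqToHom (by rw [h]) := by
  subst h; simp

theorem eqToHom_whiskerRight_eq {a b c : C} {f g : a ⟶ b} (h : f = g) (k : b ⟶ c) :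
    eqToHom h ▷ k = eqToHom (by rw [h]) := by
  subst h; simp

theorem whiskerLeft_eqToHom_eq {a b c : C} (k : a ⟶ b) {f g : b ⟶ c} (h : f = g) :
    k ◁ eqToHom h = eqToHom (by rw [h]) := by
  subst h; simp

end Transport

section Icons

variable {B : Type u₁} [Bicategory.{w₁, v₁} B] {C : Type u₂} [Bicategory.{w₂, v₂} C]

/-- A 2-morphism between 2-functors `F`, `G` that agree on objects: a family of natural
transformations `F_{a,b} ⟶ G_{a,b}` compatible with the structure isomorphisms for compositions
and for identities. -/
structure Icon (F G : B ⥤ᵖ C) where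
  obj_eq (a : B) : F.obj a = G.obj a
  app {a b : B} (f : a ⟶ b) : F.map f ⟶ (homCast (obj_eq a) (obj_eq b)).obj (G.map f)
  naturality {a b : B} {f g : a ⟶ b} (η : f ⟶ g) :
    F.map₂ η ≫ app g = app f ≫ (homCast (obj_eq a) (obj_eq b)).map (G.map₂ η)
  app_id (a : B) :
    app (𝟙 a) ≫ (homCast (obj_eq a) (obj_eq a)).map (G.mapId a).hom =
      (F.mapId a).hom ≫ eqToHom (homCast_id (obj_eq a))
  app_comp {a b c : B} (f : a ⟶ b) (g : b ⟶ c) :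
    app (f ≫ g) ≫ (homCast (obj_eq a) (obj_eq c)).map (G.mapComp f g).hom =
      (F.mapComp f g).hom ≫ app f ▷ F.map g ≫
        (homCast (obj_eq a) (obj_eq b)).obj (G.map f) ◁ app g ≫
        eqToHom (homCast_comp (obj_eq a) (obj_eq b) (obj_eq c) (G.map f) (G.map g))

namespace Icon

theorem ext_app {F G : B ⥤ᵖ C} {α β : Icon F G}
    (h : ∀ {a b : B} (f : a ⟶ b), α.app f = β.app f) : α = β := by
  cases α; cases β
  congr
  funext a b f
  exact h f

/-- A 2-morphism is invertible if all its components are. -/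
def Invertible {F G : B ⥤ᵖ C} (α : Icon F G) : Prop :=
  ∀ ⦃a b : B⦄ (f : a ⟶ b), IsIso (α.app f)

/-- The identity 2-morphism. -/
def refl (F : B ⥤ᵖ C) : Icon F F where
  obj_eq _ := rfl
  app f := 𝟙 (F.map f)
  naturality _ := by simp
  app_id _ := by simp
  app_comp _ _ := by simp

/-- The composition of 2-morphisms. -/
def comp {F G H : B ⥤ᵖ C} (α : Icon F G) (β : Icon G H) : Icon F H where
  obj_eq a := (α.obj_eq a).trans (β.obj_eq a)
  app {a b} f := α.app f ≫ (homCast (α.obj_eq a) (α.obj_eq b)).map (β.app f) ≫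
    eqToHom (homCast_trans _ _ _ _ _)
  naturality {a b f g} η := by
    rw [← Category.assoc, α.naturality, Category.assoc, ← Functor.map_comp_assoc, β.naturality]
    simp [homCast_map_trans]
  app_id a := by
    have h := congrArg (homCast (α.obj_eq a) (α.obj_eq a)).map (β.app_id a)
    simp only [Functor.map_comp, homCast_map_trans, homCast_map_eqToHom] at h
    rw [← cancel_mono (eqToHom (homCast_trans (α.obj_eq a) (α.obj_eq a) (β.obj_eq a)
      (β.obj_eq a) (𝟙 _)).symm)]
    simp only [Category.assoc]
    rw [h, ← Category.assoc, α.app_id]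
    simp
  app_comp {a b c} f g := by
    have h := congrArg (homCast (α.obj_eq a) (α.obj_eq c)).map (β.app_comp f g)
    simp only [Functor.map_comp, homCast_map_trans, homCast_map_eqToHom] at h
    rw [← cancel_mono (eqToHom (homCast_trans (α.obj_eq a) (α.obj_eq c) (β.obj_eq a)
      (β.obj_eq c) (H.map f ≫ H.map g)).symm)]
    simp only [Category.assoc]
    rw [h, ← Category.assoc, α.app_comp]
    rw [homCast_map_whiskerRight (α.obj_eq a) (α.obj_eq b) (α.obj_eq c),
      homCast_map_whiskerLeft (α.obj_eq a) (α.obj_eq b) (α.obj_eq c)]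
    simp only [comp_whiskerRight, whiskerLeft_comp, eqToHom_whiskerRight_eq,
      whiskerLeft_eqToHom_eq, Category.assoc, eqToHom_trans, eqToHom_trans_assoc, eqToHom_refl,
      Category.id_comp]
    rw [whisker_exchange_assoc, reassoc_of% (eqToHom_comp_whiskerLeft
      (homCast_trans (α.obj_eq a) (α.obj_eq b) (β.obj_eq a) (β.obj_eq b) (H.map f)) (α.app g)),
      reassoc_of% (eqToHom_comp_whiskerLeft
      (homCast_trans (α.obj_eq a) (α.obj_eq b) (β.obj_eq a) (β.obj_eq b) (H.map f))
      ((homCast (α.obj_eq b) (α.obj_eq c)).map (β.app g)))]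
    simp

end Icon
end Icons

section FunTwo

variable (B : Type u₁) [Bicategory.{w₁, v₁} B] (C : Type u₂) [Bicategory.{w₂, v₂} C]

/-- The category of normalized (that is, strictly preserving identity morphisms) 2-functors
`B → C` and 2-morphisms between them. -/
instance funTwo : Category (StrictlyUnitaryPseudofunctor B C) where
  Hom F G := Icon F.toPseudofunctor G.toPseudofunctor
  id F := Icon.refl F.toPseudofunctor
  comp α β := Icon.comp α β
  id_comp α := by
    apply Icon.ext_app
    intro a b f
    change 𝟙 _ ≫ α.app f ≫ 𝟙 _ = α.app f
    simp
  comp_id α := by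
    apply Icon.ext_app
    intro a b f
    change α.app f ≫ (homCast _ _).map (𝟙 _) ≫ eqToHom _ = α.app f
    simp
  assoc α β γ := by
    apply Icon.ext_app
    intro a b f
    simp [Icon.comp, homCast_map_trans, homCast_map_eqToHom]

end FunTwo

section Restriction

variable {J : Type u₁} {K : Type u₂} [Preorder J] [Preorder K]
  {C : Type u₃} [Bicategory.{w₂, v₂} C]

/-- Precomposition of a 2-functor defined on a preorder with a monotone map. -/
def restrictObj (f : J →o K) (γ : StrictlyUnitaryPseudofunctor (LocallyDiscrete K) C) :
    StrictlyUnitaryPseudofunctor (LocallyDiscrete J) C where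
  obj j := γ.obj ⟨f j.as⟩
  map u := γ.map ⟨f.monotone.functor.map u.as⟩
  map₂ η := γ.map₂ ⟨⟨by rw [LocallyDiscrete.eq_of_hom η]⟩⟩
  map₂_id _ := γ.map₂_id _
  map₂_comp _ _ := γ.map₂_comp _ _
  mapId j := γ.mapId ⟨f j.as⟩
  mapComp u v := γ.mapComp ⟨f.monotone.functor.map u.as⟩ ⟨f.monotone.functor.map v.as⟩
  map₂_whisker_left _ _ _ _ := γ.map₂_whisker_left _ _
  map₂_whisker_right _ _ := γ.map₂_whisker_right _ _
  map₂_associator _ _ _ := γ.map₂_associator _ _ _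
  map₂_left_unitor _ := γ.map₂_left_unitor _
  map₂_right_unitor _ := γ.map₂_right_unitor _
  map_id _ := γ.map_id _
  mapId_eq_eqToIso _ := γ.mapId_eq_eqToIso _

/-- Precomposition of a 2-morphism of 2-functors defined on a preorder with a monotone map. -/
def restrictMap (f : J →o K) {γ γ' : StrictlyUnitaryPseudofunctor (LocallyDiscrete K) C}
    (α : γ ⟶ γ') : restrictObj f γ ⟶ restrictObj f γ' where
  obj_eq j := Icon.obj_eq α ⟨f j.as⟩
  app u := Icon.app α ⟨f.monotone.functor.map u.as⟩
  naturality _ := Icon.naturality α _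
  app_id _ := Icon.app_id α _
  app_comp _ _ := Icon.app_comp α _ _

/-- The functor `f^* : Fun²(K, C) ⥤ Fun²(J, C)` for a monotone map `f : J → K`. -/
def restrict (f : J →o K) :
    StrictlyUnitaryPseudofunctor (LocallyDiscrete K) C ⥤
      StrictlyUnitaryPseudofunctor (LocallyDiscrete J) C where
  obj := restrictObj f
  map := restrictMap f
  map_id _ := rfl
  map_comp _ _ := rfl

end Restriction

section Replacement

variable (C : Type u₃) [Bicategory.{w₂, v₂} C]

/-- The simplicial replacement `ΔC` of a (strict) 2-category `C`: the Grothendieck construction of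
`[n] ↦ Fun²([n], C)`, with the functors `f^*` of precomposition with `f : [n] ⟶ [m]`. -/
structure SimplicialReplacement where
  base : SimplexCategory
  fiber : StrictlyUnitaryPseudofunctor (LocallyDiscrete (Fin (base.len + 1))) C

namespace SimplicialReplacement

variable {C}

/-- A morphism in `ΔC` from `⟨[n], γ⟩` to `⟨[m], γ'⟩` is a map `f : [n] ⟶ [m]` together with
a 2-morphism `γ ⟶ f^* γ'`. -/
structure Hom (X Y : SimplicialReplacement C) where
  base : X.base ⟶ Y.base
  fiber : X.fiber ⟶ (restrict base.toOrderHom).obj Y.fiber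

instance : Category (SimplicialReplacement C) where
  Hom := Hom
  id X := { base := 𝟙 X.base, fiber := 𝟙 X.fiber }
  comp f g :=
    { base := f.base ≫ g.base
      fiber := f.fiber ≫ (restrict f.base.toOrderHom).map g.fiber }
  id_comp f := by
    have h : 𝟙 _ ≫ f.fiber = f.fiber := Category.id_comp _
    with_unfolding_all exact congrArg (Hom.mk f.base) h
  comp_id f := by
    have h : f.fiber ≫ 𝟙 _ = f.fiber := Category.comp_id _
    with_unfolding_all exact congrArg (Hom.mk f.base) h
  assoc f g h := congrArg (Hom.mk (f.base ≫ g.base ≫ h.base)) (Category.assoc f.fiber _ _)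

variable (C) in
/-- The projection `ΔC ⥤ Δ`. -/
def proj : SimplicialReplacement C ⥤ SimplexCategory where
  obj X := X.base
  map f := f.base

end SimplicialReplacement

end Replacement

section Transition

variable {E : Type u₁} [Category.{v₁} E] {I : Type u₂} [Category.{v₂} I] (p : E ⥤ I) [p.IsFibered]

open Functor Functor.IsPreFibered

/-- The transition functor `f^* : E_j ⥤ E_i` of a fibration `p : E ⥤ I` along `f : i ⟶ j`. -/
noncomputable def transition {i j : I} (f : i ⟶ j) : p.Fiber j ⥤ p.Fiber i where
  obj c := ⟨pullbackObj c.2 f, pullbackObj_proj c.2 f⟩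
  map {c c'} φ :=
    haveI := φ.2
    ⟨IsCartesian.map p f (pullbackMap c'.2 f) (pullbackMap c.2 f ≫ φ.1), inferInstance⟩
  map_id c := by
    apply Subtype.ext
    change IsCartesian.map p f (pullbackMap c.2 f) (pullbackMap c.2 f ≫ 𝟙 c.1) = 𝟙 _
    simp
  map_comp {c c' c''} φ ψ := by
    have := φ.2
    have := ψ.2
    apply Subtype.ext
    change IsCartesian.map p f (pullbackMap c''.2 f) (pullbackMap c.2 f ≫ φ.1 ≫ ψ.1) =
      IsCartesian.map p f (pullbackMap c'.2 f) (pullbackMap c.2 f ≫ φ.1) ≫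
        IsCartesian.map p f (pullbackMap c''.2 f) (pullbackMap c'.2 f ≫ ψ.1)
    symm
    apply IsCartesian.map_uniq
    simp

/-- The canonical isomorphism `f^* g^* ≅ (g ∘ f)^*`. -/
noncomputable def transitionComp {i j k : I} (f : i ⟶ j) (g : j ⟶ k) :
    transition p g ⋙ transition p f ≅ transition p (f ≫ g) :=
  NatIso.ofComponents
    (fun c =>
      let ψ := pullbackMap c.2 (f ≫ g)
      let φ := pullbackMap (pullbackObj_proj c.2 g) f ≫ pullbackMap c.2 g
      have : p.IsCartesian (f ≫ g) ψ := pullbackMap.IsCartesian c.2 (f ≫ g)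
      have : p.IsCartesian (f ≫ g) φ := inferInstance
      let e := IsCartesian.domainUniqueUpToIso p (f ≫ g) ψ φ
      { hom := ⟨e.hom, IsCartesian.domainUniqueUpToIso_inv_isHomLift p (f ≫ g) ψ φ⟩
        inv := ⟨e.inv, IsCartesian.domainUniqueUpToIso_hom_isHomLift p (f ≫ g) ψ φ⟩
        hom_inv_id := Subtype.ext e.hom_inv_id
        inv_hom_id := Subtype.ext e.inv_hom_id })
    (fun {c c'} φ => by
      have := φ.2
      apply Subtype.ext
      let ψ := IsCartesian.map p g (pullbackMap c'.2 g) (pullbackMap c.2 g ≫ φ.1)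
      change IsCartesian.map p f (pullbackMap (pullbackObj_proj c'.2 g) f)
          (pullbackMap (pullbackObj_proj c.2 g) f ≫ ψ) ≫
          IsCartesian.map p (f ≫ g) (pullbackMap c'.2 (f ≫ g))
            (pullbackMap (pullbackObj_proj c'.2 g) f ≫ pullbackMap c'.2 g) =
        IsCartesian.map p (f ≫ g) (pullbackMap c.2 (f ≫ g))
            (pullbackMap (pullbackObj_proj c.2 g) f ≫ pullbackMap c.2 g) ≫
          IsCartesian.map p (f ≫ g) (pullbackMap c'.2 (f ≫ g)) (pullbackMap c.2 (f ≫ g) ≫ φ.1)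
      apply IsCartesian.ext p (f ≫ g) (pullbackMap c'.2 (f ≫ g))
      simp [ψ])

end Transition

section TwoCategories

variable {E : Type u₁} [Category.{v₁} E] (p : E ⥤ SimplexCategory)

/-- The embedding `s : [l] ⟶ [l + k]` onto the initial segment. -/
def initialSegment (l k : ℕ) : ⦋l⦌ ⟶ ⦋l + k⦌ :=
  SimplexCategory.subinterval 0 l (by omega)

/-- The embedding `t : [k] ⟶ [l + k]` onto the terminal segment. -/
def terminalSegment (l k : ℕ) : ⦋k⦌ ⟶ ⦋l + k⦌ :=
  SimplexCategory.subinterval l k le_rfl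

theorem segal_square (l k : ℕ) :
    SimplexCategory.const ⦋0⦌ ⦋l⦌ (Fin.last l) ≫ initialSegment l k =
      SimplexCategory.const ⦋0⦌ ⦋k⦌ 0 ≫ terminalSegment l k := by
  unfold initialSegment terminalSegment
  rw [SimplexCategory.const_subinterval_eq, SimplexCategory.const_subinterval_eq]
  congr 1
  simp

/-- The functor `s^* × t^* : E_[l+k] ⥤ E_[l] ×_{E_[0]} E_[k]`. The target consists of triples
`⟨a, b, t^* a ≅ s^* b⟩`, where `t : [0] ⟶ [l]` and `s : [0] ⟶ [k]` are the embeddings onto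
the last and the first element. -/
noncomputable def segalFunctor [p.IsFibered] (l k : ℕ) :
    p.Fiber ⦋l + k⦌ ⥤ Limits.CategoricalPullback
      (transition p (SimplexCategory.const ⦋0⦌ ⦋l⦌ (Fin.last l)))
      (transition p (SimplexCategory.const ⦋0⦌ ⦋k⦌ 0)) :=
  (Limits.CategoricalPullback.CatCommSqOver.toFunctorToCategoricalPullback _ _ _).obj
    { fst := transition p (initialSegment l k)
      snd := transition p (terminalSegment l k)
      iso := transitionComp p _ _ ≪≫
        eqToIso (congrArg (fun f => transition p f) (segal_square l k)) ≪≫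
          (transitionComp p _ _).symm }

/-- A 2-category in the sense of Segal: a fibration over `Δ` that satisfies the Segal condition
and whose fiber over `[0]` is discrete. -/
structure IsTwoCategory : Prop where
  isFibered : p.IsFibered
  segal (l k : ℕ) : (segalFunctor p l k).IsEquivalence
  discrete : IsDiscrete (p.Fiber ⦋0⦌)

variable {E' : Type u₂} [Category.{v₂} E'] (p' : E' ⥤ SimplexCategory)

/-- A 2-functor: a functor over `Δ` that sends cartesian morphisms to cartesian morphisms. -/
structure TwoFunctor where
  functor : E ⥤ E'
  comm : functor ⋙ p' ≅ p
  cartesian {x y : E} (f : x ⟶ y) :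
    p.IsCartesian (p.map f) f → p'.IsCartesian (p'.map (functor.map f)) (functor.map f)

/-- `p` and `p'` are equivalent: there is a 2-functor between them that is an equivalence of
categories. -/
def Equivalent : Prop :=
  ∃ F : TwoFunctor p p', F.functor.IsEquivalence

end TwoCategories

section StrongEquivalence

variable (B : Type u₁) [Bicategory.{w₁, v₁} B] (C : Type u₂) [Bicategory.{w₂, v₂} C]

/-- `B` and `C` are strongly equivalent: there are 2-functors `F : B → C` and `G : C → B`
and invertible 2-morphisms `id ⟶ G ∘ F` and `F ∘ G ⟶ id`. -/
def StronglyEquivalent : Prop :=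
  ∃ (F : B ⥤ᵖ C) (G : C ⥤ᵖ B) (α : Icon (Pseudofunctor.id B) (F.comp G))
    (β : Icon (G.comp F) (Pseudofunctor.id C)), α.Invertible ∧ β.Invertible

end StrongEquivalence

end SegalTwoCat

/-! Existence. As the fiber over `[0]` is discrete, the vertices of a simplex are determined up to
equality, so the total category may be replaced by the equivalent category `Framed p` of simplices
with named vertices. The Segal condition for an initial segment and a last edge says that a simplex
is glued from these two pieces: a morphism out of it is a pair of morphisms out of the pieces that
agree on the common vertex (`IsGluing.ext`, `IsGluing.exists_desc`).

Two consecutive edges compose by filling a triangle and taking its long edge, but only up to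
isomorphism. Strictness is gained by letting a 1-morphism be a formal chain of edges, composed by
concatenation. Each chain gets a chosen simplex, whose long edge `Chain.comps` is the actual
composite; a 2-morphism of chains is a morphism of these long edges fixing the endpoints.
Consecutive edges of any simplex have a join `Chain.jn`, and horizontal composition is characterized
by its action on joins (`Chain.hcomp_jn`). Since 2-morphisms can be tested after a cartesian edge
(`Chain.hom_ext_cart`), the axioms reduce to `Chain.jn_assoc`, `Chain.jn_nil_left` and
`Chain.jn_nil_right`.

A simplex `A` defines a normalized 2-functor from its ordinal to `Rect p` by representing each of
its edges by a chain. The resulting functor `Rect.nerve` is faithful and full because morphisms out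
of `A` are determined by, and can be prescribed on, consecutive edges (`Rect.spine_ext`,
`Rect.exists_spine_lift`). It is essentially surjective because any normalized 2-functor is realized
by gluing its consecutive edges (`Rect.exists_realization_succ`).

Uniqueness. An equivalence from the given fibration to `ΔC` induces a 2-functor from `Rect p` to `C`
that is bijective on objects and an equivalence on categories of morphisms
(`Comparison.isLocalEquivalence`). Such local equivalences compose, have sections of the same kind,
and give strong equivalences. Hence the span `R ← Rect p → R'` yields a strong equivalence of `R`
and `R'`. -/

namespace SegalTwoCat

/-! ### Simplices with named vertices and their cartesian morphisms. -/

section FramedObjects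

variable {E : Type u₁} [Category.{v₁} E] (p : E ⥤ SimplexCategory)

/-- `a` is the `i`-th vertex of `x`: there is a morphism `a ⟶ x` over `i : [0] ⟶ [n]`. -/
def IsVertex {n : ℕ} (x : p.Fiber ⦋n⦌) (i : Fin (n + 1)) (a : p.Fiber ⦋0⦌) : Prop :=
  ∃ φ : a.1 ⟶ x.1, p.IsHomLift (SimplexCategory.const ⦋0⦌ ⦋n⦌ i) φ

/-- An object of the total category of a fibration over `Δ` together with a choice of its
vertices. -/
structure Framed where
  len : ℕ
  obj : p.Fiber ⦋len⦌
  vtx : Fin (len + 1) → p.Fiber ⦋0⦌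
  isVertex (i : Fin (len + 1)) : IsVertex p obj i (vtx i)

namespace Framed

variable {p}

/-- A morphism of framed objects together with the order-preserving map over which it lies. -/
structure Hom (X Y : Framed p) where
  base : Fin (X.len + 1) →o Fin (Y.len + 1)
  hom : X.obj.1 ⟶ Y.obj.1
  lift : p.IsHomLift (SimplexCategory.mkHom base) hom

/-- The map under a morphism is its image under `p`, up to the fixed identifications of the images
of source and target; the field `base` only records it as a function on vertices. -/
theorem Hom.ext_hom {X Y : Framed p} {φ ψ : Hom X Y} (h : φ.hom = ψ.hom) : φ = ψ := by
  have hb : φ.base = ψ.base := by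
    have h₁ := φ.lift
    have h₂ := ψ.lift
    have e₁ := CategoryTheory.IsHomLift.fac p (SimplexCategory.mkHom φ.base) φ.hom
    have e₂ := CategoryTheory.IsHomLift.fac p (SimplexCategory.mkHom ψ.base) ψ.hom
    simp only [h] at e₁
    have e := e₁.trans e₂.symm
    exact congrArg SimplexCategory.Hom.toOrderHom e
  cases φ; cases ψ
  cases h; cases hb
  rfl

instance : Category (Framed p) where
  Hom := Hom
  id X := ⟨OrderHom.id, 𝟙 _, CategoryTheory.IsHomLift.id X.obj.2⟩
  comp φ ψ := ⟨ψ.base.comp φ.base, φ.hom ≫ ψ.hom, by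
    have := φ.lift
    have := ψ.lift
    exact CategoryTheory.IsHomLift.comp p (SimplexCategory.mkHom φ.base)
      (SimplexCategory.mkHom ψ.base) φ.hom ψ.hom⟩
  id_comp φ := Hom.ext_hom (Category.id_comp _)
  comp_id φ := Hom.ext_hom (Category.comp_id _)
  assoc φ ψ χ := Hom.ext_hom (Category.assoc _ _ _)

theorem hom_ext {X Y : Framed p} {φ ψ : X ⟶ Y} (h : φ.hom = ψ.hom) : φ = ψ := Hom.ext_hom h

/-- The order-preserving map under a morphism. -/
def base {X Y : Framed p} (φ : X ⟶ Y) : Fin (X.len + 1) →o Fin (Y.len + 1) := Hom.base φ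

@[simp]
theorem base_id (X : Framed p) : base (𝟙 X) = OrderHom.id := rfl

@[simp]
theorem base_comp {X Y Z : Framed p} (φ : X ⟶ Y) (ψ : Y ⟶ Z) :
    base (φ ≫ ψ) = (base ψ).comp (base φ) := rfl

theorem base_eqToHom_val {X Y : Framed p} (h : X = Y) (i : Fin (X.len + 1)) :
    (base (eqToHom h) i).val = i.val := by
  subst h; rfl

/-- Cartesian morphisms of framed objects. -/
def Cart {X Y : Framed p} (φ : X ⟶ Y) : Prop :=
  ∀ ⦃Z : Framed p⦄ (ψ : Z ⟶ Y) (g : Fin (Z.len + 1) →o Fin (X.len + 1)),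
    (∀ i, base φ (g i) = base ψ i) → ∃! χ : Z ⟶ X, base χ = g ∧ χ ≫ φ = ψ

namespace Cart

variable {X Y Z W : Framed p}

/-- The lift of a morphism through a cartesian morphism. -/
noncomputable def lift {φ : X ⟶ Y} (h : Cart φ) (ψ : Z ⟶ Y)
    (g : Fin (Z.len + 1) →o Fin (X.len + 1)) (hg : ∀ i, base φ (g i) = base ψ i) : Z ⟶ X :=
  (h ψ g hg).choose

@[simp]
theorem lift_base {φ : X ⟶ Y} (h : Cart φ) (ψ : Z ⟶ Y)
    (g : Fin (Z.len + 1) →o Fin (X.len + 1)) (hg : ∀ i, base φ (g i) = base ψ i) :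
    base (h.lift ψ g hg) = g := (h ψ g hg).choose_spec.1.1

@[simp]
theorem lift_comp {φ : X ⟶ Y} (h : Cart φ) (ψ : Z ⟶ Y)
    (g : Fin (Z.len + 1) →o Fin (X.len + 1)) (hg : ∀ i, base φ (g i) = base ψ i) :
    h.lift ψ g hg ≫ φ = ψ := (h ψ g hg).choose_spec.1.2

@[simp]
theorem lift_comp_assoc {φ : X ⟶ Y} (h : Cart φ) (ψ : Z ⟶ Y)
    (g : Fin (Z.len + 1) →o Fin (X.len + 1)) (hg : ∀ i, base φ (g i) = base ψ i) (χ : Y ⟶ W) :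
    h.lift ψ g hg ≫ φ ≫ χ = ψ ≫ χ := by
  rw [← Category.assoc, h.lift_comp]

theorem exists_lift {φ : X ⟶ Y} (h : Cart φ) (ψ : Z ⟶ Y)
    (g : Fin (Z.len + 1) →o Fin (X.len + 1)) (hg : ∀ i, base φ (g i) = base ψ i) :
    ∃ χ : Z ⟶ X, (∀ i, base χ i = g i) ∧ χ ≫ φ = ψ :=
  ⟨h.lift ψ g hg, fun i => by rw [lift_base], h.lift_comp _ _ _⟩

theorem ext {φ : X ⟶ Y} (h : Cart φ) {χ χ' : Z ⟶ X} (hb : ∀ i, base χ i = base χ' i)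
    (hc : χ ≫ φ = χ' ≫ φ) : χ = χ' :=
  (h (χ' ≫ φ) (base χ') (fun _ => rfl)).unique ⟨OrderHom.ext _ _ (funext hb), hc⟩ ⟨rfl, rfl⟩

theorem comp {φ : X ⟶ Y} {ψ : Y ⟶ Z} (hφ : Cart φ) (hψ : Cart ψ) : Cart (φ ≫ ψ) := by
  intro W χ g hg
  have hg' : ∀ i, base ψ (((base φ).comp g) i) = base χ i := by simpa using hg
  refine ⟨hφ.lift (hψ.lift χ ((base φ).comp g) hg') g (by simp), ⟨by simp, by simp⟩, ?_⟩
  rintro χ' ⟨h₁, h₂⟩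
  refine hφ.ext (by simp [h₁]) (hψ.ext (by simp [h₁]) (by simp [h₂]))

theorem of_comp {φ : X ⟶ Y} {ψ : Y ⟶ Z} (hψ : Cart ψ) (h : Cart (φ ≫ ψ)) : Cart φ := by
  intro W χ g hg
  have hg' : ∀ i, base (φ ≫ ψ) (g i) = base (χ ≫ ψ) i := by simp [hg]
  refine ⟨h.lift (χ ≫ ψ) g hg', ⟨by simp, hψ.ext (by simp [hg]) (by simp)⟩, ?_⟩
  rintro χ' ⟨h₁, h₂⟩
  exact h.ext (by simp [h₁]) (by simp [← h₂])

theorem of_isIso (φ : X ⟶ Y) [IsIso φ] : Cart φ := by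
  intro W χ g hg
  refine ⟨χ ≫ inv φ, ⟨?_, by simp⟩, ?_⟩
  · have h := congrArg base (IsIso.hom_inv_id φ)
    rw [base_comp, base_id] at h
    ext i
    have h' := congrArg (fun f => (f (g i)).val) h
    simpa [hg] using h'
  · rintro χ' ⟨-, h₂⟩
    simp [← h₂]

theorem isIso {φ : X ⟶ Y} (h : Cart φ) (g : Fin (Y.len + 1) →o Fin (X.len + 1))
    (h₁ : ∀ i, base φ (g i) = i) (h₂ : ∀ i, g (base φ i) = i) : IsIso φ :=
  have h₁' : ∀ i, base φ (g i) = base (𝟙 Y) i := by simp [h₁]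
  ⟨h.lift (𝟙 _) g h₁', h.ext (by simp [h₂]) (by simp), by simp⟩

theorem isIso_of_base_id {X Y : Framed p} (hl : X.len = Y.len) {φ : X ⟶ Y} (h : Cart φ)
    (hb : ∀ i, (base φ i).val = i.val) : IsIso φ := by
  refine h.isIso ⟨fun i => ⟨i.val, by omega⟩, fun i j hij => hij⟩ ?_ ?_
  · intro i; ext; exact hb _
  · intro i; ext; exact hb _

/-- Precomposition with cartesian morphisms over the same map detects the same equalities. -/
theorem comp_eq_of_comp_eq {κ : X ⟶ Y} (h : Cart κ) {κ' : Z ⟶ Y}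
    (g : Fin (Z.len + 1) →o Fin (X.len + 1)) (hg : ∀ i, base κ (g i) = base κ' i) {φ ψ : Y ⟶ W}
    (e : κ ≫ φ = κ ≫ ψ) : κ' ≫ φ = κ' ≫ ψ := by
  rw [← h.lift_comp κ' g hg, Category.assoc, Category.assoc, e]

end Cart

theorem Cart.id (X : Framed p) : Cart (𝟙 X) := Cart.of_isIso _

theorem isVertex_self (a : p.Fiber ⦋0⦌) (i : Fin 1) : IsVertex p a i a := by
  refine ⟨𝟙 _, ?_⟩
  have : SimplexCategory.const ⦋0⦌ ⦋0⦌ i = 𝟙 _ := Subsingleton.elim _ _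
  rw [this]
  exact CategoryTheory.IsHomLift.id a.2

variable (p) in
/-- An object of the fiber over `[0]` as a framed object. -/
def point (a : p.Fiber ⦋0⦌) : Framed p where
  len := 0
  obj := a
  vtx _ := a
  isVertex i := isVertex_self a i

theorem exists_point_hom (X : Framed p) (i : Fin (X.len + 1)) {a : p.Fiber ⦋0⦌}
    (h : X.vtx i = a) : ∃ φ : point p a ⟶ X, ∀ j, base φ j = i := by
  subst h
  obtain ⟨φ, hφ⟩ := X.isVertex i
  exact ⟨⟨⟨fun _ => i, fun _ _ _ => le_rfl⟩, φ, hφ⟩, fun _ => rfl⟩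

/-- The embedding of a vertex. -/
noncomputable def vertex (X : Framed p) (i : Fin (X.len + 1)) {a : p.Fiber ⦋0⦌}
    (h : X.vtx i = a) : point p a ⟶ X := (exists_point_hom X i h).choose

@[simp]
theorem base_vertex (X : Framed p) (i : Fin (X.len + 1)) {a : p.Fiber ⦋0⦌}
    (h : X.vtx i = a) (j) : base (vertex X i h) j = i := (exists_point_hom X i h).choose_spec j

variable [hp : p.IsFibered]

open Functor Functor.IsPreFibered

/-- In a fibration cartesian morphisms are strongly cartesian, which provides lifts over an
arbitrary `g` and not only over identities. -/
theorem cart_of_isCartesian {X Y : Framed p} (φ : X ⟶ Y)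
    (h : p.IsCartesian (SimplexCategory.mkHom (base φ)) φ.hom) : Cart φ := by
  intro Z ψ g hg
  have hs : p.IsStronglyCartesian (SimplexCategory.mkHom (base φ)) φ.hom := inferInstance
  have hl : p.IsHomLift (SimplexCategory.mkHom (base ψ)) ψ.hom := ψ.lift
  obtain ⟨χ, ⟨h₁, h₂⟩, h₃⟩ := IsStronglyCartesian.universal_property p
    (SimplexCategory.mkHom (base φ)) φ.hom (SimplexCategory.mkHom g)
    (SimplexCategory.mkHom (base ψ)) (by
      have : base ψ = (base φ).comp g := by ext i; exact congrArg Fin.val (hg i).symm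
      rw [this]; rfl) ψ.hom
  refine ⟨⟨g, χ, h₁⟩, ⟨rfl, hom_ext h₂⟩, ?_⟩
  rintro χ' ⟨h₄, h₅⟩
  refine hom_ext (h₃ _ ⟨?_, congrArg Hom.hom h₅⟩)
  rw [← h₄]
  exact χ'.lift

theorem pullbackMap_isHomLift {i j : SimplexCategory} (x : p.Fiber j) (f : i ⟶ j) :
    p.IsHomLift f (pullbackMap x.2 f) := (pullbackMap.IsCartesian x.2 f).toIsHomLift

theorem isVertex_pull {n m : ℕ} {x : p.Fiber ⦋n⦌} {y : p.Fiber ⦋m⦌}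
    (f : Fin (m + 1) →o Fin (n + 1)) (φ : y.1 ⟶ x.1)
    [p.IsCartesian (SimplexCategory.mkHom f) φ] (i : Fin (m + 1)) (a : p.Fiber ⦋0⦌)
    (ha : IsVertex p x (f i) a) : IsVertex p y i a := by
  obtain ⟨ψ, hψ⟩ := ha
  exact ⟨IsStronglyCartesian.map p (SimplexCategory.mkHom f) φ
    (g := SimplexCategory.const ⦋0⦌ ⦋m⦌ i) (f' := SimplexCategory.const ⦋0⦌ ⦋n⦌ (f i)) rfl ψ,
    IsStronglyCartesian.map_isHomLift _ _ _ _ _⟩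

/-- The pullback of a framed object along an order-preserving map. -/
noncomputable def pull (X : Framed p) {m : ℕ} (f : Fin (m + 1) →o Fin (X.len + 1)) :
    Framed p where
  len := m
  obj := ⟨pullbackObj X.obj.2 (SimplexCategory.mkHom f), pullbackObj_proj _ _⟩
  vtx i := X.vtx (f i)
  isVertex i := isVertex_pull f (pullbackMap X.obj.2 (SimplexCategory.mkHom f)) i _
    (X.isVertex (f i))

/-- The cartesian morphism from the pullback. -/
noncomputable def pullMap (X : Framed p) {m : ℕ} (f : Fin (m + 1) →o Fin (X.len + 1)) :
    X.pull f ⟶ X :=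
  ⟨f, pullbackMap X.obj.2 (SimplexCategory.mkHom f),
    (pullbackMap.IsCartesian X.obj.2 (SimplexCategory.mkHom f)).toIsHomLift⟩

theorem cart_pullMap (X : Framed p) {m : ℕ} (f : Fin (m + 1) →o Fin (X.len + 1)) :
    Cart (X.pullMap f) :=
  cart_of_isCartesian _ (pullbackMap.IsCartesian X.obj.2 (SimplexCategory.mkHom f))

variable [hd : IsDiscrete (p.Fiber ⦋0⦌)]

/-- Both vertices map, inside the fiber over `[0]`, to the pullback of `x` along `i`, and in a
discrete fiber a morphism forces equality. This is what allows 1-morphisms to have sources and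
targets on the nose. -/
theorem IsVertex.unique {n : ℕ} {x : p.Fiber ⦋n⦌} {i : Fin (n + 1)} {a b : p.Fiber ⦋0⦌}
    (ha : IsVertex p x i a) (hb : IsVertex p x i b) : a = b := by
  obtain ⟨φ, hφ⟩ := ha
  obtain ⟨ψ, hψ⟩ := hb
  let π := pullbackMap x.2 (SimplexCategory.const ⦋0⦌ ⦋n⦌ i)
  let y : p.Fiber ⦋0⦌ := ⟨_, pullbackObj_proj x.2 (SimplexCategory.const ⦋0⦌ ⦋n⦌ i)⟩
  let φ' : a ⟶ y := ⟨IsCartesian.map p (SimplexCategory.const ⦋0⦌ ⦋n⦌ i) π φ, inferInstance⟩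
  let ψ' : b ⟶ y := ⟨IsCartesian.map p (SimplexCategory.const ⦋0⦌ ⦋n⦌ i) π ψ, inferInstance⟩
  exact (hd.eq_of_hom φ').trans (hd.eq_of_hom ψ').symm

theorem vtx_eq_of_isVertex (X : Framed p) {i : Fin (X.len + 1)} {a : p.Fiber ⦋0⦌}
    (ha : IsVertex p X.obj i a) : X.vtx i = a := IsVertex.unique (X.isVertex i) ha

theorem vtx_eq {X Y : Framed p} (φ : X ⟶ Y) (i : Fin (X.len + 1)) :
    X.vtx i = Y.vtx (base φ i) := by
  obtain ⟨ψ, hψ⟩ := X.isVertex i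
  refine (vtx_eq_of_isVertex Y ⟨ψ ≫ φ.hom, ?_⟩).symm
  have := φ.lift
  exact CategoryTheory.IsHomLift.comp p (SimplexCategory.const ⦋0⦌ ⦋X.len⦌ i)
    (SimplexCategory.mkHom φ.base) ψ φ.hom

/-- The comparison of `φ` with the pullback of `Y` lies in the discrete fiber over `[0]`, hence is
an isomorphism. -/
theorem cart_of_len_eq_zero {X Y : Framed p} (h : X.len = 0) (φ : X ⟶ Y) : Cart φ := by
  obtain ⟨n, x, v, hv⟩ := X
  obtain rfl : n = 0 := h
  let χ := (Y.cart_pullMap (base φ)).lift φ OrderHom.id (fun _ => rfl)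
  have hχ : IsIso χ := by
    let y : p.Fiber ⦋0⦌ := (Y.pull (base φ)).obj
    let χ' : x ⟶ y := ⟨χ.hom, by
      have h₁ := χ.lift
      have h₂ : χ.base = OrderHom.id := (Y.cart_pullMap (base φ)).lift_base φ OrderHom.id
        (fun _ => rfl)
      rw [h₂] at h₁
      exact h₁⟩
    have e := hd.eq_of_hom χ'
    let ξ : y ⟶ x := eqToHom e.symm
    have h₁ : χ' ≫ ξ = 𝟙 _ := Subsingleton.elim _ _
    have h₂ : ξ ≫ χ' = 𝟙 _ := Subsingleton.elim _ _
    refine ⟨⟨OrderHom.id, ξ.1, ξ.2⟩, hom_ext (congrArg Subtype.val h₁),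
      hom_ext (congrArg Subtype.val h₂)⟩
  rw [← (Y.cart_pullMap (base φ)).lift_comp φ OrderHom.id (fun _ => rfl)]
  exact (Cart.of_isIso χ).comp (Y.cart_pullMap _)

/-- Since `φ` is cartesian, `ψ` factors through it by an endomorphism in a discrete fiber, that is,
by an identity. -/
theorem hom_ext_of_len_eq_zero {X Y : Framed p} (h : X.len = 0) {φ ψ : X ⟶ Y}
    (hb : ∀ i, base φ i = base ψ i) : φ = ψ := by
  have hc := cart_of_len_eq_zero h φ
  have e := hc.lift_comp ψ OrderHom.id hb
  have : hc.lift ψ OrderHom.id hb = 𝟙 X := by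
    obtain ⟨n, x, v, hv⟩ := X
    obtain rfl : n = 0 := h
    let χ := hc.lift ψ OrderHom.id hb
    let χ' : x ⟶ x := ⟨χ.hom, by
      have h₁ := χ.lift
      have h₂ : χ.base = OrderHom.id := hc.lift_base ψ OrderHom.id hb
      rw [h₂] at h₁
      exact h₁⟩
    exact hom_ext (congrArg Subtype.val (Subsingleton.elim χ' (𝟙 x)))
  rw [← e, this, Category.id_comp]

end Framed

end FramedObjects

/-! ### The Segal equivalence unfolded: faithfulness, fullness, essential surjectivity. -/

section SegalCondition

variable {E : Type u₁} [Category.{v₁} E] (p : E ⥤ SimplexCategory)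

/-- The Segal condition for gluing a simplex and an edge. -/
class IsSegal [p.IsFibered] : Prop where
  isEquivalence (n : ℕ) : (segalFunctor p n 1).IsEquivalence

variable {p} [hp : p.IsFibered] [hs : IsSegal p]

open Functor Functor.IsPreFibered

/-- Faithfulness of the Segal functor: its two components on `φ` are the factorizations of these
composites through the cartesian morphisms into `y`. -/
theorem fiber_hom_ext {n : ℕ} {x y : p.Fiber ⦋n + 1⦌} {φ ψ : x ⟶ y}
    (h₁ : pullbackMap x.2 (initialSegment n 1) ≫ φ.1 =
      pullbackMap x.2 (initialSegment n 1) ≫ ψ.1)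
    (h₂ : pullbackMap x.2 (terminalSegment n 1) ≫ φ.1 =
      pullbackMap x.2 (terminalSegment n 1) ≫ ψ.1) : φ = ψ := by
  have := hs.isEquivalence n
  apply (segalFunctor p n 1).map_injective
  apply Limits.CategoricalPullback.hom_ext
  · apply Subtype.ext
    have := φ.2
    have := ψ.2
    change IsCartesian.map p (initialSegment n 1) (pullbackMap y.2 _)
        (pullbackMap x.2 (initialSegment n 1) ≫ φ.1) =
      IsCartesian.map p (initialSegment n 1) (pullbackMap y.2 _)
        (pullbackMap x.2 (initialSegment n 1) ≫ ψ.1)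
    congr 1
  · apply Subtype.ext
    have := φ.2
    have := ψ.2
    change IsCartesian.map p (terminalSegment n 1) (pullbackMap y.2 _)
        (pullbackMap x.2 (terminalSegment n 1) ≫ φ.1) =
      IsCartesian.map p (terminalSegment n 1) (pullbackMap y.2 _)
        (pullbackMap x.2 (terminalSegment n 1) ≫ ψ.1)
    congr 1

variable [hd : IsDiscrete (p.Fiber ⦋0⦌)]

/-- Fullness of the Segal functor. No compatibility of `u` and `v` is required, since it would be an
equality of morphisms in the discrete fiber over `[0]`. -/
theorem exists_fiber_hom {n : ℕ} {x y : p.Fiber ⦋n + 1⦌}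
    (u : (transition p (initialSegment n 1)).obj x ⟶ (transition p (initialSegment n 1)).obj y)
    (v : (transition p (terminalSegment n 1)).obj x ⟶
      (transition p (terminalSegment n 1)).obj y) :
    ∃ φ : x ⟶ y,
      pullbackMap x.2 (initialSegment n 1) ≫ φ.1 =
        u.1 ≫ pullbackMap y.2 (initialSegment n 1) ∧
      pullbackMap x.2 (terminalSegment n 1) ≫ φ.1 =
        v.1 ≫ pullbackMap y.2 (terminalSegment n 1) := by
  have := hs.isEquivalence n
  let w : (segalFunctor p n 1).obj x ⟶ (segalFunctor p n 1).obj y :=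
    { fst := u
      snd := v
      w := Subsingleton.elim _ _ }
  obtain ⟨φ, hφ⟩ := (segalFunctor p n 1).map_surjective w
  have hφ' := φ.2
  refine ⟨φ, ?_, ?_⟩
  · have h : IsCartesian.map p (initialSegment n 1) (pullbackMap y.2 _)
        (pullbackMap x.2 _ ≫ φ.1) = u.1 :=
      congrArg (fun f => f.fst.1) hφ
    rw [← h]
    exact (IsCartesian.fac p (initialSegment n 1) (pullbackMap y.2 _) _).symm
  · have h : IsCartesian.map p (terminalSegment n 1) (pullbackMap y.2 _)
        (pullbackMap x.2 _ ≫ φ.1) = v.1 :=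
      congrArg (fun f => f.snd.1) hφ
    rw [← h]
    exact (IsCartesian.fac p (terminalSegment n 1) (pullbackMap y.2 _) _).symm

omit hd in
theorem exists_fiber_obj {n : ℕ} (a : p.Fiber ⦋n⦌) (b : p.Fiber ⦋1⦌)
    (h : (transition p (SimplexCategory.const ⦋0⦌ ⦋n⦌ (Fin.last n))).obj a =
      (transition p (SimplexCategory.const ⦋0⦌ ⦋1⦌ 0)).obj b) :
    ∃ x : p.Fiber ⦋n + 1⦌, Nonempty ((transition p (initialSegment n 1)).obj x ≅ a) ∧
      Nonempty ((transition p (terminalSegment n 1)).obj x ≅ b) := by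
  have := hs.isEquivalence n
  let z : Limits.CategoricalPullback
      (transition p (SimplexCategory.const ⦋0⦌ ⦋n⦌ (Fin.last n)))
      (transition p (SimplexCategory.const ⦋0⦌ ⦋1⦌ 0)) := ⟨a, b, eqToIso h⟩
  let e := (segalFunctor p n 1).objObjPreimageIso z
  exact ⟨(segalFunctor p n 1).objPreimage z,
    ⟨(Limits.CategoricalPullback.π₁ _ _).mapIso e⟩,
    ⟨(Limits.CategoricalPullback.π₂ _ _).mapIso e⟩⟩

end SegalCondition

/-! ### Gluing a simplex and an edge along a vertex. -/

namespace Framed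

variable {E : Type u₁} [Category.{v₁} E] {p : E ⥤ SimplexCategory}

/-- `X` is glued from its initial segment `A` and its last edge `B`. -/
structure IsGluing {A B X : Framed p} (s : A ⟶ X) (t : B ⟶ X) : Prop where
  cart_left : Cart s
  cart_right : Cart t
  len_left : A.len + 1 = X.len
  len_right : B.len = 1
  base_left (i) : (base s i).val = i.val
  base_right (i) : (base t i).val = i.val + A.len

variable [hp : p.IsFibered]

/-- The order-preserving map onto the initial segment. -/
def initialHom (n : ℕ) : Fin (n + 1) →o Fin (n + 1 + 1) :=
  (initialSegment n 1).toOrderHom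

/-- The order-preserving map onto the last edge. -/
def terminalHom (n : ℕ) : Fin (1 + 1) →o Fin (n + 1 + 1) :=
  (terminalSegment n 1).toOrderHom

theorem isGluing_pullMap {n : ℕ} (x : p.Fiber ⦋n + 1⦌) (v) (hv) :
    IsGluing (pullMap ⟨n + 1, x, v, hv⟩ (initialHom n))
      (pullMap ⟨n + 1, x, v, hv⟩ (terminalHom n)) where
  cart_left := cart_pullMap _ _
  cart_right := cart_pullMap _ _
  len_left := rfl
  len_right := rfl
  base_left _ := rfl
  base_right _ := rfl

namespace IsGluing

variable {A B X Y : Framed p} {s : A ⟶ X} {t : B ⟶ X}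

/-- Factoring both morphisms through the pullback of `Y` along their common base reduces the claim
to one fiber, where it is faithfulness of the Segal functor. -/
theorem hom_ext [hs : IsSegal p] (h : IsGluing s t) {φ ψ : X ⟶ Y}
    (hb : ∀ i, base φ i = base ψ i)
    (h₁ : s ≫ φ = s ≫ ψ) (h₂ : t ≫ φ = t ≫ ψ) : φ = ψ := by
  obtain ⟨cs, ct, l₁, l₂, bs, bt⟩ := h
  obtain ⟨n, x, v, hv⟩ := X
  obtain ⟨m, a, va, ha⟩ := A
  obtain ⟨k, b, vb, hvb⟩ := B
  dsimp at l₁ l₂ bs bt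
  subst l₁ l₂
  let X : Framed p := ⟨m + 1, x, v, hv⟩
  let i₀ := X.pullMap (initialHom m)
  let t₀ := X.pullMap (terminalHom m)
  -- The Segal functor uses the cleavage, so the hypothesis is moved from the given cartesian `s` to
  -- the chosen pullback over the same map.
  have e₁ : i₀ ≫ φ = i₀ ≫ ψ :=
    cs.comp_eq_of_comp_eq (κ' := i₀) OrderHom.id (fun i => Fin.ext (bs i)) h₁
  have e₂ : t₀ ≫ φ = t₀ ≫ ψ :=
    ct.comp_eq_of_comp_eq (κ' := t₀) OrderHom.id (fun i => Fin.ext (bt i)) h₂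
  have c := Y.cart_pullMap (base φ)
  let φ' := c.lift φ OrderHom.id (fun _ => rfl)
  let ψ' := c.lift ψ OrderHom.id (fun i => hb i)
  have eφ : φ' ≫ pullMap _ _ = φ := c.lift_comp _ _ _
  have eψ : ψ' ≫ pullMap _ _ = ψ := c.lift_comp _ _ _
  have bφ : base φ' = OrderHom.id := c.lift_base _ _ _
  have bψ : base ψ' = OrderHom.id := c.lift_base _ _ _
  have key : φ' = ψ' := by
    let y : p.Fiber ⦋m + 1⦌ := (Y.pull (base φ)).obj
    have hφ := φ'.lift
    have hψ := ψ'.lift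
    have bφ' := bφ
    have bψ' := bψ
    change Hom.base φ' = _ at bφ
    change Hom.base ψ' = _ at bψ
    rw [bφ] at hφ
    rw [bψ] at hψ
    let φ₁ : x ⟶ y := ⟨φ'.hom, hφ⟩
    let ψ₁ : x ⟶ y := ⟨ψ'.hom, hψ⟩
    have : φ₁ = ψ₁ := by
      apply fiber_hom_ext
      · refine congrArg Hom.hom (c.ext (χ := i₀ ≫ φ') (χ' := i₀ ≫ ψ') ?_ ?_)
        · rw [base_comp, base_comp, bφ', bψ']; exact fun _ => rfl
        · rw [Category.assoc, Category.assoc, eφ, eψ, e₁]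
      · refine congrArg Hom.hom (c.ext (χ := t₀ ≫ φ') (χ' := t₀ ≫ ψ') ?_ ?_)
        · rw [base_comp, base_comp, bφ', bψ']; exact fun _ => rfl
        · rw [Category.assoc, Category.assoc, eφ, eψ, e₂]
    exact Framed.hom_ext (congrArg Subtype.val this)
  rw [← eφ, ← eψ, key]

/-- Fullness of the Segal functor applied between `X` and the pullback of `Y` along `f`. -/
theorem exists_lift [hs : IsSegal p] [hd : IsDiscrete (p.Fiber ⦋0⦌)] (h : IsGluing s t)
    (f : Fin (X.len + 1) →o Fin (Y.len + 1))
    (u : A ⟶ Y) (v : B ⟶ Y) (hu : ∀ i, base u i = f (base s i))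
    (hv : ∀ i, base v i = f (base t i)) :
    ∃ φ : X ⟶ Y, base φ = f ∧ s ≫ φ = u ∧ t ≫ φ = v := by
  obtain ⟨cs, ct, l₁, l₂, bs, bt⟩ := h
  obtain ⟨n, x, vx, hvx⟩ := X
  obtain ⟨m, a, va, ha⟩ := A
  obtain ⟨k, b, vb, hvb⟩ := B
  dsimp at l₁ l₂ bs bt
  subst l₁ l₂
  let X : Framed p := ⟨m + 1, x, vx, hvx⟩
  let Z := Y.pull (m := m + 1) f
  let y : p.Fiber ⦋m + 1⦌ := Z.obj
  have cY : Cart (Y.pullMap (m := m + 1) f) := Y.cart_pullMap f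
  have ci : Cart (Z.pullMap (initialHom m)) := Z.cart_pullMap _
  have ct' : Cart (Z.pullMap (terminalHom m)) := Z.cart_pullMap _
  let i₀ := X.pullMap (initialHom m)
  let t₀ := X.pullMap (terminalHom m)
  have hi : ∀ i, base s i = initialHom m i := fun i => Fin.ext (bs i)
  have ht : ∀ i, base t i = terminalHom m i := fun i => Fin.ext (bt i)
  -- The pieces `s`, `t` and the pieces `i₀`, `t₀` of the cleavage are cartesian over the same maps.
  -- The data are carried to the latter by `i₁`, `t₁`, and the answer is carried back by `s₁`, `t₂`.
  obtain ⟨i₁, bi₁, ei₁⟩ := cs.exists_lift i₀ OrderHom.id hi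
  obtain ⟨t₁, bt₁, et₁⟩ := ct.exists_lift t₀ OrderHom.id ht
  have ci₀ : Cart i₀ := X.cart_pullMap _
  have ct₀ : Cart t₀ := X.cart_pullMap _
  obtain ⟨s₁, bs₁, es₁⟩ := ci₀.exists_lift s OrderHom.id (fun i => (hi i).symm)
  obtain ⟨t₂, bt₂, et₂⟩ := ct₀.exists_lift t OrderHom.id (fun i => (ht i).symm)
  obtain ⟨u₁, bu₁, eu₁⟩ := (ci.comp cY).exists_lift (i₁ ≫ u) OrderHom.id
    (fun i => ((hu _).trans (congrArg f ((congrArg (base s) (bi₁ i)).trans (hi i)))).symm)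
  obtain ⟨v₁, bv₁, ev₁⟩ := (ct'.comp cY).exists_lift (t₁ ≫ v) OrderHom.id
    (fun i => ((hv _).trans (congrArg f ((congrArg (base t) (bt₁ i)).trans (ht i)))).symm)
  let u₂ : (transition p (initialSegment m 1)).obj x ⟶
      (transition p (initialSegment m 1)).obj y := ⟨u₁.hom, by
    have h₁ := u₁.lift
    have h₂ : Hom.base u₁ = OrderHom.id := OrderHom.ext _ _ (funext bu₁)
    rw [h₂] at h₁
    exact h₁⟩
  let v₂ : (transition p (terminalSegment m 1)).obj x ⟶
      (transition p (terminalSegment m 1)).obj y := ⟨v₁.hom, by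
    have h₁ := v₁.lift
    have h₂ : Hom.base v₁ = OrderHom.id := OrderHom.ext _ _ (funext bv₁)
    rw [h₂] at h₁
    exact h₁⟩
  obtain ⟨φ, h₁, h₂⟩ := exists_fiber_hom u₂ v₂
  let φ₁ : X ⟶ Z := ⟨OrderHom.id, φ.1, φ.2⟩
  have k₁ : i₀ ≫ φ₁ = u₁ ≫ Z.pullMap (initialHom m) := Framed.hom_ext h₁
  have k₂ : t₀ ≫ φ₁ = v₁ ≫ Z.pullMap (terminalHom m) := Framed.hom_ext h₂
  refine ⟨φ₁ ≫ Y.pullMap (m := m + 1) f, rfl, ?_, ?_⟩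
  · have e₁ : i₀ ≫ φ₁ ≫ Y.pullMap (m := m + 1) f = i₁ ≫ u := by
      rw [← Category.assoc, k₁, Category.assoc]
      exact eu₁
    rw [← es₁, Category.assoc, e₁, ← Category.assoc]
    have : s₁ ≫ i₁ = 𝟙 _ := cs.ext (fun i => (bi₁ _).trans (bs₁ i))
      (by rw [Category.assoc, ei₁, es₁, Category.id_comp])
    rw [this, Category.id_comp]
  · have e₁ : t₀ ≫ φ₁ ≫ Y.pullMap (m := m + 1) f = t₁ ≫ v := by
      rw [← Category.assoc, k₂, Category.assoc]
      exact ev₁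
    rw [← et₂, Category.assoc, e₁, ← Category.assoc]
    have : t₂ ≫ t₁ = 𝟙 _ := ct.ext (fun i => (bt₁ _).trans (bt₂ i))
      (by rw [Category.assoc, et₁, et₂, Category.id_comp])
    rw [this, Category.id_comp]

/-- The pullback of `Y` along the base of `φ` is glued from the same two pieces, so the comparison
`χ` is an isomorphism. -/
theorem cart [hs : IsSegal p] [hd : IsDiscrete (p.Fiber ⦋0⦌)] (h : IsGluing s t) {φ : X ⟶ Y}
    (hu : Cart (s ≫ φ)) (hv : Cart (t ≫ φ)) : Cart φ := by
  have c := Y.cart_pullMap (base φ)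
  let χ := c.lift φ OrderHom.id (fun _ => rfl)
  have e : χ ≫ Y.pullMap (base φ) = φ := c.lift_comp _ _ _
  have bχ : base χ = OrderHom.id := c.lift_base _ _ _
  have h' : IsGluing (s ≫ χ) (t ≫ χ) :=
    { cart_left := c.of_comp (by rw [Category.assoc, e]; exact hu)
      cart_right := c.of_comp (by rw [Category.assoc, e]; exact hv)
      len_left := h.len_left
      len_right := h.len_right
      base_left := fun i => by rw [base_comp, bχ]; exact h.base_left i
      base_right := fun i => by rw [base_comp, bχ]; exact h.base_right i }
  obtain ⟨θ, h₁, h₂, h₃⟩ := h'.exists_lift (Y := X) OrderHom.id s t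
    (fun i => by rw [base_comp, bχ]; rfl) (fun i => by rw [base_comp, bχ]; rfl)
  have hχ : IsIso χ := ⟨θ, h.hom_ext (fun i => by rw [base_comp, bχ, h₁]; rfl)
    (by rw [← Category.assoc, h₂, Category.comp_id])
    (by rw [← Category.assoc, h₃, Category.comp_id]),
    h'.hom_ext (fun i => by rw [base_comp, bχ, h₁]; rfl)
    (by rw [← Category.assoc, h₂, Category.comp_id])
    (by rw [← Category.assoc, h₃, Category.comp_id])⟩
  rw [← e]
  exact (Cart.of_isIso χ).comp c

end IsGluing

namespace IsGluing

variable {A B X Y : Framed p} {s : A ⟶ X} {t : B ⟶ X}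

omit hp in
theorem base_right_zero (h : IsGluing s t) : base s (Fin.last _) = base t 0 :=
  Fin.ext (by rw [h.base_left, h.base_right]; simp)

omit hp in
theorem forall_iff (h : IsGluing s t) {P : Fin (X.len + 1) → Prop} :
    (∀ i, P i) ↔ (∀ i, P (base s i)) ∧ ∀ i, P (base t i) := by
  refine ⟨fun H => ⟨fun i => H _, fun i => H _⟩, fun H i => ?_⟩
  by_cases hi : i.val ≤ A.len
  · have : i = base s ⟨i.val, by omega⟩ := Fin.ext (by rw [h.base_left])
    rw [this]; exact H.1 _
  · have h₁ := h.len_left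
    have h₂ := h.len_right
    have : i = base t ⟨1, by omega⟩ := Fin.ext (by rw [h.base_right]; simp only; omega)
    rw [this]; exact H.2 _

theorem ext [hs : IsSegal p] (h : IsGluing s t) {φ ψ : X ⟶ Y}
    (h₁ : s ≫ φ = s ≫ ψ) (h₂ : t ≫ φ = t ≫ ψ) : φ = ψ := by
  refine h.hom_ext ?_ h₁ h₂
  exact h.forall_iff.2 ⟨fun i => congrArg (fun f => base f i) h₁,
    fun i => congrArg (fun f => base f i) h₂⟩

/-- The form of the Segal condition used from here on: together with `ext`, it makes `X` the pushout
of `A` and `B` along their common vertex. -/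
theorem exists_desc [hs : IsSegal p] [hd : IsDiscrete (p.Fiber ⦋0⦌)] (h : IsGluing s t)
    (u : A ⟶ Y) (v : B ⟶ Y) (huv : base u (Fin.last _) = base v 0) :
    ∃ φ : X ⟶ Y, s ≫ φ = u ∧ t ≫ φ = v := by
  have l₁ := h.len_left
  have l₂ := h.len_right
  -- The only vertex of `X` outside `A` is the last one, which is vertex `1` of the edge `B`;
  -- monotonicity across the seam is `huv`.
  let f : Fin (X.len + 1) →o Fin (Y.len + 1) :=
    { toFun := fun i => if hi : i.val ≤ A.len then base u ⟨i.val, by omega⟩ else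
        base v ⟨1, by omega⟩
      monotone' := by
        intro i j hij
        have hij' : i.val ≤ j.val := hij
        dsimp only
        split_ifs with h₁ h₂
        · exact (base u).monotone hij'
        · refine ((base u).monotone (Fin.le_last _)).trans ?_
          rw [huv]
          exact (base v).monotone (Fin.zero_le _)
        · omega
        · exact le_rfl }
  have hf : ∀ i (hi : i.val ≤ A.len), f i = base u ⟨i.val, by omega⟩ := fun i hi => dif_pos hi
  have hf' : ∀ i, ¬ i.val ≤ A.len → f i = base v ⟨1, by omega⟩ := fun i hi => dif_neg hi
  clear_value f
  have hu : ∀ i, base u i = f (base s i) := by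
    intro i
    rw [hf _ (by rw [h.base_left]; omega)]
    exact congrArg (base u) (Fin.ext (h.base_left i).symm)
  have hv : ∀ i, base v i = f (base t i) := by
    intro i
    by_cases hi : i.val = 0
    · obtain rfl : i = 0 := Fin.ext hi
      rw [hf _ (by rw [h.base_right]; simp), ← huv]
      exact congrArg (base u) (Fin.ext (by simp [h.base_right]))
    · rw [hf' _ (by rw [h.base_right]; omega)]
      exact congrArg (base v) (Fin.ext (by change i.val = 1; omega))
  obtain ⟨φ, -, h₂, h₃⟩ := h.exists_lift f u v hu hv
  exact ⟨φ, h₂, h₃⟩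

end IsGluing

/-- Essential surjectivity of the Segal functor. The restrictions of `x` are only isomorphic to the
given pieces, but composing the pullback maps with isomorphisms keeps them cartesian. -/
theorem exists_gluing [hs : IsSegal p] [hd : IsDiscrete (p.Fiber ⦋0⦌)] (A B : Framed p)
    (hB : B.len = 1) (hv : A.vtx (Fin.last _) = B.vtx 0) :
    ∃ (X : Framed p) (s : A ⟶ X) (t : B ⟶ X), IsGluing s t := by
  obtain ⟨m, a, va, ha⟩ := A
  obtain ⟨k, b, vb, hvb⟩ := B
  dsimp at hB
  subst hB
  obtain ⟨x, ⟨e₁⟩, ⟨e₂⟩⟩ := exists_fiber_obj (p := p) (n := m) a b (by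
    have h₁ : va (Fin.last m) =
        (transition p (SimplexCategory.const ⦋0⦌ ⦋m⦌ (Fin.last m))).obj a :=
      IsVertex.unique (ha _) ⟨_, pullbackMap_isHomLift a _⟩
    have h₂ : vb 0 = (transition p (SimplexCategory.const ⦋0⦌ ⦋1⦌ 0)).obj b :=
      IsVertex.unique (hvb _) ⟨_, pullbackMap_isHomLift b _⟩
    rw [← h₁, ← h₂]
    exact hv)
  have hw : ∀ i, ∃ w, IsVertex p x i w := fun i =>
    ⟨(transition p (SimplexCategory.const ⦋0⦌ ⦋m + 1⦌ i)).obj x,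
      _, pullbackMap_isHomLift x _⟩
  choose w hw using hw
  let X : Framed p := ⟨m + 1, x, w, hw⟩
  let s₀ : (⟨m, a, va, ha⟩ : Framed p) ⟶ X.pull (initialHom m) := ⟨OrderHom.id, e₁.inv.1, e₁.inv.2⟩
  let s₁ : X.pull (initialHom m) ⟶ (⟨m, a, va, ha⟩ : Framed p) := ⟨OrderHom.id, e₁.hom.1, e₁.hom.2⟩
  let t₀ : (⟨1, b, vb, hvb⟩ : Framed p) ⟶ X.pull (terminalHom m) :=
    ⟨OrderHom.id, e₂.inv.1, e₂.inv.2⟩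
  let t₁ : X.pull (terminalHom m) ⟶ (⟨1, b, vb, hvb⟩ : Framed p) :=
    ⟨OrderHom.id, e₂.hom.1, e₂.hom.2⟩
  have is : IsIso s₀ := ⟨s₁, hom_ext (congrArg Subtype.val e₁.inv_hom_id),
    hom_ext (congrArg Subtype.val e₁.hom_inv_id)⟩
  have it : IsIso t₀ := ⟨t₁, hom_ext (congrArg Subtype.val e₂.inv_hom_id),
    hom_ext (congrArg Subtype.val e₂.hom_inv_id)⟩
  exact ⟨X, s₀ ≫ X.pullMap (initialHom m), t₀ ≫ X.pullMap (terminalHom m),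
    { cart_left := (Cart.of_isIso s₀).comp (X.cart_pullMap _)
      cart_right := (Cart.of_isIso t₀).comp (X.cart_pullMap _)
      len_left := rfl
      len_right := rfl
      base_left := fun _ => rfl
      base_right := fun _ => rfl }⟩

end Framed

/-- The order-preserving map `[1] → [n]` onto the edge from `i` to `j`. -/
def edgeHom {n : ℕ} (i j : Fin (n + 1)) (h : i ≤ j) : Fin (1 + 1) →o Fin (n + 1) :=
  (SimplexCategory.mkOfLe i j h).toOrderHom

/-- The function on `[1]` with the given values. -/
def vec₂ {α : Type*} (a b : α) : Fin (1 + 1) → α := ![a, b]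

/-! ### Formal composites of edges. -/

section Chains

variable {E : Type u₁} [Category.{v₁} E] (p : E ⥤ SimplexCategory)

/-- Formal composites of 1-morphisms. -/
inductive Chain (a : p.Fiber ⦋0⦌) : p.Fiber ⦋0⦌ → Type u₁ where
  | nil : Chain a a
  /-- Appending an edge. -/
  | snoc {b c : p.Fiber ⦋0⦌} (P : Chain a b) (e : p.Fiber ⦋1⦌) (h₀ : IsVertex p e 0 b)
      (h₁ : IsVertex p e 1 c) : Chain a c

variable {p}

/-- Concatenation of formal composites. -/
def Chain.comp {a b c : p.Fiber ⦋0⦌} (P : Chain p a b) (Q : Chain p b c) : Chain p a c :=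
  match Q with
  | .nil => P
  | .snoc Q e h₀ h₁ => .snoc (P.comp Q) e h₀ h₁

/-- Concatenation recurses on its second factor, so the right unit law holds by definition, while
this law and associativity need induction. -/
theorem Chain.nil_comp {a b : p.Fiber ⦋0⦌} (P : Chain p a b) : (Chain.nil : Chain p a a).comp P = P := by
  induction P with
  | nil => rfl
  | snoc Q e h₀ h₁ ih => exact congrArg (fun R => Chain.snoc R e h₀ h₁) ih

theorem Chain.comp_assoc {a b c d : p.Fiber ⦋0⦌} (P : Chain p a b) (Q : Chain p b c)
    (R : Chain p c d) : (P.comp Q).comp R = P.comp (Q.comp R) := by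
  induction R with
  | nil => rfl
  | snoc R e h₀ h₁ ih => exact congrArg (fun R => Chain.snoc R e h₀ h₁) ih

namespace Framed

/-- An edge with the given vertices. -/
def edge (e : p.Fiber ⦋1⦌) {a b : p.Fiber ⦋0⦌} (h₀ : IsVertex p e 0 a) (h₁ : IsVertex p e 1 b) :
    Framed p where
  len := 1
  obj := e
  vtx := vec₂ a b
  isVertex := Fin.forall_fin_two.2 ⟨h₀, h₁⟩

variable [hp : p.IsFibered]

/-- The pullback of a framed object with another presentation of its vertices. -/
noncomputable def pullAs (X : Framed p) {m : ℕ} (f : Fin (m + 1) →o Fin (X.len + 1))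
    (v : Fin (m + 1) → p.Fiber ⦋0⦌) (hv : ∀ i, X.vtx (f i) = v i) : Framed p where
  len := m
  obj := (X.pull f).obj
  vtx := v
  isVertex i := by rw [← hv]; exact (X.pull f).isVertex i

/-- The cartesian morphism from the pullback. -/
noncomputable def pullAsMap (X : Framed p) {m : ℕ} (f : Fin (m + 1) →o Fin (X.len + 1))
    (v : Fin (m + 1) → p.Fiber ⦋0⦌) (hv : ∀ i, X.vtx (f i) = v i) : X.pullAs f v hv ⟶ X :=
  ⟨(X.pullMap f).base, (X.pullMap f).hom, (X.pullMap f).lift⟩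

theorem cart_pullAsMap (X : Framed p) {m : ℕ} (f : Fin (m + 1) →o Fin (X.len + 1))
    (v : Fin (m + 1) → p.Fiber ⦋0⦌) (hv : ∀ i, X.vtx (f i) = v i) :
    Cart (X.pullAsMap f v hv) :=
  cart_of_isCartesian _ (Functor.IsPreFibered.pullbackMap.IsCartesian X.obj.2
    (SimplexCategory.mkHom f))

end Framed

end Chains

/-! ### The simplex of a chain and the embeddings of its two segments. -/

namespace Chain

open Framed

variable {E : Type u₁} [Category.{v₁} E] {p : E ⥤ SimplexCategory}
  [hp : p.IsFibered] [hs : IsSegal p] [hd : IsDiscrete (p.Fiber ⦋0⦌)]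

/-- The chosen simplex with the given edges. -/
noncomputable def simplexAux {a b : p.Fiber ⦋0⦌} (P : Chain p a b) :
    { X : Framed p // X.vtx 0 = a ∧ X.vtx (Fin.last _) = b } :=
  match P with
  | .nil => ⟨point p a, rfl, rfl⟩
  | .snoc P e h₀ h₁ =>
    let H := exists_gluing P.simplexAux.1 (edge e h₀ h₁) rfl P.simplexAux.2.2
    ⟨H.choose, by
      obtain ⟨s, t, ht⟩ := H.choose_spec
      refine (congrArg H.choose.vtx ?_).trans ((vtx_eq s 0).symm.trans P.simplexAux.2.1)
      exact Fin.ext (ht.base_left 0).symm, by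
      obtain ⟨s, t, ht⟩ := H.choose_spec
      refine (congrArg H.choose.vtx ?_).trans (vtx_eq t (1 : Fin (1 + 1))).symm
      refine Fin.ext (Eq.trans ?_ (ht.base_right (1 : Fin (1 + 1))).symm)
      exact ht.len_left.symm.trans (add_comm _ _)⟩

/-- The chosen simplex with the given edges. -/
noncomputable def simplex {a b : p.Fiber ⦋0⦌} (P : Chain p a b) : Framed p := P.simplexAux.1

theorem simplex_vtx_zero {a b : p.Fiber ⦋0⦌} (P : Chain p a b) : P.simplex.vtx 0 = a :=
  P.simplexAux.2.1

theorem simplex_vtx_last {a b : p.Fiber ⦋0⦌} (P : Chain p a b) :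
    P.simplex.vtx (Fin.last _) = b := P.simplexAux.2.2

section

variable {a b c : p.Fiber ⦋0⦌} (P : Chain p a b) (e : p.Fiber ⦋1⦌) (h₀ : IsVertex p e 0 b)
  (h₁ : IsVertex p e 1 c)

theorem exists_isGluing : ∃ (s : P.simplex ⟶ (P.snoc e h₀ h₁).simplex)
    (t : edge e h₀ h₁ ⟶ (P.snoc e h₀ h₁).simplex), IsGluing s t :=
  (exists_gluing P.simplex (edge e h₀ h₁) rfl P.simplexAux.2.2).choose_spec

/-- The embedding of the initial segment. -/
noncomputable def snocInl : P.simplex ⟶ (P.snoc e h₀ h₁).simplex :=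
  (exists_isGluing P e h₀ h₁).choose

/-- The embedding of the last edge. -/
noncomputable def snocInr : edge e h₀ h₁ ⟶ (P.snoc e h₀ h₁).simplex :=
  (exists_isGluing P e h₀ h₁).choose_spec.choose

theorem isGluing_snoc : IsGluing (snocInl P e h₀ h₁) (snocInr P e h₀ h₁) :=
  (exists_isGluing P e h₀ h₁).choose_spec.choose_spec

end

/-- The embedding of an initial segment. -/
noncomputable def inl {a b c : p.Fiber ⦋0⦌} (P : Chain p a b) (Q : Chain p b c) :
    P.simplex ⟶ (P.comp Q).simplex :=
  match Q with
  | .nil => 𝟙 _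
  | .snoc Q e h₀ h₁ => P.inl Q ≫ snocInl (P.comp Q) e h₀ h₁

theorem cart_inl {a b c : p.Fiber ⦋0⦌} (P : Chain p a b) (Q : Chain p b c) : Cart (P.inl Q) := by
  induction Q with
  | nil => exact Cart.id _
  | snoc Q e h₀ h₁ ih => exact ih.comp (isGluing_snoc (P.comp Q) e h₀ h₁).cart_left

theorem base_inl_val {a b c : p.Fiber ⦋0⦌} (P : Chain p a b) (Q : Chain p b c) (i) :
    (base (P.inl Q) i).val = i.val := by
  induction Q with
  | nil => rfl
  | snoc Q e h₀ h₁ ih => exact ((isGluing_snoc (P.comp Q) e h₀ h₁).base_left _).trans ih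

/-- The embedding of a terminal segment, with its properties. -/
theorem exists_inr_snoc {a b c d : p.Fiber ⦋0⦌} (P : Chain p a b) (Q : Chain p b c)
    (e : p.Fiber ⦋1⦌) (h₀ : IsVertex p e 0 c) (h₁ : IsVertex p e 1 d)
    (f : Q.simplex ⟶ (P.comp Q).simplex) (hf : base f (Fin.last _) = Fin.last _) :
    ∃ φ : (Q.snoc e h₀ h₁).simplex ⟶ ((P.comp Q).snoc e h₀ h₁).simplex,
      snocInl Q e h₀ h₁ ≫ φ = f ≫ snocInl (P.comp Q) e h₀ h₁ ∧
      snocInr Q e h₀ h₁ ≫ φ = snocInr (P.comp Q) e h₀ h₁ := by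
  refine (isGluing_snoc Q e h₀ h₁).exists_desc _ _ ?_
  rw [← (isGluing_snoc (P.comp Q) e h₀ h₁).base_right_zero, ← hf]
  rfl

omit hp hs hd in
theorem isGluing_base_last {A X : Framed p} {e : p.Fiber ⦋1⦌} {a b : p.Fiber ⦋0⦌}
    {h₀ : IsVertex p e 0 a} {h₁ : IsVertex p e 1 b} {s : A ⟶ X} {t : edge e h₀ h₁ ⟶ X}
    (h : IsGluing s t) : base t (Fin.last _) = Fin.last _ := by
  refine Fin.ext ?_
  rw [h.base_right]
  have := h.len_left
  simp only [edge, Fin.val_last]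
  omega

/-- The embedding of a terminal segment, with its value at the last vertex. -/
noncomputable def inrAux {a b c : p.Fiber ⦋0⦌} (P : Chain p a b) (Q : Chain p b c) :
    { f : Q.simplex ⟶ (P.comp Q).simplex // base f (Fin.last _) = Fin.last _ } :=
  match Q with
  | .nil => ⟨vertex P.simplex (Fin.last _) P.simplex_vtx_last, base_vertex _ _ _ _⟩
  | .snoc Q e h₀ h₁ =>
    -- Appending an edge is possible only if the embedding built so far ends at the last vertex;
    -- hence the recursion carries this property along.
    let H := exists_inr_snoc P Q e h₀ h₁ (P.inrAux Q).1 (P.inrAux Q).2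
    ⟨H.choose, by
      rw [← isGluing_base_last (isGluing_snoc Q e h₀ h₁)]
      exact (congrArg (fun f => base f (Fin.last _)) H.choose_spec.2).trans
        (isGluing_base_last (isGluing_snoc (P.comp Q) e h₀ h₁))⟩

/-- The embedding of a terminal segment. -/
noncomputable def inr {a b c : p.Fiber ⦋0⦌} (P : Chain p a b) (Q : Chain p b c) :
    Q.simplex ⟶ (P.comp Q).simplex := (P.inrAux Q).1

theorem base_inr_last {a b c : p.Fiber ⦋0⦌} (P : Chain p a b) (Q : Chain p b c) :
    base (P.inr Q) (Fin.last _) = Fin.last _ := (P.inrAux Q).2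

section

variable {a b c d : p.Fiber ⦋0⦌} (P : Chain p a b) (Q : Chain p b c) (e : p.Fiber ⦋1⦌)
  (h₀ : IsVertex p e 0 c) (h₁ : IsVertex p e 1 d)

theorem snocInl_inr : snocInl Q e h₀ h₁ ≫ P.inr (Q.snoc e h₀ h₁) =
    P.inr Q ≫ snocInl (P.comp Q) e h₀ h₁ :=
  (exists_inr_snoc P Q e h₀ h₁ (P.inrAux Q).1 (P.inrAux Q).2).choose_spec.1

theorem snocInr_inr : snocInr Q e h₀ h₁ ≫ P.inr (Q.snoc e h₀ h₁) =
    snocInr (P.comp Q) e h₀ h₁ :=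
  (exists_inr_snoc P Q e h₀ h₁ (P.inrAux Q).1 (P.inrAux Q).2).choose_spec.2

end

/-- A morphism out of a point is cartesian, and cartesianness of a morphism out of a glued simplex
is checked on its pieces. -/
theorem cart_inr {a b c : p.Fiber ⦋0⦌} (P : Chain p a b) (Q : Chain p b c) : Cart (P.inr Q) := by
  induction Q with
  | nil => exact cart_of_len_eq_zero rfl _
  | snoc Q e h₀ h₁ ih =>
    refine (isGluing_snoc Q e h₀ h₁).cart ?_ ?_
    · rw [snocInl_inr]
      exact ih.comp (isGluing_snoc (P.comp Q) e h₀ h₁).cart_left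
    · rw [snocInr_inr]
      exact (isGluing_snoc (P.comp Q) e h₀ h₁).cart_right

theorem base_inr_zero {a b c : p.Fiber ⦋0⦌} (P : Chain p a b) (Q : Chain p b c) :
    base (P.inr Q) 0 = base (P.inl Q) (Fin.last _) := by
  induction Q with
  | nil => exact base_vertex P.simplex (Fin.last _) P.simplex_vtx_last 0
  | snoc Q e h₀ h₁ ih =>
    have h := congrArg (fun f => base f 0) (snocInl_inr P Q e h₀ h₁)
    have h0 : base (snocInl Q e h₀ h₁) 0 = 0 := Fin.ext ((isGluing_snoc Q e h₀ h₁).base_left 0)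
    change base (P.inr (Q.snoc e h₀ h₁)) (base (snocInl Q e h₀ h₁) 0) =
      base (snocInl (P.comp Q) e h₀ h₁) (base (P.inr Q) 0) at h
    rw [h0, ih] at h
    exact h

/-- The identification of the simplices of equal chains. -/
noncomputable def assocMap {a b c d : p.Fiber ⦋0⦌} (P : Chain p a b) (Q : Chain p b c)
    (R : Chain p c d) : ((P.comp Q).comp R).simplex ⟶ (P.comp (Q.comp R)).simplex :=
  eqToHom (congrArg simplex (comp_assoc P Q R))

theorem snocInl_eqToHom {a c d : p.Fiber ⦋0⦌} {S S' : Chain p a c} (h : S = S') (e : p.Fiber ⦋1⦌)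
    (h₀ : IsVertex p e 0 c) (h₁ : IsVertex p e 1 d) :
    snocInl S e h₀ h₁ ≫ eqToHom (congrArg (fun S => (S.snoc e h₀ h₁).simplex) h) =
      eqToHom (congrArg simplex h) ≫ snocInl S' e h₀ h₁ := by
  subst h
  simp

theorem snocInr_eqToHom {a c d : p.Fiber ⦋0⦌} {S S' : Chain p a c} (h : S = S') (e : p.Fiber ⦋1⦌)
    (h₀ : IsVertex p e 0 c) (h₁ : IsVertex p e 1 d) :
    snocInr S e h₀ h₁ ≫ eqToHom (congrArg (fun S => (S.snoc e h₀ h₁).simplex) h) =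
      snocInr S' e h₀ h₁ := by
  subst h
  simp

section

variable {a b c d d' : p.Fiber ⦋0⦌} (P : Chain p a b) (Q : Chain p b c) (R : Chain p c d)
  (e : p.Fiber ⦋1⦌) (h₀ : IsVertex p e 0 d) (h₁ : IsVertex p e 1 d')

theorem snocInl_assocMap : snocInl ((P.comp Q).comp R) e h₀ h₁ ≫ assocMap P Q (R.snoc e h₀ h₁) =
    assocMap P Q R ≫ snocInl (P.comp (Q.comp R)) e h₀ h₁ :=
  snocInl_eqToHom (comp_assoc P Q R) e h₀ h₁

theorem snocInr_assocMap : snocInr ((P.comp Q).comp R) e h₀ h₁ ≫ assocMap P Q (R.snoc e h₀ h₁) =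
    snocInr (P.comp (Q.comp R)) e h₀ h₁ :=
  snocInr_eqToHom (comp_assoc P Q R) e h₀ h₁

end

theorem comp_eq₃ {C : Type*} [Category C] {x y z w w' : C} (f : x ⟶ y) {g : y ⟶ z} {h : z ⟶ w}
    {g' : y ⟶ w'} {h' : w' ⟶ w} (e : g ≫ h = g' ≫ h') : (f ≫ g) ≫ h = (f ≫ g') ≫ h' := by
  rw [Category.assoc, e, Category.assoc]

/-- This and the next two lemmas treat the initial, middle and final segment of a triple
concatenation: its two bracketings give the same embedding up to transport along `comp_assoc`. The
last chain is built up edge by edge. -/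
theorem inl_comp {a b c d : p.Fiber ⦋0⦌} (P : Chain p a b) (Q : Chain p b c) (R : Chain p c d) :
    P.inl (Q.comp R) = (P.inl Q ≫ (P.comp Q).inl R) ≫ assocMap P Q R := by
  induction R with
  | nil => exact ((congrArg (· ≫ 𝟙 _) (Category.comp_id _)).trans (Category.comp_id _)).symm
  | snoc R e h₀ h₁ ih =>
    refine (congrArg (· ≫ snocInl (P.comp (Q.comp R)) e h₀ h₁) ih).trans ?_
    refine (comp_eq₃ (P.inl Q ≫ (P.comp Q).inl R) (snocInl_assocMap P Q R e h₀ h₁)).symm.trans ?_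
    exact congrArg (· ≫ assocMap P Q (R.snoc e h₀ h₁)) (Category.assoc _ _ _)

theorem inl_inr {a b c d : p.Fiber ⦋0⦌} (P : Chain p a b) (Q : Chain p b c) (R : Chain p c d) :
    (P.inr Q ≫ (P.comp Q).inl R) ≫ assocMap P Q R = Q.inl R ≫ P.inr (Q.comp R) := by
  induction R with
  | nil =>
    exact (congrArg (· ≫ 𝟙 _) (Category.comp_id _)).trans
      ((Category.comp_id _).trans (Category.id_comp _).symm)
  | snoc R e h₀ h₁ ih =>
    refine (congrArg (· ≫ assocMap P Q (R.snoc e h₀ h₁)) (Category.assoc _ _ _).symm).trans ?_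
    refine (comp_eq₃ (P.inr Q ≫ (P.comp Q).inl R) (snocInl_assocMap P Q R e h₀ h₁)).trans ?_
    refine (congrArg (· ≫ snocInl (P.comp (Q.comp R)) e h₀ h₁) ih).trans ?_
    exact comp_eq₃ (Q.inl R) (snocInl_inr P (Q.comp R) e h₀ h₁).symm

/-- For empty `R` both sides are morphisms from a point to the last vertex; otherwise they are
compared on the two pieces of the simplex of `R`. -/
theorem inr_inr {a b c d : p.Fiber ⦋0⦌} (P : Chain p a b) (Q : Chain p b c) (R : Chain p c d) :
    (P.comp Q).inr R ≫ assocMap P Q R = Q.inr R ≫ P.inr (Q.comp R) := by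
  induction R with
  | nil =>
    refine hom_ext_of_len_eq_zero rfl fun i => ?_
    refine Eq.trans (b := Fin.last _) ?_ (Eq.symm ?_)
    · exact base_vertex (P.comp Q).simplex (Fin.last _) (P.comp Q).simplex_vtx_last i
    · refine (congrArg (base (P.inr Q))
        (base_vertex Q.simplex (Fin.last _) Q.simplex_vtx_last i)).trans ?_
      exact base_inr_last P Q
  | snoc R e h₀ h₁ ih =>
    refine (isGluing_snoc R e h₀ h₁).ext ?_ ?_
    · refine ((Category.assoc _ _ _).symm.trans (congrArg (· ≫ assocMap P Q (R.snoc e h₀ h₁))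
        (snocInl_inr (P.comp Q) R e h₀ h₁))).trans ?_
      refine (comp_eq₃ _ (snocInl_assocMap P Q R e h₀ h₁)).trans ?_
      refine (congrArg (· ≫ snocInl (P.comp (Q.comp R)) e h₀ h₁) ih).trans ?_
      refine (comp_eq₃ _ (snocInl_inr P (Q.comp R) e h₀ h₁).symm).trans ?_
      exact (congrArg (· ≫ P.inr (Q.comp (R.snoc e h₀ h₁)))
        (snocInl_inr Q R e h₀ h₁)).symm.trans (Category.assoc _ _ _)
    · refine ((Category.assoc _ _ _).symm.trans (congrArg (· ≫ assocMap P Q (R.snoc e h₀ h₁))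
        (snocInr_inr (P.comp Q) R e h₀ h₁))).trans ?_
      refine (snocInr_assocMap P Q R e h₀ h₁).trans ?_
      refine (snocInr_inr P (Q.comp R) e h₀ h₁).symm.trans ?_
      exact (congrArg (· ≫ P.inr (Q.comp (R.snoc e h₀ h₁)))
        (snocInr_inr Q R e h₀ h₁)).symm.trans (Category.assoc _ _ _)

end Chain

/-! ### Composite edges, joins of consecutive edges, associativity and units. -/

namespace Chain

open Framed

variable {E : Type u₁} [Category.{v₁} E] {p : E ⥤ SimplexCategory}
  [hp : p.IsFibered] [hs : IsSegal p] [hd : IsDiscrete (p.Fiber ⦋0⦌)]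

/-- The order-preserving map `[1] → [n]` onto the endpoints. -/
def endsHom (n : ℕ) : Fin (1 + 1) →o Fin (n + 1) := edgeHom 0 (Fin.last n) (Fin.zero_le _)

section

variable {a b c d : p.Fiber ⦋0⦌}

/-- The composite edge of a chain. -/
noncomputable def comps (P : Chain p a b) : Framed p :=
  P.simplex.pullAs (endsHom _) (vec₂ a b)
    (Fin.forall_fin_two.2 ⟨P.simplex_vtx_zero, P.simplex_vtx_last⟩)

/-- The embedding of the composite edge. -/
noncomputable def toSimplex (P : Chain p a b) : P.comps ⟶ P.simplex :=
  P.simplex.pullAsMap (endsHom _) (vec₂ a b)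
    (Fin.forall_fin_two.2 ⟨P.simplex_vtx_zero, P.simplex_vtx_last⟩)

theorem comps_vtx_zero (P : Chain p a b) : P.comps.vtx 0 = a := rfl

theorem comps_vtx_last (P : Chain p a b) : P.comps.vtx (Fin.last _) = b := rfl

theorem cart_toSimplex (P : Chain p a b) : Cart P.toSimplex := cart_pullAsMap _ _ _ _

theorem forall_comps {P : Chain p a b} {q : Fin (P.comps.len + 1) → Prop} (h₀ : q 0)
    (h₁ : q (Fin.last _)) (i) : q i :=
  (Fin.forall_fin_two (p := q)).2 ⟨h₀, h₁⟩ i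

theorem base_inr_toSimplex (P : Chain p a b) (Q : Chain p b c) :
    base (P.toSimplex ≫ P.inl Q) (Fin.last _) = base (Q.toSimplex ≫ P.inr Q) 0 :=
  (base_inr_zero P Q).symm

/-- The two composite edges are glued to a triangle, which maps cartesianly to the simplex of the
concatenation because its two edges do. -/
theorem exists_triangle (P : Chain p a b) (Q : Chain p b c) :
    ∃ (T : Framed p) (s : P.comps ⟶ T) (t : Q.comps ⟶ T) (d : (P.comp Q).comps ⟶ T)
      (τ : T ⟶ (P.comp Q).simplex), IsGluing s t ∧ Cart τ ∧ s ≫ τ = P.toSimplex ≫ P.inl Q ∧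
      t ≫ τ = Q.toSimplex ≫ P.inr Q ∧ d ≫ τ = (P.comp Q).toSimplex ∧ base d 0 = 0 ∧
      base d (Fin.last _) = Fin.last _ := by
  obtain ⟨T, s, t, h⟩ := exists_gluing P.comps Q.comps rfl rfl
  obtain ⟨τ, h₁, h₂⟩ := h.exists_desc _ _ (base_inr_toSimplex P Q)
  have hτ : Cart τ := by
    refine h.cart ?_ ?_
    · rw [h₁]; exact P.cart_toSimplex.comp (cart_inl P Q)
    · rw [h₂]; exact Q.cart_toSimplex.comp (cart_inr P Q)
  have hs0 : base s 0 = 0 := Fin.ext (h.base_left 0)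
  have htl : base t (Fin.last _) = Fin.last _ := by
    refine Fin.ext ((h.base_right _).trans ?_)
    have h₁ := h.len_left
    have h₂ := h.len_right
    simp only [Fin.val_last]
    omega
  have b₀ : base τ 0 = 0 := by
    have := congrArg (fun f => base f 0) h₁
    change base τ (base s 0) = base (P.inl Q) 0 at this
    rw [hs0] at this
    rw [this]
    exact Fin.ext (base_inl_val P Q 0)
  have b₁ : base τ (Fin.last _) = Fin.last _ := by
    have := congrArg (fun f => base f (Fin.last _)) h₂
    change base τ (base t (Fin.last _)) = base (P.inr Q) (Fin.last _) at this
    rw [htl, base_inr_last] at this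
    exact this
  -- The long edge of the simplex has the endpoints of the triangle, so it factors through the
  -- cartesian `τ`; the factorization is the long edge of the triangle.
  obtain ⟨d, h₃, h₄⟩ := hτ.exists_lift (P.comp Q).toSimplex (endsHom _)
    (forall_comps b₀ b₁)
  exact ⟨T, s, t, d, τ, h, hτ, h₁, h₂, h₄, h₃ 0, h₃ (Fin.last _)⟩

section

variable (P : Chain p a b) (Q : Chain p b c)

/-- The triangle witnessing a composition. -/
noncomputable def triangle : Framed p := (exists_triangle P Q).choose

/-- The first edge of the triangle. -/
noncomputable def fstEdge : P.comps ⟶ triangle P Q := (exists_triangle P Q).choose_spec.choose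

/-- The second edge of the triangle. -/
noncomputable def sndEdge : Q.comps ⟶ triangle P Q :=
  (exists_triangle P Q).choose_spec.choose_spec.choose

/-- The long edge of the triangle. -/
noncomputable def diag : (P.comp Q).comps ⟶ triangle P Q :=
  (exists_triangle P Q).choose_spec.choose_spec.choose_spec.choose

/-- The embedding of the triangle. -/
noncomputable def triangleToSimplex : triangle P Q ⟶ (P.comp Q).simplex :=
  (exists_triangle P Q).choose_spec.choose_spec.choose_spec.choose_spec.choose

theorem triangle_spec : IsGluing (fstEdge P Q) (sndEdge P Q) ∧ Cart (triangleToSimplex P Q) ∧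
      fstEdge P Q ≫ triangleToSimplex P Q = P.toSimplex ≫ P.inl Q ∧
      sndEdge P Q ≫ triangleToSimplex P Q = Q.toSimplex ≫ P.inr Q ∧
      diag P Q ≫ triangleToSimplex P Q = (P.comp Q).toSimplex ∧ base (diag P Q) 0 = 0 ∧
      base (diag P Q) (Fin.last _) = Fin.last _ :=
  (exists_triangle P Q).choose_spec.choose_spec.choose_spec.choose_spec.choose_spec

theorem isGluing_triangle : IsGluing (fstEdge P Q) (sndEdge P Q) := (triangle_spec P Q).1

theorem base_fstEdge_zero : base (fstEdge P Q) 0 = 0 :=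
  Fin.ext ((isGluing_triangle P Q).base_left 0)

theorem base_sndEdge_last : base (sndEdge P Q) (Fin.last _) = Fin.last _ := by
  have h := isGluing_triangle P Q
  refine Fin.ext ((h.base_right _).trans ?_)
  have h₁ := h.len_left
  have h₂ := h.len_right
  simp only [Fin.val_last]
  omega

theorem cart_diag : Cart (diag P Q) :=
  (triangle_spec P Q).2.1.of_comp (by
    rw [(triangle_spec P Q).2.2.2.2.1]; exact cart_toSimplex _)

end

variable {P : Chain p a b} {Q : Chain p b c} {Y Z : Framed p}

/-- The morphism from the triangle with the given edges. -/
noncomputable def desc (α : P.comps ⟶ Y) (β : Q.comps ⟶ Y)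
    (h : base α (Fin.last _) = base β 0) : triangle P Q ⟶ Y :=
  ((isGluing_triangle P Q).exists_desc α β h).choose

theorem fstEdge_desc (α : P.comps ⟶ Y) (β : Q.comps ⟶ Y)
    (h : base α (Fin.last _) = base β 0) : fstEdge P Q ≫ desc α β h = α :=
  ((isGluing_triangle P Q).exists_desc α β h).choose_spec.1

theorem sndEdge_desc (α : P.comps ⟶ Y) (β : Q.comps ⟶ Y)
    (h : base α (Fin.last _) = base β 0) : sndEdge P Q ≫ desc α β h = β :=
  ((isGluing_triangle P Q).exists_desc α β h).choose_spec.2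

/-- The composite of two consecutive edges of an object. -/
noncomputable def jn (α : P.comps ⟶ Y) (β : Q.comps ⟶ Y)
    (h : base α (Fin.last _) = base β 0) : (P.comp Q).comps ⟶ Y := diag P Q ≫ desc α β h

theorem jn_eq {α : P.comps ⟶ Y} {β : Q.comps ⟶ Y} (h : base α (Fin.last _) = base β 0)
    (φ : triangle P Q ⟶ Y) (h₁ : fstEdge P Q ≫ φ = α) (h₂ : sndEdge P Q ≫ φ = β) :
    jn α β h = diag P Q ≫ φ :=
  congrArg (diag P Q ≫ ·) ((isGluing_triangle P Q).ext ((fstEdge_desc α β h).trans h₁.symm)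
    ((sndEdge_desc α β h).trans h₂.symm))

theorem jn_congr {α α' : P.comps ⟶ Y} {β β' : Q.comps ⟶ Y} (h : base α (Fin.last _) = base β 0)
    (h₁ : α = α') (h₂ : β = β') : jn α β h = jn α' β' (by rw [← h₁, ← h₂, h]) := by
  subst h₁ h₂; rfl

/-- A morphism out of the triangle is unique once its edges are given, so joins are natural in the
ambient simplex. This permits proving identities of joins in a universal simplex. -/
theorem jn_comp (α : P.comps ⟶ Y) (β : Q.comps ⟶ Y) (h : base α (Fin.last _) = base β 0)
    (g : Y ⟶ Z) : jn α β h ≫ g = jn (α ≫ g) (β ≫ g) (congrArg (base g) h) := by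
  rw [jn_eq (congrArg (base g) h : base (α ≫ g) _ = base (β ≫ g) _) (desc α β h ≫ g)
    (by rw [← Category.assoc, fstEdge_desc]) (by rw [← Category.assoc, sndEdge_desc]), jn,
    Category.assoc]

theorem base_jn_zero (α : P.comps ⟶ Y) (β : Q.comps ⟶ Y) (h : base α (Fin.last _) = base β 0) :
    base (jn α β h) 0 = base α 0 := by
  have h₁ := congrArg (fun f => base f 0) (fstEdge_desc α β h)
  change base (desc α β h) (base (fstEdge P Q) 0) = _ at h₁
  change base (desc α β h) (base (diag P Q) 0) = _
  rw [base_fstEdge_zero] at h₁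
  rw [(triangle_spec P Q).2.2.2.2.2.1]
  exact h₁

theorem base_jn_last (α : P.comps ⟶ Y) (β : Q.comps ⟶ Y) (h : base α (Fin.last _) = base β 0) :
    base (jn α β h) (Fin.last _) = base β (Fin.last _) := by
  have h₁ := congrArg (fun f => base f (Fin.last _)) (sndEdge_desc α β h)
  change base (desc α β h) (base (sndEdge P Q) (Fin.last _)) = _ at h₁
  change base (desc α β h) (base (diag P Q) (Fin.last _)) = _
  rw [base_sndEdge_last] at h₁
  rw [(triangle_spec P Q).2.2.2.2.2.2]
  exact h₁

theorem cart_jn {α : P.comps ⟶ Y} {β : Q.comps ⟶ Y} (h : base α (Fin.last _) = base β 0)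
    (hα : Cart α) (hβ : Cart β) : Cart (jn α β h) := by
  refine (cart_diag P Q).comp ((isGluing_triangle P Q).cart ?_ ?_)
  · rw [fstEdge_desc]; exact hα
  · rw [sndEdge_desc]; exact hβ

/-- Ties joins to the chosen composites. Identities of joins below are reduced to this one inside
the simplex of a chain. -/
theorem jn_toSimplex (P : Chain p a b) (Q : Chain p b c) :
    jn (P.toSimplex ≫ P.inl Q) (Q.toSimplex ≫ P.inr Q) (base_inr_toSimplex P Q) =
      (P.comp Q).toSimplex :=
  (jn_eq _ _ (triangle_spec P Q).2.2.1 (triangle_spec P Q).2.2.2.1).trans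
    (triangle_spec P Q).2.2.2.2.1

/-- The identification of composites of equal chains. -/
noncomputable def congrMap {P P' : Chain p a b} (h : P = P') : P.comps ⟶ P'.comps :=
  eqToHom (congrArg comps h)

theorem base_congrMap {P P' : Chain p a b} (h : P = P') (i) : base (congrMap h) i = i := by
  subst h; rfl

theorem congrMap_toSimplex {P P' : Chain p a b} (h : P = P') :
    congrMap h ≫ P'.toSimplex = P.toSimplex ≫ eqToHom (congrArg simplex h) := by
  subst h; simp [congrMap]

/-- The universal simplex with three consecutive edges of the given types. The cartesian `τ` makes
it possible to test morphisms into it inside the simplex of the chain. -/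
theorem exists_tetrahedron (P : Chain p a b) (Q : Chain p b c) (R : Chain p c d) :
    ∃ (U : Framed p) (s : triangle P Q ⟶ U) (t : R.comps ⟶ U)
      (τ : U ⟶ ((P.comp Q).comp R).simplex), IsGluing s t ∧ Cart τ ∧
      s ≫ τ = triangleToSimplex P Q ≫ (P.comp Q).inl R ∧
      t ≫ τ = R.toSimplex ≫ (P.comp Q).inr R := by
  have hl : base (diag P Q) (Fin.last _) = Fin.last _ := (triangle_spec P Q).2.2.2.2.2.2
  have hv : (triangle P Q).vtx (Fin.last _) = R.comps.vtx 0 := by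
    rw [← hl, ← vtx_eq (diag P Q)]
    rfl
  obtain ⟨U, s, t, h⟩ := exists_gluing (triangle P Q) R.comps rfl hv
  obtain ⟨τ, h₁, h₂⟩ := h.exists_desc (triangleToSimplex P Q ≫ (P.comp Q).inl R)
    (R.toSimplex ≫ (P.comp Q).inr R) (by
      have h₃ := congrArg (fun f => base f (Fin.last _)) (triangle_spec P Q).2.2.2.2.1
      change base (triangleToSimplex P Q) (base (diag P Q) (Fin.last _)) = Fin.last _ at h₃
      rw [hl] at h₃
      change base ((P.comp Q).inl R) (base (triangleToSimplex P Q) _) = base ((P.comp Q).inr R) 0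
      rw [h₃, base_inr_zero])
  refine ⟨U, s, t, τ, h, h.cart ?_ ?_, h₁, h₂⟩
  · rw [h₁]; exact (triangle_spec P Q).2.1.comp (cart_inl _ _)
  · rw [h₂]; exact R.cart_toSimplex.comp (cart_inr _ _)

/-- By `jn_toSimplex` each bracketing is the long edge of the corresponding simplex, and the two
simplices are identified by `comp_assoc`. -/
theorem jn_assoc_simplex (P : Chain p a b) (Q : Chain p b c) (R : Chain p c d)
    {Y : Framed p} (hY : Y = ((P.comp Q).comp R).simplex)
    (α : P.comps ⟶ Y) (β : Q.comps ⟶ Y) (γ : R.comps ⟶ Y)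
    (h₁ : base α (Fin.last _) = base β 0) (h₂ : base β (Fin.last _) = base γ 0) 
    (eα : α ≫ eqToHom hY = P.toSimplex ≫ P.inl Q ≫ (P.comp Q).inl R)
    (eβ : β ≫ eqToHom hY = Q.toSimplex ≫ P.inr Q ≫ (P.comp Q).inl R)
    (eγ : γ ≫ eqToHom hY = R.toSimplex ≫ (P.comp Q).inr R) :
    jn (jn α β h₁) γ ((base_jn_last _ _ _).trans h₂) =
      congrMap (comp_assoc P Q R) ≫ jn α (jn β γ h₂) (h₁.trans (base_jn_zero _ _ _).symm) := by
  subst hY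
  simp only [eqToHom_refl, Category.comp_id] at eα eβ eγ
  have e₁ : jn α β h₁ = (P.comp Q).toSimplex ≫ (P.comp Q).inl R := by
    rw [← jn_toSimplex, jn_comp]
    exact jn_congr _ (eα.trans (Category.assoc _ _ _).symm) (eβ.trans (Category.assoc _ _ _).symm)
  have e₂ : jn (jn α β h₁) γ ((base_jn_last _ _ _).trans h₂) = ((P.comp Q).comp R).toSimplex := by
    rw [← jn_toSimplex]
    exact jn_congr _ e₁ eγ
  have e₃ : jn β γ h₂ ≫ assocMap P Q R = (Q.comp R).toSimplex ≫ P.inr (Q.comp R) := by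
    rw [← jn_toSimplex, jn_comp, jn_comp]
    refine jn_congr _ ?_ ?_
    · rw [eβ, Category.assoc, inl_inr, Category.assoc]
    · rw [eγ, Category.assoc, inr_inr, Category.assoc]
  have e₄ : jn α (jn β γ h₂) (h₁.trans (base_jn_zero _ _ _).symm) ≫ assocMap P Q R =
      (P.comp (Q.comp R)).toSimplex := by
    rw [← jn_toSimplex, jn_comp]
    refine jn_congr _ ?_ e₃
    rw [eα, inl_comp, Category.assoc]
  rw [e₂, ← cancel_mono (eqToHom (congrArg simplex (comp_assoc P Q R))), Category.assoc]
  refine Eq.trans ?_ (congrArg (congrMap (comp_assoc P Q R) ≫ ·) e₄).symm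
  exact (congrMap_toSimplex _).symm

theorem jn_assoc {P : Chain p a b} {Q : Chain p b c} {R : Chain p c d}
    (α : P.comps ⟶ Y) (β : Q.comps ⟶ Y) (γ : R.comps ⟶ Y)
    (h₁ : base α (Fin.last _) = base β 0) (h₂ : base β (Fin.last _) = base γ 0) :
    jn (jn α β h₁) γ ((base_jn_last _ _ _).trans h₂) =
      congrMap (comp_assoc P Q R) ≫ jn α (jn β γ h₂) (h₁.trans (base_jn_zero _ _ _).symm) := by
  obtain ⟨U, s, t, τ, h, hτ, hs, ht⟩ := exists_tetrahedron P Q R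
  let α₁ := fstEdge P Q ≫ s
  let β₁ := sndEdge P Q ≫ s
  have k₁ : base α₁ (Fin.last _) = base β₁ 0 :=
    congrArg (base s) (isGluing_triangle P Q).base_right_zero
  have k₂ : base β₁ (Fin.last _) = base t 0 := by
    refine (congrArg (base s) (base_sndEdge_last P Q)).trans h.base_right_zero
  -- The universal case: equality in the tetrahedron follows from equality in the simplex of the
  -- chain, because `τ` is cartesian.
  have key : jn (jn α₁ β₁ k₁) t ((base_jn_last _ _ _).trans k₂) =
      congrMap (comp_assoc P Q R) ≫ jn α₁ (jn β₁ t k₂) (k₁.trans (base_jn_zero _ _ _).symm) := by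
    refine hτ.ext ?_ ?_
    · refine forall_comps ?_ ?_
      · rw [base_jn_zero, base_jn_zero]
        change _ = base (jn _ _ _) (base (congrMap _) _)
        rw [base_congrMap]
        exact (base_jn_zero _ _ _).symm
      · rw [base_jn_last]
        change _ = base (jn _ _ _) (base (congrMap _) _)
        rw [base_congrMap]
        exact ((base_jn_last _ _ _).trans (base_jn_last _ _ _)).symm
    · have := jn_assoc_simplex P Q R rfl (α₁ ≫ τ) (β₁ ≫ τ) (t ≫ τ) (congrArg (base τ) k₁)
        (congrArg (base τ) k₂) (by
          simp only [α₁, eqToHom_refl, Category.comp_id, Category.assoc, hs]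
          rw [← Category.assoc, (triangle_spec P Q).2.2.1, Category.assoc]) (by
          simp only [β₁, eqToHom_refl, Category.comp_id, Category.assoc, hs]
          rw [← Category.assoc, (triangle_spec P Q).2.2.2.1, Category.assoc]) (by
          simp [ht])
      rw [jn_comp, Category.assoc]
      refine (jn_congr _ (jn_comp _ _ _ _) rfl).trans (this.trans ?_)
      rw [jn_comp]
      exact congrArg (congrMap (comp_assoc P Q R) ≫ ·) (jn_congr _ rfl (jn_comp _ _ _ _).symm)
  -- Any three consecutive edges are the image of the universal ones under a morphism `f`, and joins
  -- are natural.
  obtain ⟨f, f₁, f₂⟩ := h.exists_desc (desc α β h₁) γ (by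
    have := congrArg (fun f => base f (Fin.last _)) (sndEdge_desc α β h₁)
    change base (desc α β h₁) (base (sndEdge P Q) _) = _ at this
    rw [base_sndEdge_last] at this
    exact this.trans h₂)
  have eα : α₁ ≫ f = α := by rw [Category.assoc, f₁, fstEdge_desc]
  have eβ : β₁ ≫ f = β := by rw [Category.assoc, f₁, sndEdge_desc]
  have e₁ : jn (jn α β h₁) γ ((base_jn_last _ _ _).trans h₂) =
      jn (jn α₁ β₁ k₁) t ((base_jn_last _ _ _).trans k₂) ≫ f :=
    (jn_congr _ ((jn_congr _ eα.symm eβ.symm).trans (jn_comp _ _ k₁ _).symm) f₂.symm).trans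
      (jn_comp _ _ _ _).symm
  have e₂ : jn α₁ (jn β₁ t k₂) (k₁.trans (base_jn_zero _ _ _).symm) ≫ f =
      jn α (jn β γ h₂) (h₁.trans (base_jn_zero _ _ _).symm) :=
    (jn_comp _ _ _ _).trans (jn_congr _ eα ((jn_comp _ _ k₂ _).trans (jn_congr _ eβ f₂)))
  rw [e₁, key, Category.assoc, e₂]

/-- The projection of a degenerate edge. -/
noncomputable def toPoint (a : p.Fiber ⦋0⦌) : (nil : Chain p a a).comps ⟶ point p a :=
  toSimplex nil

theorem cart_toPoint (a : p.Fiber ⦋0⦌) : Cart (toPoint a) := cart_toSimplex nil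

theorem base_toPoint_comp {a : p.Fiber ⦋0⦌} (v : point p a ⟶ Y) (i) :
    base (toPoint a ≫ v) i = base v 0 :=
  congrArg (base v) (Subsingleton.elim (α := Fin 1) _ _)

omit hs in
theorem point_hom_ext {a : p.Fiber ⦋0⦌} {v w : point p a ⟶ Y} (h : base v 0 = base w 0) :
    v = w :=
  hom_ext_of_len_eq_zero rfl fun i => by
    obtain rfl : i = 0 := Subsingleton.elim (α := Fin 1) _ _
    exact h

/-- By naturality of joins it suffices to take `α` to be the identity of `P.comps`; that case is
tested after the cartesian `toSimplex`, where it is `jn_toSimplex` for the empty chain. -/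
theorem jn_nil_right (α : P.comps ⟶ Y) (v : point p b ⟶ Y)
    (h : base α (Fin.last _) = base (toPoint b ≫ v) 0) :
    jn α (toPoint b ≫ v) h = α := by
  let v₁ : point p b ⟶ P.comps := vertex P.comps (Fin.last _) rfl
  have k : base (𝟙 P.comps) (Fin.last _) = base (toPoint b ≫ v₁) 0 :=
    ((base_toPoint_comp _ _).trans (base_vertex _ _ _ _)).symm
  have e : jn (𝟙 P.comps) (toPoint b ≫ v₁) k = 𝟙 P.comps := by
    refine P.cart_toSimplex.ext (forall_comps ?_ ?_) ?_
    · exact base_jn_zero _ _ _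
    · exact (base_jn_last _ _ _).trans ((base_toPoint_comp _ _).trans (base_vertex _ _ _ _))
    · refine (jn_comp _ _ _ _).trans ?_
      refine Eq.trans ?_ ((jn_toSimplex P nil).trans (Category.id_comp _).symm)
      refine jn_congr _ ?_ ?_
      · rw [Category.id_comp]; exact (Category.comp_id _).symm
      · refine (Category.assoc _ _ _).trans (congrArg (toPoint b ≫ ·) (point_hom_ext ?_))
        refine (congrArg (base P.toSimplex) (base_vertex P.comps (Fin.last _) rfl 0)).trans ?_
        exact (base_vertex P.simplex (Fin.last _) P.simplex_vtx_last 0).symm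
  have : _ = α := (jn_comp _ _ k α).symm.trans ((congrArg (· ≫ α) e).trans (Category.id_comp α))
  refine (jn_congr _ (Category.id_comp _).symm ?_).trans this
  refine (congrArg (toPoint b ≫ ·) (point_hom_ext ?_)).trans (Category.assoc _ _ _).symm
  rw [base_toPoint_comp] at h
  rw [← h]
  exact (congrArg (base α) (base_vertex P.comps (Fin.last _) rfl 0)).symm

theorem inr_nil_comp (Q : Chain p b c) :
    (nil : Chain p b b).inr Q ≫ eqToHom (congrArg simplex (nil_comp Q)) = 𝟙 Q.simplex := by
  induction Q with
  | nil =>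
    refine hom_ext_of_len_eq_zero rfl fun i => ?_
    exact Subsingleton.elim (α := Fin 1) _ _
  | snoc Q e h₀ h₁ ih =>
    refine (isGluing_snoc Q e h₀ h₁).ext ?_ ?_
    · refine ((Category.assoc _ _ _).symm.trans (congrArg (· ≫ eqToHom _)
        (snocInl_inr nil Q e h₀ h₁))).trans ?_
      refine (comp_eq₃ _ (snocInl_eqToHom (nil_comp Q) e h₀ h₁)).trans ?_
      refine (congrArg (· ≫ snocInl Q e h₀ h₁) ih).trans ?_
      exact (Category.id_comp _).trans (Category.comp_id _).symm
    · refine ((Category.assoc _ _ _).symm.trans (congrArg (· ≫ eqToHom _)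
        (snocInr_inr nil Q e h₀ h₁))).trans ?_
      exact (snocInr_eqToHom (nil_comp Q) e h₀ h₁).trans (Category.comp_id _).symm

/-- The argument of `jn_nil_right`, with a transport because the left unit law of concatenation is
not definitional; `inr_nil_comp` absorbs it. -/
theorem jn_nil_left (v : point p b ⟶ Y) (β : Q.comps ⟶ Y)
    (h : base (toPoint b ≫ v) (Fin.last _) = base β 0) :
    jn (toPoint b ≫ v) β h = congrMap (nil_comp Q) ≫ β := by
  let v₁ : point p b ⟶ Q.comps := vertex Q.comps 0 rfl
  have k : base (toPoint b ≫ v₁) (Fin.last _) = base (𝟙 Q.comps) 0 :=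
    (base_toPoint_comp _ _).trans (base_vertex _ _ _ _)
  have e : jn (toPoint b ≫ v₁) (𝟙 Q.comps) k = congrMap (nil_comp Q) := by
    refine Q.cart_toSimplex.ext (forall_comps ?_ ?_) ?_
    · rw [base_jn_zero, base_congrMap]
      exact (base_toPoint_comp _ _).trans (base_vertex _ _ _ _)
    · rw [base_jn_last, base_congrMap]; rfl
    · refine (jn_comp _ _ _ _).trans ?_
      rw [congrMap_toSimplex, ← jn_toSimplex, jn_comp]
      refine jn_congr _ ?_ ?_
      · refine (Category.assoc _ _ _).trans (Eq.trans (congrArg (toPoint b ≫ ·) (point_hom_ext ?_))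
          (Category.assoc (toPoint b) _ _).symm)
        refine (congrArg (base Q.toSimplex) (base_vertex Q.comps 0 rfl 0)).trans ?_
        refine Fin.ext (Eq.symm ?_)
        exact (base_eqToHom_val _ _).trans (base_inl_val nil Q 0)
      · rw [Category.id_comp, Category.assoc, inr_nil_comp, Category.comp_id]
  have := (jn_comp _ _ k β).symm.trans (congrArg (· ≫ β) e)
  refine (jn_congr _ ?_ (Category.id_comp _).symm).trans this
  refine (congrArg (toPoint b ≫ ·) (point_hom_ext ?_)).trans (Category.assoc _ _ _).symm
  rw [base_toPoint_comp] at h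
  rw [h]
  exact (congrArg (base β) (base_vertex Q.comps 0 rfl 0)).symm

end

end Chain

/-! ### 2-morphisms of chains and their horizontal composition. -/

namespace Chain

open Framed

variable {E : Type u₁} [Category.{v₁} E] {p : E ⥤ SimplexCategory}
  [hp : p.IsFibered] [hs : IsSegal p] [hd : IsDiscrete (p.Fiber ⦋0⦌)]
  {a b c d : p.Fiber ⦋0⦌}

/-- A 2-morphism between chains: a morphism of their composites over the identity. -/
structure Cell (P Q : Chain p a b) where
  hom : P.comps ⟶ Q.comps
  base_zero : base hom 0 = 0
  base_last : base hom (Fin.last _) = Fin.last _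

theorem Cell.ext {P Q : Chain p a b} {η θ : Cell P Q} (h : η.hom = θ.hom) : η = θ := by
  cases η; cases θ; cases h; rfl

noncomputable instance : Category (Chain p a b) where
  Hom := Cell
  id _ := ⟨𝟙 _, rfl, rfl⟩
  comp η θ := ⟨η.hom ≫ θ.hom, (congrArg (base θ.hom) η.base_zero).trans θ.base_zero,
    (congrArg (base θ.hom) η.base_last).trans θ.base_last⟩
  id_comp _ := Cell.ext (Category.id_comp _)
  comp_id _ := Cell.ext (Category.comp_id _)
  assoc _ _ _ := Cell.ext (Category.assoc _ _ _)

/-- The morphism of composites underlying a 2-morphism. -/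
noncomputable def mor {P Q : Chain p a b} (η : P ⟶ Q) : P.comps ⟶ Q.comps := Cell.hom η

theorem mor_id (P : Chain p a b) : mor (𝟙 P) = 𝟙 _ := rfl

theorem mor_comp {P Q R : Chain p a b} (η : P ⟶ Q) (θ : Q ⟶ R) : mor (η ≫ θ) = mor η ≫ mor θ :=
  rfl

theorem base_mor_zero {P Q : Chain p a b} (η : P ⟶ Q) : base (mor η) 0 = 0 := Cell.base_zero η

theorem base_mor_last {P Q : Chain p a b} (η : P ⟶ Q) :
    base (mor η) (Fin.last _) = Fin.last _ := Cell.base_last η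

theorem hom_ext_mor {P Q : Chain p a b} {η θ : P ⟶ Q} (h : mor η = mor θ) : η = θ := Cell.ext h

/-- The endpoints of the underlying morphism of a 2-morphism are fixed, so only the composite with
`κ` can differ. With `exists_mor`, a 2-morphism into `Q` amounts to a morphism into `Y` with the
endpoints of `κ`; equations between 2-morphisms are proved in this way. -/
theorem hom_ext_cart {P Q : Chain p a b} {η θ : P ⟶ Q} {Y : Framed p} {κ : Q.comps ⟶ Y}
    (hκ : Cart κ) (h : mor η ≫ κ = mor θ ≫ κ) : η = θ := by
  refine hom_ext_mor (hκ.ext (forall_comps ?_ ?_) h)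
  · exact (base_mor_zero η).trans (base_mor_zero θ).symm
  · exact (base_mor_last η).trans (base_mor_last θ).symm

theorem exists_mor {P Q : Chain p a b} {Y : Framed p} {κ : Q.comps ⟶ Y} (hκ : Cart κ)
    (f : P.comps ⟶ Y) (h₀ : base κ 0 = base f 0)
    (h₁ : base κ (Fin.last _) = base f (Fin.last _)) : ∃ η : P ⟶ Q, mor η ≫ κ = f := by
  obtain ⟨χ, h, e⟩ := hκ.exists_lift (Z := P.comps) f OrderHom.id (forall_comps h₀ h₁)
  exact ⟨⟨χ, h 0, h (Fin.last _)⟩, e⟩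

theorem isIso_of_cart {P Q : Chain p a b} (η : P ⟶ Q) (h : Cart (mor η)) : IsIso η := by
  obtain ⟨θ, hθ⟩ := exists_mor (P := Q) h (𝟙 _) (base_mor_zero η) (base_mor_last η)
  refine ⟨θ, hom_ext_cart h ?_, hom_ext_mor hθ⟩
  rw [mor_comp, Category.assoc, hθ, Category.comp_id, mor_id, Category.id_comp]

theorem mor_eqToHom {P Q : Chain p a b} (h : P = Q) : mor (eqToHom h) = congrMap h := by
  subst h; rfl

theorem cart_mor_of_isIso {P Q : Chain p a b} (η : P ⟶ Q) [IsIso η] : Cart (mor η) := by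
  have : IsIso (mor η) := ⟨mor (inv η), congrArg mor (IsIso.hom_inv_id η),
    congrArg mor (IsIso.inv_hom_id η)⟩
  exact Cart.of_isIso _

theorem base_mor_comp_zero {P Q : Chain p a b} (η : P ⟶ Q) {Y : Framed p} (f : Q.comps ⟶ Y) :
    base (mor η ≫ f) 0 = base f 0 := congrArg (base f) (base_mor_zero η)

theorem base_mor_comp_last {P Q : Chain p a b} (η : P ⟶ Q) {Y : Framed p} (f : Q.comps ⟶ Y) :
    base (mor η ≫ f) (Fin.last _) = base f (Fin.last _) := congrArg (base f) (base_mor_last η)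

theorem exists_hcomp {P P' : Chain p a b} {Q Q' : Chain p b c} (η : P ⟶ P') (θ : Q ⟶ Q') :
    ∃ κ : P.comp Q ⟶ P'.comp Q', mor κ ≫ diag P' Q' =
      jn (mor η ≫ fstEdge P' Q') (mor θ ≫ sndEdge P' Q') (by
        rw [base_mor_comp_last, base_mor_comp_zero]
        exact (isGluing_triangle P' Q').base_right_zero) := by
  refine exists_mor (cart_diag P' Q') _ ?_ ?_
  · rw [base_jn_zero, base_mor_comp_zero, base_fstEdge_zero, (triangle_spec P' Q').2.2.2.2.2.1]
  · rw [base_jn_last, base_mor_comp_last, base_sndEdge_last, (triangle_spec P' Q').2.2.2.2.2.2]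

/-- The horizontal composition of 2-morphisms. -/
noncomputable def hcomp {P P' : Chain p a b} {Q Q' : Chain p b c} (η : P ⟶ P') (θ : Q ⟶ Q') :
    P.comp Q ⟶ P'.comp Q' := (exists_hcomp η θ).choose

/-- The defining property concerns the universal triangle, and naturality of joins carries it to any
pair of consecutive edges. Testing on cartesian joins, it determines `hcomp`. -/
theorem hcomp_jn {P P' : Chain p a b} {Q Q' : Chain p b c} (η : P ⟶ P') (θ : Q ⟶ Q')
    {Y : Framed p} (α : P'.comps ⟶ Y) (β : Q'.comps ⟶ Y) (h : base α (Fin.last _) = base β 0) :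
    mor (hcomp η θ) ≫ jn α β h = jn (mor η ≫ α) (mor θ ≫ β)
      ((base_mor_comp_last η α).trans (h.trans (base_mor_comp_zero θ β).symm)) := by
  rw [jn, ← Category.assoc, hcomp, (exists_hcomp η θ).choose_spec, jn_comp]
  refine jn_congr _ ?_ ?_
  · rw [Category.assoc, fstEdge_desc]
  · rw [Category.assoc, sndEdge_desc]

theorem cart_edges (P : Chain p a b) (Q : Chain p b c) :
    Cart (jn (P.toSimplex ≫ P.inl Q) (Q.toSimplex ≫ P.inr Q) (base_inr_toSimplex P Q)) :=
  cart_jn _ (P.cart_toSimplex.comp (cart_inl P Q)) (Q.cart_toSimplex.comp (cart_inr P Q))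

theorem hcomp_id (P : Chain p a b) (Q : Chain p b c) : hcomp (𝟙 P) (𝟙 Q) = 𝟙 (P.comp Q) := by
  refine hom_ext_cart (cart_edges P Q) ?_
  rw [hcomp_jn, mor_id (P.comp Q), Category.id_comp]
  exact jn_congr _ (Category.id_comp _) (Category.id_comp _)

theorem hcomp_comp {P P' P'' : Chain p a b} {Q Q' Q'' : Chain p b c} (η : P ⟶ P') (η' : P' ⟶ P'')
    (θ : Q ⟶ Q') (θ' : Q' ⟶ Q'') :
    hcomp (η ≫ η') (θ ≫ θ') = hcomp η θ ≫ hcomp η' θ' := by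
  refine hom_ext_cart (cart_edges P'' Q'') ?_
  rw [mor_comp, Category.assoc, hcomp_jn, hcomp_jn, hcomp_jn]
  exact jn_congr _ (Category.assoc _ _ _) (Category.assoc _ _ _)

theorem hcomp_eqToHom_id {P P' : Chain p a b} (h : P = P') (Q : Chain p b c) :
    hcomp (eqToHom h) (𝟙 Q) = eqToHom (congrArg (fun P => P.comp Q) h) := by
  subst h; exact hcomp_id _ _

theorem hcomp_id_eqToHom (P : Chain p a b) {Q Q' : Chain p b c} (h : Q = Q') :
    hcomp (𝟙 P) (eqToHom h) = eqToHom (congrArg P.comp h) := by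
  subst h; exact hcomp_id _ _

theorem exists_cart₃ (P : Chain p a b) (Q : Chain p b c) (R : Chain p c d) :
    ∃ (Y : Framed p) (α : P.comps ⟶ Y) (β : Q.comps ⟶ Y) (γ : R.comps ⟶ Y)
      (_ : base α (Fin.last _) = base β 0) (_ : base β (Fin.last _) = base γ 0),
      Cart α ∧ Cart β ∧ Cart γ := by
  obtain ⟨U, s, t, τ, h, -, -, -⟩ := exists_tetrahedron P Q R
  have g := isGluing_triangle P Q
  refine ⟨U, fstEdge P Q ≫ s, sndEdge P Q ≫ s, t, ?_, ?_, g.cart_left.comp h.cart_left,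
    g.cart_right.comp h.cart_left, h.cart_right⟩
  · exact congrArg (base s) g.base_right_zero
  · exact (congrArg (base s) (base_sndEdge_last P Q)).trans h.base_right_zero

/-- Tested on three consecutive cartesian edges, both sides become joins of the modified edges,
which agree by `jn_assoc`. -/
theorem hcomp_assoc {P P' : Chain p a b} {Q Q' : Chain p b c} {R R' : Chain p c d}
    (η : P ⟶ P') (θ : Q ⟶ Q') (κ : R ⟶ R') :
    hcomp (hcomp η θ) κ ≫ eqToHom (comp_assoc P' Q' R') =
      eqToHom (comp_assoc P Q R) ≫ hcomp η (hcomp θ κ) := by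
  obtain ⟨Y, α, β, γ, h₁, h₂, cα, cβ, cγ⟩ := exists_cart₃ P' Q' R'
  refine hom_ext_cart (cart_jn (h₁.trans (base_jn_zero β γ h₂).symm) cα (cart_jn h₂ cβ cγ)) ?_
  rw [mor_comp, mor_comp, Category.assoc, Category.assoc, mor_eqToHom, mor_eqToHom, ← jn_assoc _ _ _ h₁ h₂,
    hcomp_jn, hcomp_jn η (hcomp θ κ)]
  have k₁ : base (mor η ≫ α) (Fin.last _) = base (mor θ ≫ β) 0 :=
    (base_mor_comp_last η α).trans (h₁.trans (base_mor_comp_zero θ β).symm)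
  have k₂ : base (mor θ ≫ β) (Fin.last _) = base (mor κ ≫ γ) 0 :=
    (base_mor_comp_last θ β).trans (h₂.trans (base_mor_comp_zero κ γ).symm)
  refine (jn_congr _ (hcomp_jn _ _ _ _ _) rfl).trans ?_
  refine (jn_assoc _ _ _ k₁ k₂).trans ?_
  exact congrArg (congrMap (comp_assoc P Q R) ≫ ·) (jn_congr _ rfl (hcomp_jn _ _ _ _ _).symm)

/-- The transport along `nil_comp` is itself a join with a degenerate edge, so `hcomp_jn` applies to
it. -/
theorem nil_hcomp {Q Q' : Chain p a b} (θ : Q ⟶ Q') :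
    hcomp (𝟙 (nil : Chain p a a)) θ ≫ eqToHom (nil_comp Q') = eqToHom (nil_comp Q) ≫ θ := by
  let v : point p a ⟶ Q'.comps := vertex Q'.comps 0 rfl
  have k : base (toPoint a ≫ v) (Fin.last _) = base (𝟙 Q'.comps) 0 :=
    (base_toPoint_comp _ _).trans (base_vertex _ _ _ _)
  have e : mor (eqToHom (nil_comp Q')) = jn (toPoint a ≫ v) (𝟙 Q'.comps) k := by
    rw [jn_nil_left, mor_eqToHom, Category.comp_id]
  refine hom_ext_mor ?_
  rw [mor_comp, e, hcomp_jn]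
  refine (jn_congr _ (Category.id_comp _) (Category.comp_id _)).trans ?_
  rw [jn_nil_left, mor_comp, mor_eqToHom]

theorem hcomp_nil {P P' : Chain p a b} (η : P ⟶ P') :
    hcomp η (𝟙 (nil : Chain p b b)) = η := by
  let v : point p b ⟶ P'.comps := vertex P'.comps (Fin.last _) rfl
  have k : base (𝟙 P'.comps) (Fin.last _) = base (toPoint b ≫ v) 0 :=
    ((base_toPoint_comp _ _).trans (base_vertex _ _ _ _)).symm
  have e : jn (𝟙 P'.comps) (toPoint b ≫ v) k = 𝟙 _ := jn_nil_right _ _ _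
  refine hom_ext_mor ?_
  refine (Category.comp_id _).symm.trans ?_
  refine (congrArg (mor (hcomp η (𝟙 (nil : Chain p b b))) ≫ ·) e).symm.trans ?_
  refine (hcomp_jn _ _ _ _ _).trans ?_
  exact (jn_congr _ (Category.comp_id _) (Category.id_comp _)).trans (jn_nil_right _ _ _)

end Chain

/-! ### The strict 2-category of chains. -/

section

variable {E : Type u₁} [Category.{v₁} E] (p : E ⥤ SimplexCategory)

/-- The rectification of a 2-category in the sense of Segal. -/
structure Rect where
  pt : p.Fiber ⦋0⦌

variable {p} [hp : p.IsFibered] [hs : IsSegal p] [hd : IsDiscrete (p.Fiber ⦋0⦌)]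

open Chain

/-- The structural isomorphisms are transports along equalities of chains, so pentagon and triangle
concern only `eqToHom`. The substance is in the naturality axioms, supplied by `hcomp_assoc`,
`nil_hcomp` and `hcomp_nil`. -/
noncomputable instance : Bicategory (Rect p) where
  Hom X Y := Chain p X.pt Y.pt
  id X := .nil
  comp P Q := P.comp Q
  homCategory X Y := inferInstanceAs (Category (Chain p X.pt Y.pt))
  whiskerLeft P _ _ η := hcomp (𝟙 P) η
  whiskerRight η Q := hcomp η (𝟙 Q)
  associator P Q R := eqToIso (comp_assoc P Q R)
  leftUnitor P := eqToIso (nil_comp P)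
  rightUnitor P := Iso.refl P
  whiskerLeft_id P Q := hcomp_id P Q
  whiskerLeft_comp P _ _ _ η θ := by
    rw [← hcomp_comp, Category.comp_id]
  id_whiskerLeft {_ _ P Q} η := by
    rw [← Category.assoc]
    refine (Iso.eq_comp_inv _).2 ?_
    exact nil_hcomp η
  comp_whiskerLeft P Q _ _ η := by
    rw [← Category.assoc]
    refine (Iso.eq_comp_inv _).2 ?_
    refine Eq.trans ?_ (hcomp_assoc (𝟙 P) (𝟙 Q) η)
    rw [hcomp_id]
    rfl
  id_whiskerRight P Q := hcomp_id P Q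
  comp_whiskerRight η θ Q := by
    rw [← hcomp_comp, Category.comp_id]
  whiskerRight_id η := by
    refine (hcomp_nil η).trans ?_
    exact ((Category.id_comp _).trans (Category.comp_id _)).symm
  whiskerRight_comp η Q R := by
    refine (Iso.eq_inv_comp _).2 ?_
    have := hcomp_assoc η (𝟙 Q) (𝟙 R)
    rw [hcomp_id] at this
    exact this.symm
  whisker_assoc P _ _ η R := by
    rw [← Category.assoc]
    refine (Iso.eq_comp_inv _).2 ?_
    exact hcomp_assoc (𝟙 P) η (𝟙 R)
  whisker_exchange η θ := by
    rw [← hcomp_comp, ← hcomp_comp, Category.comp_id, Category.comp_id, Category.id_comp,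
      Category.id_comp]
  pentagon P Q R S := by
    simp only [eqToIso.hom]
    rw [hcomp_eqToHom_id, hcomp_id_eqToHom]
    simp only [eqToHom_trans]
  triangle P Q := by
    simp only [eqToIso.hom]
    rw [hcomp_id_eqToHom]
    refine (eqToHom_trans _ _).trans ?_
    exact (hcomp_id P Q).symm

instance : Bicategory.Strict (Rect p) where
  id_comp P := nil_comp P
  comp_id _ := rfl
  assoc P Q R := comp_assoc P Q R
  leftUnitor_eqToIso _ := rfl
  rightUnitor_eqToIso _ := rfl
  associator_eqToIso _ _ _ := rfl

end

/-! ### Calculus of joins for 1-morphisms of `Rect`. -/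

namespace Rect

open Framed

variable {E : Type u₁} [Category.{v₁} E] {p : E ⥤ SimplexCategory}
  [hp : p.IsFibered] [hs : IsSegal p] [hd : IsDiscrete (p.Fiber ⦋0⦌)]
  {X X' Y Y' Z Z' W : Rect p} {A B : Framed p}

/-- The composite edge of a 1-morphism. -/
noncomputable def comps (P : X ⟶ Y) : Framed p := Chain.comps P

/-- The morphism of composite edges underlying a 2-morphism. -/
noncomputable def mor {P Q : X ⟶ Y} (η : P ⟶ Q) : comps P ⟶ comps Q := Chain.mor η

/-- The first vertex of an edge of a framed object. -/
noncomputable def src {P : X ⟶ Y} (α : comps P ⟶ A) : Fin (A.len + 1) := base α 0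

/-- The last vertex of an edge of a framed object. -/
noncomputable def tgt {P : X ⟶ Y} (α : comps P ⟶ A) : Fin (A.len + 1) := base α (Fin.last _)

theorem src_comp {P : X ⟶ Y} (α : comps P ⟶ A) (f : A ⟶ B) :
    src (α ≫ f) = base f (src α) := rfl

theorem tgt_comp {P : X ⟶ Y} (α : comps P ⟶ A) (f : A ⟶ B) :
    tgt (α ≫ f) = base f (tgt α) := rfl

@[simp] theorem src_mor_comp {P Q : X ⟶ Y} (η : P ⟶ Q) (α : comps Q ⟶ A) :
    src (mor η ≫ α) = src α := Chain.base_mor_comp_zero (P := P) (Q := Q) η α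

@[simp] theorem tgt_mor_comp {P Q : X ⟶ Y} (η : P ⟶ Q) (α : comps Q ⟶ A) :
    tgt (mor η ≫ α) = tgt α := Chain.base_mor_comp_last (P := P) (Q := Q) η α

theorem base_ext {P : X ⟶ Y} {f g : comps P ⟶ A} (h₀ : src f = src g) (h₁ : tgt f = tgt g) (i) :
    base f i = base g i :=
  Chain.forall_comps (P := P) (q := fun i => base f i = base g i) h₀ h₁ i

theorem vtx_src {P : X ⟶ Y} (α : comps P ⟶ A) : A.vtx (src α) = X.pt :=
  (vtx_eq α _).symm.trans (Chain.comps_vtx_zero P)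

theorem vtx_tgt {P : X ⟶ Y} (α : comps P ⟶ A) : A.vtx (tgt α) = Y.pt :=
  (vtx_eq α _).symm.trans (Chain.comps_vtx_last P)

theorem src_le_tgt {P : X ⟶ Y} (α : comps P ⟶ A) : src α ≤ tgt α :=
  (base α).monotone (Fin.zero_le _)

theorem mor_id (P : X ⟶ Y) : mor (𝟙 P) = 𝟙 _ := rfl

theorem mor_comp {P Q R : X ⟶ Y} (η : P ⟶ Q) (θ : Q ⟶ R) : mor (η ≫ θ) = mor η ≫ mor θ :=
  rfl

theorem hom_ext_cart {P Q : X ⟶ Y} {η θ : P ⟶ Q} {κ : comps Q ⟶ A}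
    (hκ : Cart κ) (h : mor η ≫ κ = mor θ ≫ κ) : η = θ :=
  Chain.hom_ext_cart (P := P) (Q := Q) hκ h

theorem exists_mor {P Q : X ⟶ Y} {κ : comps Q ⟶ A} (hκ : Cart κ)
    (f : comps P ⟶ A) (h₀ : src κ = src f) (h₁ : tgt κ = tgt f) : ∃ η : P ⟶ Q, mor η ≫ κ = f :=
  Chain.exists_mor (P := P) (Q := Q) hκ f h₀ h₁

theorem isIso_of_cart {P Q : X ⟶ Y} (η : P ⟶ Q) {κ : comps Q ⟶ A} (hκ : Cart κ)
    (h : Cart (mor η ≫ κ)) : IsIso η :=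
  Chain.isIso_of_cart (P := P) (Q := Q) η (hκ.of_comp h)

theorem cart_mor_comp {P Q : X ⟶ Y} (η : P ⟶ Q) [h : IsIso η] {κ : comps Q ⟶ A} (hκ : Cart κ) :
    Cart (mor η ≫ κ) :=
  (@Chain.cart_mor_of_isIso _ _ _ _ _ _ _ _ P Q η h).comp hκ

/-- The isomorphism between edges of an object over the same map. -/
theorem exists_iso {P Q : X ⟶ Y} {κ : comps Q ⟶ A} {κ' : comps P ⟶ A} (hκ : Cart κ)
    (hκ' : Cart κ') (h₀ : src κ = src κ') (h₁ : tgt κ = tgt κ') :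
    ∃ η : P ≅ Q, mor η.hom ≫ κ = κ' := by
  obtain ⟨η, h⟩ := exists_mor hκ κ' h₀ h₁
  have := isIso_of_cart η hκ (by rw [h]; exact hκ')
  exact ⟨asIso η, h⟩

/-- The composite of two consecutive edges of an object. -/
noncomputable def jn {P : X ⟶ Y} {Q : Y ⟶ Z} (α : comps P ⟶ A) (β : comps Q ⟶ A)
    (h : tgt α = src β) : comps (P ≫ Q) ⟶ A := Chain.jn (P := P) (Q := Q) α β h

section

variable {P P' : X ⟶ Y} {Q Q' : Y ⟶ Z} {R : Z ⟶ W}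

@[simp] theorem src_jn (α : comps P ⟶ A) (β : comps Q ⟶ A) (h : tgt α = src β) :
    src (jn α β h) = src α := Chain.base_jn_zero (P := P) (Q := Q) α β h

@[simp] theorem tgt_jn (α : comps P ⟶ A) (β : comps Q ⟶ A) (h : tgt α = src β) :
    tgt (jn α β h) = tgt β := Chain.base_jn_last (P := P) (Q := Q) α β h

theorem jn_congr {α α' : comps P ⟶ A} {β β' : comps Q ⟶ A} (h : tgt α = src β)
    (h₁ : α = α') (h₂ : β = β') : jn α β h = jn α' β' (by rw [← h₁, ← h₂, h]) := by
  subst h₁ h₂; rfl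

theorem jn_comp (α : comps P ⟶ A) (β : comps Q ⟶ A) (h : tgt α = src β) (f : A ⟶ B) :
    jn α β h ≫ f = jn (α ≫ f) (β ≫ f) (congrArg (base f) h) :=
  Chain.jn_comp (P := P) (Q := Q) α β h f

theorem cart_jn {α : comps P ⟶ A} {β : comps Q ⟶ A} (h : tgt α = src β) (hα : Cart α)
    (hβ : Cart β) : Cart (jn α β h) := Chain.cart_jn (P := P) (Q := Q) h hα hβ

/-- With the rules for the other whiskering, the associator and the unitors below, a pasting of
structural 2-morphisms followed by a join can be evaluated to a join. -/
theorem mor_whiskerRight_jn (η : P ⟶ P') (α : comps P' ⟶ A) (β : comps Q ⟶ A)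
    (h : tgt α = src β) : mor (η ▷ Q) ≫ jn α β h = jn (mor η ≫ α) β (by simp [h]) :=
  (Chain.hcomp_jn (P := P) (P' := P') (Q := Q) (Q' := Q) η (𝟙 Q) α β h).trans
    (Chain.jn_congr (P := P) (Q := Q) _ rfl (Category.id_comp β))

theorem mor_whiskerLeft_jn (θ : Q ⟶ Q') (α : comps P ⟶ A) (β : comps Q' ⟶ A)
    (h : tgt α = src β) : mor (P ◁ θ) ≫ jn α β h = jn α (mor θ ≫ β) (by simp [h]) :=
  (Chain.hcomp_jn (P := P) (P' := P) (Q := Q) (Q' := Q') (𝟙 P) θ α β h).trans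
    (Chain.jn_congr (P := P) (Q := Q) _ (Category.id_comp α) rfl)

theorem mor_associator_jn (α : comps P ⟶ A) (β : comps Q ⟶ A) (γ : comps R ⟶ A)
    (h : tgt α = src β) (h' : tgt β = src γ) :
    mor (α_ P Q R).hom ≫ jn α (jn β γ h') (by simp [h]) = jn (jn α β h) γ (by simp [h']) := by
  refine Eq.symm ((Chain.jn_assoc (P := P) (Q := Q) (R := R) α β γ h h').trans ?_)
  refine congrArg (· ≫ _) ?_
  exact (Chain.mor_eqToHom (Chain.comp_assoc P Q R)).symm

end

/-- The degenerate edge of a framed object at a vertex. -/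
noncomputable def deg (A : Framed p) (i : Fin (A.len + 1)) (h : A.vtx i = X.pt) :
    comps (𝟙 X) ⟶ A := Chain.toPoint X.pt ≫ vertex A i h

@[simp] theorem src_deg (i : Fin (A.len + 1)) (h : A.vtx i = X.pt) : src (deg A i h) = i :=
  (Chain.base_toPoint_comp _ _).trans (base_vertex _ _ _ _)

@[simp] theorem tgt_deg (i : Fin (A.len + 1)) (h : A.vtx i = X.pt) : tgt (deg A i h) = i :=
  (Chain.base_toPoint_comp _ _).trans (base_vertex _ _ _ _)

theorem cart_deg (i : Fin (A.len + 1)) (h : A.vtx i = X.pt) : Cart (deg A i h) :=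
  (Chain.cart_toPoint _).comp (cart_of_len_eq_zero rfl _)

theorem deg_comp (i : Fin (A.len + 1)) (h : A.vtx i = X.pt) (f : A ⟶ B) (j : Fin (B.len + 1))
    (hj : base f i = j) :
    deg A i h ≫ f = deg B j (by rw [← h, vtx_eq f, hj]) := by
  refine (Category.assoc _ _ _).trans (congrArg (_ ≫ ·) (Chain.point_hom_ext ?_))
  exact (congrArg (base f) (base_vertex A i h 0)).trans (hj.trans (base_vertex B j _ 0).symm)

theorem mor_leftUnitor (P : X ⟶ Y) (α : comps P ⟶ A) :
    mor (λ_ P).hom ≫ α = jn (deg A (src α) (vtx_src α)) α (by simp) := by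
  refine Eq.trans ?_ (Chain.jn_nil_left (Q := P) _ α ?_).symm
  · exact congrArg (· ≫ α) (Chain.mor_eqToHom (Chain.nil_comp P))
  · exact tgt_deg (src α) (vtx_src α)

theorem mor_rightUnitor (P : X ⟶ Y) (α : comps P ⟶ A) :
    mor (ρ_ P).hom ≫ α = jn α (deg A (tgt α) (vtx_tgt α)) (by simp) :=
  (Category.id_comp α).trans (Chain.jn_nil_right (P := P) α _
    (src_deg (tgt α) (vtx_tgt α)).symm).symm

/-- The identification of the composites of a transported 1-morphism. -/
noncomputable def castMap (ha : X = X') (hb : Y = Y') (P : X' ⟶ Y') :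
    comps ((homCast ha hb).obj P) ⟶ comps P :=
  eqToHom (by subst ha; subst hb; rfl)

@[simp] theorem src_castMap_comp (ha : X = X') (hb : Y = Y') (P : X' ⟶ Y') (α : comps P ⟶ A) :
    src (castMap ha hb P ≫ α) = src α := by
  subst ha; subst hb; rfl

@[simp] theorem tgt_castMap_comp (ha : X = X') (hb : Y = Y') (P : X' ⟶ Y') (α : comps P ⟶ A) :
    tgt (castMap ha hb P ≫ α) = tgt α := by
  subst ha; subst hb; rfl

theorem cart_castMap_comp (ha : X = X') (hb : Y = Y') (P : X' ⟶ Y') {α : comps P ⟶ A}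
    (hα : Cart α) : Cart (castMap ha hb P ≫ α) := (Cart.of_isIso (eqToHom _)).comp hα

/-- Components of an `Icon` land in a transported category of morphisms. `castMap` returns them to
the original edges, and this lemma and the next ones move it past every operation. -/
theorem mor_homCast_map (ha : X = X') (hb : Y = Y') {P Q : X' ⟶ Y'} (η : P ⟶ Q)
    (α : comps Q ⟶ A) :
    mor ((homCast ha hb).map η) ≫ castMap ha hb Q ≫ α = castMap ha hb P ≫ mor η ≫ α := by
  subst ha; subst hb
  change mor η ≫ 𝟙 _ ≫ α = 𝟙 _ ≫ mor η ≫ α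
  rw [Category.id_comp, Category.id_comp]

theorem castMap_jn (ha : X = X') (hb : Y = Y') (hc : Z = Z') (P : X' ⟶ Y') (Q : Y' ⟶ Z')
    (α : comps P ⟶ A) (β : comps Q ⟶ A) (h : tgt α = src β) :
    mor (eqToHom (homCast_comp ha hb hc P Q)) ≫ castMap ha hc (P ≫ Q) ≫ jn α β h =
      jn (castMap ha hb P ≫ α) (castMap hb hc Q ≫ β) (by simp [h]) := by
  subst ha; subst hb; subst hc
  change 𝟙 _ ≫ 𝟙 _ ≫ jn α β h = _
  rw [Category.id_comp, Category.id_comp]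
  exact jn_congr h (Category.id_comp _).symm (Category.id_comp _).symm

theorem castMap_deg (ha : X = X') (i : Fin (A.len + 1)) (h : A.vtx i = X'.pt) :
    mor (eqToHom (homCast_id ha)) ≫ castMap ha ha (𝟙 X') ≫ deg A i h =
      deg A i (by rw [ha, h]) := by
  subst ha
  change 𝟙 _ ≫ 𝟙 _ ≫ deg A i h = _
  rw [Category.id_comp, Category.id_comp]

theorem castMap_castMap {X'' Y'' : Rect p} (ha : X = X') (hb : Y = Y') (ha' : X' = X'')
    (hb' : Y' = Y'') (P : X'' ⟶ Y'') (α : comps P ⟶ A) :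
    mor (eqToHom (homCast_trans ha hb ha' hb' P)) ≫
      castMap (ha.trans ha') (hb.trans hb') P ≫ α =
      castMap ha hb _ ≫ castMap ha' hb' P ≫ α := by
  subst ha; subst hb; subst ha'; subst hb'
  rfl

end Rect

/-! ### Normalized 2-functors out of a preorder, given by inequalities. -/

section OfPreorder

variable {J : Type u₁} [Preorder J] {C : Type u₂} [Bicategory.{w₂, v₂} C]

/-- The data of a normalized 2-functor from a preorder. -/
structure PreorderData (J : Type u₁) [Preorder J] (C : Type u₂) [Bicategory.{w₂, v₂} C] where
  obj : J → C
  hom {i j : J} (h : i ≤ j) : obj i ⟶ obj j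
  hom_refl (i : J) : hom (le_refl i) = 𝟙 (obj i)
  comp {i j k : J} (h : i ≤ j) (h' : j ≤ k) : hom (h.trans h') ≅ hom h ≫ hom h'
  assoc {i j k l : J} (h : i ≤ j) (h' : j ≤ k) (h'' : k ≤ l) :
    (comp (h.trans h') h'').hom ≫ (comp h h').hom ▷ hom h'' ≫ (α_ _ _ _).hom =
      (comp h (h'.trans h'')).hom ≫ hom h ◁ (comp h' h'').hom
  refl_comp {i j : J} (h : i ≤ j) :
    (comp (le_refl i) h).hom ≫ eqToHom (hom_refl i) ▷ hom h ≫ (λ_ _).hom = 𝟙 _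
  comp_refl {i j : J} (h : i ≤ j) :
    (comp h (le_refl j)).hom ≫ hom h ◁ eqToHom (hom_refl j) ≫ (ρ_ _).hom = 𝟙 _

/-- The normalized 2-functor with the given data. -/
def PreorderData.toPseudofunctor (D : PreorderData J C) :
    StrictlyUnitaryPseudofunctor (LocallyDiscrete J) C where
  obj i := D.obj i.as
  map u := D.hom (leOfHom u.as)
  map₂ _ := 𝟙 _
  map₂_id _ := rfl
  map₂_comp _ _ := (Category.id_comp _).symm
  mapId i := eqToIso (D.hom_refl i.as)
  mapComp u v := D.comp (leOfHom u.as) (leOfHom v.as)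
  map₂_whisker_left f _ _ η := by
    obtain rfl := LocallyDiscrete.eq_of_hom η
    simp
  map₂_whisker_right η _ := by
    obtain rfl := LocallyDiscrete.eq_of_hom η
    simp
  map₂_associator f g h := by
    have := D.assoc (leOfHom f.as) (leOfHom g.as) (leOfHom h.as)
    simp only [← Category.assoc] at this ⊢
    rw [this]
    simp only [Category.assoc]
    rw [← Bicategory.whiskerLeft_comp_assoc]
    simp
  map₂_left_unitor f := (D.refl_comp (leOfHom f.as)).symm
  map₂_right_unitor f := (D.comp_refl (leOfHom f.as)).symm
  map_id i := D.hom_refl i.as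
  mapId_eq_eqToIso _ := rfl

end OfPreorder

/-! ### The nerve: from simplices to normalized 2-functors. -/

namespace Rect

open Framed

variable {E : Type u₁} [Category.{v₁} E] {p : E ⥤ SimplexCategory}
  [hp : p.IsFibered] [hs : IsSegal p] [hd : IsDiscrete (p.Fiber ⦋0⦌)]

/-- The pulled-back edge is taken as a chain of length one. Its simplex is glued from a point and
that edge, hence maps cartesianly to `A`. -/
theorem exists_edge_of_lt (A : Framed p) {i j : Fin (A.len + 1)} (h : i ≤ j)
    {X Y : Rect p} (hX : A.vtx i = X.pt) (hY : A.vtx j = Y.pt) :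
    ∃ (P : X ⟶ Y) (κ : comps P ⟶ A), Cart κ ∧ src κ = i ∧ tgt κ = j := by
  let e := (A.pull (edgeHom i j h)).obj
  have h₀ : IsVertex p e 0 X.pt := hX ▸ (A.pull (edgeHom i j h)).isVertex 0
  have h₁ : IsVertex p e 1 Y.pt := hY ▸ (A.pull (edgeHom i j h)).isVertex 1
  let κ₀ : edge e h₀ h₁ ⟶ A := ⟨(A.pullMap (edgeHom i j h)).base, (A.pullMap (edgeHom i j h)).hom,
    (A.pullMap (edgeHom i j h)).lift⟩
  have hκ₀ : Cart κ₀ := cart_of_isCartesian _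
    (Functor.IsPreFibered.pullbackMap.IsCartesian A.obj.2 (SimplexCategory.mkHom _))
  let P : Chain p X.pt Y.pt := Chain.snoc Chain.nil e h₀ h₁
  have g : IsGluing (A := point p X.pt) (B := edge e h₀ h₁) (X := P.simplex) _ _ :=
    Chain.isGluing_snoc Chain.nil e h₀ h₁
  obtain ⟨ψ, h₂, h₃⟩ := g.exists_desc (vertex A i hX) κ₀ (base_vertex _ _ _ _)
  have hψ : Cart ψ := g.cart (by rw [h₂]; exact cart_of_len_eq_zero rfl _) (by rw [h₃]; exact hκ₀)
  refine ⟨P, P.toSimplex ≫ ψ, P.cart_toSimplex.comp hψ, ?_, ?_⟩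
  · have h₄ := congrArg (fun f => base f 0) h₂
    have h₅ := base_vertex A i hX 0
    change base ψ (base (Chain.snocInl Chain.nil e h₀ h₁) 0) = _ at h₄
    rw [show base (Chain.snocInl Chain.nil e h₀ h₁) 0 = 0 from Fin.ext (g.base_left 0)] at h₄
    exact h₄.trans h₅
  · have h₄ := congrArg (fun f => base f (Fin.last _)) h₃
    change base ψ (base (Chain.snocInr Chain.nil e h₀ h₁) (Fin.last _)) = _ at h₄
    rw [Chain.isGluing_base_last g] at h₄
    exact h₄

/-- A 1-morphism representing an edge of a framed object. -/
structure EdgeLift (A : Framed p) (i j : Fin (A.len + 1)) where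
  hom : (⟨A.vtx i⟩ : Rect p) ⟶ ⟨A.vtx j⟩
  map : comps hom ⟶ A
  cart : Cart map
  src_eq : src map = i
  tgt_eq : tgt map = j

/-- The degenerate edge. -/
noncomputable def degLift (A : Framed p) (i : Fin (A.len + 1)) : EdgeLift A i i where
  hom := 𝟙 _
  map := deg A i rfl
  cart := cart_deg i rfl
  src_eq := src_deg i rfl
  tgt_eq := tgt_deg i rfl

theorem nonempty_edgeLift (A : Framed p) {i j : Fin (A.len + 1)} (h : i ≤ j) :
    Nonempty (EdgeLift A i j) := by
  obtain ⟨P, κ, h₁, h₂, h₃⟩ :=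
    exists_edge_of_lt A h (X := ⟨A.vtx i⟩) (Y := ⟨A.vtx j⟩) rfl rfl
  exact ⟨⟨P, κ, h₁, h₂, h₃⟩⟩

open Classical in
/-- The chosen 1-morphism representing an edge, the identity for a degenerate edge. -/
noncomputable def edgeLift (A : Framed p) {i j : Fin (A.len + 1)} (h : i ≤ j) : EdgeLift A i j :=
  if e : i = j then e ▸ degLift A i else (nonempty_edgeLift A h).some

/-- On degenerate edges the empty chain is chosen instead of a chain with one degenerate edge, so
that the associated 2-functor strictly preserves identities. -/
theorem edgeLift_refl (A : Framed p) (i : Fin (A.len + 1)) :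
    edgeLift A (le_refl i) = degLift A i := dif_pos rfl

section

variable (A : Framed p) {i j k l : Fin (A.len + 1)} (h : i ≤ j) (h' : j ≤ k) (h'' : k ≤ l)

/-- The embedding of the chosen edge. -/
noncomputable def edgeMap : comps (edgeLift A h).hom ⟶ A := (edgeLift A h).map

theorem cart_edgeMap : Cart (edgeMap A h) := (edgeLift A h).cart

@[simp] theorem src_edgeMap : src (edgeMap A h) = i := (edgeLift A h).src_eq

@[simp] theorem tgt_edgeMap : tgt (edgeMap A h) = j := (edgeLift A h).tgt_eq

/-- The chosen edge and the join of the two shorter ones are cartesian with the same endpoints,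
hence canonically isomorphic over `A`. -/
theorem exists_edgeComp : ∃ η : (edgeLift A (h.trans h')).hom ≅ (edgeLift A h).hom ≫
    (edgeLift A h').hom, mor η.hom ≫ jn (edgeMap A h) (edgeMap A h') (by simp) =
      edgeMap A (h.trans h') :=
  exists_iso (cart_jn _ (cart_edgeMap A h) (cart_edgeMap A h')) (cart_edgeMap A _) (by simp)
    (by simp)

/-- The decomposition of an edge. -/
noncomputable def edgeComp : (edgeLift A (h.trans h')).hom ≅ (edgeLift A h).hom ≫
    (edgeLift A h').hom := (exists_edgeComp A h h').choose

theorem edgeComp_jn : mor (edgeComp A h h').hom ≫ jn (edgeMap A h) (edgeMap A h') (by simp) =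
    edgeMap A (h.trans h') := (exists_edgeComp A h h').choose_spec

theorem edgeLift_refl_hom (i : Fin (A.len + 1)) : (edgeLift A (le_refl i)).hom = 𝟙 _ :=
  congrArg EdgeLift.hom (edgeLift_refl A i)

theorem mor_eqToHom_deg (i : Fin (A.len + 1)) :
    mor (eqToHom (edgeLift_refl_hom A i)) ≫ deg A i rfl = edgeMap A (le_refl i) := by
  have key : ∀ (L L' : EdgeLift A i i) (h : L = L'),
      mor (eqToHom (congrArg EdgeLift.hom h)) ≫ L'.map = L.map := by
    rintro L L' rfl
    exact Category.id_comp _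
  exact key _ _ (edgeLift_refl A i)

/-- The data of the 2-functor associated with a framed object. -/
noncomputable def preorderData : PreorderData (Fin (A.len + 1)) (Rect p) where
  obj i := ⟨A.vtx i⟩
  hom h := (edgeLift A h).hom
  hom_refl i := edgeLift_refl_hom A i
  comp h h' := edgeComp A h h'
  assoc h h' h'' := by
    -- Tested on the triple join in `A`, both sides evaluate to the chosen edge from `i` to `l`.
    refine hom_ext_cart (cart_jn (by simp) (cart_edgeMap A h)
      (cart_jn (by simp) (cart_edgeMap A h') (cart_edgeMap A h''))) ?_
    simp only [mor_comp, Category.assoc]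
    rw [mor_associator_jn _ _ _ (by simp) (by simp), mor_whiskerRight_jn, mor_whiskerLeft_jn]
    rw [jn_congr _ (edgeComp_jn A h h') rfl, jn_congr _ rfl (edgeComp_jn A h' h''),
      edgeComp_jn, edgeComp_jn]
  refl_comp {i j} h := by
    refine hom_ext_cart (cart_edgeMap A h) ?_
    simp only [mor_comp, Category.assoc]
    rw [mor_leftUnitor, mor_whiskerRight_jn, mor_id, Category.id_comp]
    refine Eq.trans ?_ (edgeComp_jn A (le_refl i) h)
    refine congrArg (_ ≫ ·) (jn_congr _ ?_ rfl)
    refine Eq.trans ?_ (mor_eqToHom_deg A i)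
    congr 2
    exact src_edgeMap A h
  comp_refl {i j} h := by
    refine hom_ext_cart (cart_edgeMap A h) ?_
    simp only [mor_comp, Category.assoc]
    rw [mor_rightUnitor, mor_whiskerLeft_jn, mor_id, Category.id_comp]
    refine Eq.trans ?_ (edgeComp_jn A h (le_refl j))
    refine congrArg (_ ≫ ·) (jn_congr _ rfl ?_)
    refine Eq.trans ?_ (mor_eqToHom_deg A j)
    congr 2
    exact tgt_edgeMap A h

end

/-- The object of the simplicial replacement associated with a framed object. -/
noncomputable def nerveObj (A : Framed p) : SimplicialReplacement (Rect p) where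
  base := ⦋A.len⦌
  fiber := (preorderData A).toPseudofunctor

section

variable {A B : Framed p} (f : A ⟶ B)

omit hs in
theorem obj_eq_of_hom (i : Fin (A.len + 1)) :
    (⟨A.vtx i⟩ : Rect p) = ⟨B.vtx (base f i)⟩ := congrArg Rect.mk (vtx_eq f i)

/-- The image under `f` of the chosen edge of `A` factors through the chosen cartesian edge of `B`
with the same endpoints. -/
theorem exists_edgeApp {i j : Fin (A.len + 1)} (h : i ≤ j) :
    ∃ η : (edgeLift A h).hom ⟶ (homCast (obj_eq_of_hom f i) (obj_eq_of_hom f j)).obj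
      (edgeLift B ((base f).monotone h)).hom, mor η ≫ castMap _ _ _ ≫ edgeMap B _ =
        edgeMap A h ≫ f := by
  refine exists_mor (cart_castMap_comp _ _ _ (cart_edgeMap B _)) _ ?_ ?_
  · rw [src_castMap_comp, src_comp, src_edgeMap, src_edgeMap]
  · rw [tgt_castMap_comp, tgt_comp, tgt_edgeMap, tgt_edgeMap]

/-- The component of the 2-morphism associated with a morphism of framed objects. -/
noncomputable def edgeApp {i j : Fin (A.len + 1)} (h : i ≤ j) :
    (edgeLift A h).hom ⟶ (homCast (obj_eq_of_hom f i) (obj_eq_of_hom f j)).obj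
      (edgeLift B ((base f).monotone h)).hom := (exists_edgeApp f h).choose

theorem edgeApp_comp {i j : Fin (A.len + 1)} (h : i ≤ j) :
    mor (edgeApp f h) ≫ castMap (obj_eq_of_hom f i) (obj_eq_of_hom f j) _ ≫
      edgeMap B ((base f).monotone h) = edgeMap A h ≫ f := (exists_edgeApp f h).choose_spec

end

end Rect

namespace Rect

open Framed

variable {E : Type u₁} [Category.{v₁} E] {p : E ⥤ SimplexCategory}
  [hp : p.IsFibered] [hs : IsSegal p] [hd : IsDiscrete (p.Fiber ⦋0⦌)]

section

variable {A B : Framed p} (f : A ⟶ B)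

theorem edgeApp_refl (i : Fin (A.len + 1)) :
    edgeApp f (le_refl i) ≫ (homCast (obj_eq_of_hom f i) (obj_eq_of_hom f i)).map
      (eqToHom (edgeLift_refl_hom B (base f i))) =
    eqToHom (edgeLift_refl_hom A i) ≫ eqToHom (homCast_id (obj_eq_of_hom f i)) := by
  refine hom_ext_cart (cart_castMap_comp (obj_eq_of_hom f i) (obj_eq_of_hom f i) _
    (cart_deg (base f i) rfl)) ?_
  rw [mor_comp, mor_comp, Category.assoc, Category.assoc, mor_homCast_map, mor_eqToHom_deg,
    castMap_deg, edgeApp_comp]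
  rw [← mor_eqToHom_deg, Category.assoc]
  exact congrArg (_ ≫ ·) (deg_comp i rfl f _ rfl)

/-- After the join of the cartesian edges of `B`, both sides are the chosen edge of `A` from `i` to
`k` followed by `f`. -/
theorem edgeApp_edgeComp {i j k : Fin (A.len + 1)} (h : i ≤ j) (h' : j ≤ k) :
    edgeApp f (h.trans h') ≫ (homCast (obj_eq_of_hom f i) (obj_eq_of_hom f k)).map
      (edgeComp B ((base f).monotone h) ((base f).monotone h')).hom =
    (edgeComp A h h').hom ≫ edgeApp f h ▷ (edgeLift A h').hom ≫
      (homCast (obj_eq_of_hom f i) (obj_eq_of_hom f j)).obj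
        (edgeLift B ((base f).monotone h)).hom ◁ edgeApp f h' ≫
      eqToHom (homCast_comp (obj_eq_of_hom f i) (obj_eq_of_hom f j) (obj_eq_of_hom f k) _ _) := by
  refine hom_ext_cart (cart_castMap_comp (obj_eq_of_hom f i) (obj_eq_of_hom f k) _
    (cart_jn (by simp) (cart_edgeMap B ((base f).monotone h))
      (cart_edgeMap B ((base f).monotone h')))) ?_
  simp only [mor_comp, Category.assoc]
  rw [mor_homCast_map, edgeComp_jn, edgeApp_comp, castMap_jn, mor_whiskerLeft_jn,
    mor_whiskerRight_jn, jn_congr _ (edgeApp_comp f h) (edgeApp_comp f h'), ← jn_comp,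
    ← Category.assoc, edgeComp_jn]
  simp

/-- The 2-morphism associated with a morphism of framed objects. -/
noncomputable def nerveIcon : Icon (preorderData A).toPseudofunctor.toPseudofunctor
    (restrictObj (base f) (preorderData B).toPseudofunctor).toPseudofunctor where
  obj_eq i := obj_eq_of_hom f i.as
  app u := edgeApp f (leOfHom u.as)
  naturality η := by
    obtain rfl := LocallyDiscrete.eq_of_hom η
    refine (Category.id_comp _).trans ((Category.comp_id _).symm.trans (congrArg (_ ≫ ·) ?_))
    exact (CategoryTheory.Functor.map_id _ _).symm
  app_id i := edgeApp_refl f i.as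
  app_comp u v := edgeApp_edgeComp f (leOfHom u.as) (leOfHom v.as)

/-- The morphism of the simplicial replacement associated with a morphism of framed objects. -/
noncomputable def nerveMap : nerveObj A ⟶ nerveObj B where
  base := SimplexCategory.mkHom (base f)
  fiber := nerveIcon f

end

theorem hom_ext_replacement {C : Type u₂} [Bicategory.{w₂, v₂} C] {X Y : SimplicialReplacement C}
    {φ ψ : X ⟶ Y} (hb : φ.base = ψ.base)
    (h : ∀ {i j : LocallyDiscrete (Fin (X.base.len + 1))} (u : i ⟶ j),
      HEq (Icon.app φ.fiber u) (Icon.app ψ.fiber u)) : φ = ψ := by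
  obtain ⟨b, α⟩ := φ
  obtain ⟨b', β⟩ := ψ
  obtain rfl : b = b' := hb
  have : α = β := Icon.ext_app fun u => eq_of_heq (h u)
  rw [this]

theorem nerveMap_id (A : Framed p) : nerveMap (𝟙 A) = 𝟙 (nerveObj A) := by
  refine hom_ext_replacement rfl fun {i j} u => heq_of_eq ?_
  refine hom_ext_cart (cart_edgeMap A (leOfHom u.as)) ?_
  refine Eq.trans ?_ ((edgeApp_comp (𝟙 A) (leOfHom u.as)).trans ?_)
  · exact congrArg (_ ≫ ·) (Category.id_comp _).symm
  · exact (Category.comp_id _).trans (Category.id_comp _).symm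

theorem edgeApp_trans {A B C : Framed p} (f : A ⟶ B) (g : B ⟶ C) {i j : Fin (A.len + 1)}
    (h : i ≤ j) :
    edgeApp (f ≫ g) h = edgeApp f h ≫ (homCast (obj_eq_of_hom f i) (obj_eq_of_hom f j)).map
      (edgeApp g ((base f).monotone h)) ≫ eqToHom (homCast_trans _ _ _ _ _) := by
  have key : mor (edgeApp f h ≫ (homCast (obj_eq_of_hom f i) (obj_eq_of_hom f j)).map
      (edgeApp g ((base f).monotone h)) ≫ eqToHom (homCast_trans (obj_eq_of_hom f i)
        (obj_eq_of_hom f j) (obj_eq_of_hom g (base f i)) (obj_eq_of_hom g (base f j)) _)) ≫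
      castMap ((obj_eq_of_hom f i).trans (obj_eq_of_hom g (base f i)))
        ((obj_eq_of_hom f j).trans (obj_eq_of_hom g (base f j))) _ ≫
        edgeMap C ((base g).monotone ((base f).monotone h)) = edgeMap A h ≫ f ≫ g := by
    rw [mor_comp, mor_comp, Category.assoc, Category.assoc, castMap_castMap, mor_homCast_map,
      edgeApp_comp, ← Category.assoc (castMap _ _ _), ← Category.assoc (mor _), edgeApp_comp,
      Category.assoc]
  exact hom_ext_cart (cart_castMap_comp (obj_eq_of_hom (f ≫ g) i) (obj_eq_of_hom (f ≫ g) j) _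
    (cart_edgeMap C ((base g).monotone ((base f).monotone h))))
    ((edgeApp_comp (f ≫ g) h).trans key.symm)

theorem nerveMap_comp {A B C : Framed p} (f : A ⟶ B) (g : B ⟶ C) :
    nerveMap (f ≫ g) = nerveMap f ≫ nerveMap g :=
  hom_ext_replacement rfl fun {_ _} u => heq_of_eq (edgeApp_trans f g (leOfHom u.as))

variable (p) in
/-- The functor to the simplicial replacement of the rectification. -/
noncomputable def nerve : Framed p ⥤ SimplicialReplacement (Rect p) where
  obj := nerveObj
  map := nerveMap
  map_id := nerveMap_id
  map_comp := nerveMap_comp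

end Rect

/-! ### Inverses of invertible 2-morphisms. -/

section IconInverse

variable {B : Type u₁} [Bicategory.{w₁, v₁} B] {C : Type u₂} [Bicategory.{w₂, v₂} C]

theorem Icon.exists_inverse {F G : B ⥤ᵖ C} (α : Icon F G) (hα : α.Invertible) :
    ∃ β : Icon G F, Icon.comp α β = Icon.refl F ∧ Icon.comp β α = Icon.refl G := by
  -- Once `G` is split into fields, its object map can be replaced by that of `F`, and each
  -- `homCast` becomes the identity functor by definition.
  obtain ⟨⟨⟨⟨Gobj, Gmap⟩, Gmap₂⟩, h₁, h₂⟩, GmapId, GmapComp, h₃, h₄, h₅, h₆, h₇⟩ := G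
  obtain rfl : F.obj = Gobj := funext α.obj_eq
  let θ {a b : B} (f : a ⟶ b) : F.map f ⟶ Gmap f := α.app f
  have hθ {a b : B} (f : a ⟶ b) : IsIso (θ f) := hα f
  have nat {a b : B} {f g : a ⟶ b} (η : f ⟶ g) : F.map₂ η ≫ θ g = θ f ≫ Gmap₂ η := α.naturality η
  have hid (a : B) : θ (𝟙 a) ≫ (GmapId a).hom = (F.mapId a).hom :=
    (α.app_id a).trans (Category.comp_id _)
  have hcomp {a b c : B} (f : a ⟶ b) (g : b ⟶ c) : θ (f ≫ g) ≫ (GmapComp f g).hom =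
      (F.mapComp f g).hom ≫ θ f ▷ F.map g ≫ Gmap f ◁ θ g := by
    refine (α.app_comp f g).trans ?_
    exact congrArg (fun t => (F.mapComp f g).hom ≫ θ f ▷ F.map g ≫ t)
      (Category.comp_id (Gmap f ◁ θ g))
  refine ⟨⟨fun _ => rfl, fun {a b} f => (show Gmap f ⟶ F.map f from inv (θ f)), ?_, ?_, ?_⟩, ?_, ?_⟩
  · intro a b f g η
    change Gmap₂ η ≫ inv (θ g) = inv (θ f) ≫ F.map₂ η
    rw [IsIso.comp_inv_eq, Category.assoc, nat, IsIso.inv_hom_id_assoc]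
  · intro a
    change inv (θ (𝟙 a)) ≫ (F.mapId a).hom = (GmapId a).hom ≫ 𝟙 _
    rw [IsIso.inv_comp_eq, Category.comp_id, hid]
  · intro a b c f g
    change inv (θ (f ≫ g)) ≫ (F.mapComp f g).hom =
      (GmapComp f g).hom ≫ inv (θ f) ▷ Gmap g ≫ F.map f ◁ inv (θ g) ≫ 𝟙 _
    rw [IsIso.inv_comp_eq, ← Category.assoc, hcomp, Category.comp_id, ← whisker_exchange]
    simp
  · apply Icon.ext_app
    intro a b f
    change θ f ≫ inv (θ f) ≫ 𝟙 _ = 𝟙 _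
    simp
  · apply Icon.ext_app
    intro a b f
    change inv (θ f) ≫ θ f ≫ 𝟙 _ = 𝟙 _
    simp

/-- The inverse of an invertible 2-morphism. -/
noncomputable def Icon.symm {F G : B ⥤ᵖ C} (α : Icon F G) (hα : α.Invertible) : Icon G F :=
  (α.exists_inverse hα).choose

theorem Icon.isIso_map_app {F G : B ⥤ᵖ C} {α β : Icon F G} (h : α = β) (hβ : β.Invertible) :
    α.Invertible := h ▸ hβ

theorem Icon.refl_invertible (F : B ⥤ᵖ C) : (Icon.refl F).Invertible :=
  fun _ _ _ => inferInstanceAs (IsIso (𝟙 _))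

theorem homCast_isIso {a a' b b' : C} (ha : a = a') (hb : b = b') {f g : a' ⟶ b'} (θ : f ⟶ g)
    (h : IsIso ((homCast ha hb).map θ)) : IsIso θ := by
  subst ha; subst hb; exact h

theorem Icon.symm_invertible {F G : B ⥤ᵖ C} (α : Icon F G) (hα : α.Invertible) :
    (α.symm hα).Invertible := by
  obtain ⟨h₁, -⟩ := (α.exists_inverse hα).choose_spec
  intro a b f
  have h₂ : IsIso (α.app f ≫ (homCast (α.obj_eq a) (α.obj_eq b)).map ((α.symm hα).app f) ≫
    eqToHom (homCast_trans _ _ _ _ _)) :=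
    Icon.isIso_map_app h₁ (Icon.refl_invertible F) f
  have := hα f
  have h₃ := @IsIso.of_isIso_comp_left _ _ _ _ _ (α.app f) _ _ h₂
  exact homCast_isIso _ _ _ (@IsIso.of_isIso_comp_right _ _ _ _ _ _ (eqToHom _) _ h₃)

/-- A 2-morphism of normalized 2-functors is an isomorphism if its components are. -/
theorem isIso_of_invertible {F G : StrictlyUnitaryPseudofunctor B C} (α : F ⟶ G)
    (hα : Icon.Invertible α) : IsIso α := by
  obtain ⟨β, h₁, h₂⟩ := Icon.exists_inverse α hα
  exact ⟨β, h₁, h₂⟩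

end IconInverse

/-! ### Every normalized 2-functor on a preorder comes from its data on inequalities. -/

section NormalizedFunctors

variable {J : Type u₁} [Preorder J] {C : Type u₂} [Bicategory.{w₂, v₂} C]

/-- The morphism of the locally discrete bicategory given by an inequality. -/
def seg {i j : J} (h : i ≤ j) : (⟨i⟩ : LocallyDiscrete J) ⟶ ⟨j⟩ := ⟨homOfLE h⟩

variable (γ : StrictlyUnitaryPseudofunctor (LocallyDiscrete J) C)

theorem map₂_loop {a b : LocallyDiscrete J} {u : a ⟶ b} (η : u ⟶ u) :
    γ.map₂ η = 𝟙 _ := by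
  rw [Subsingleton.elim η (𝟙 u), γ.map₂_id]

/-- The data of a normalized 2-functor. -/
def PreorderData.ofPseudofunctor : PreorderData J C where
  obj i := γ.obj ⟨i⟩
  hom h := γ.map (seg h)
  hom_refl i := γ.map_id ⟨i⟩
  comp h h' := γ.mapComp (seg h) (seg h')
  assoc h h' h'' := by
    have := γ.map₂_associator (seg h) (seg h') (seg h'')
    -- In a preorder both bracketings are the same inequality, so the associator is an endomorphism
    -- in a discrete category.
    have e : γ.map₂ (α_ (seg h) (seg h') (seg h'')).hom = 𝟙 _ :=
      map₂_loop γ (u := seg (h.trans (h'.trans h''))) _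
    rw [e] at this
    have h₁ := congrArg (· ≫ (γ.mapComp (seg h) (seg h' ≫ seg h'')).hom ≫
      γ.map (seg h) ◁ (γ.mapComp (seg h') (seg h'')).hom) this
    simp only [Category.assoc, Iso.inv_hom_id_assoc, ← Bicategory.whiskerLeft_comp,
      Iso.inv_hom_id, Bicategory.whiskerLeft_id, Category.comp_id] at h₁
    exact h₁.symm.trans (Category.id_comp _)
  refl_comp {i j} h := by
    have := γ.map₂_left_unitor (seg h)
    rw [γ.mapId_eq_eqToIso] at this
    exact this.symm.trans (map₂_loop γ (u := seg h) _)
  comp_refl h := by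
    have := γ.map₂_right_unitor (seg h)
    rw [γ.mapId_eq_eqToIso] at this
    exact this.symm.trans (map₂_loop γ (u := seg h) _)

/-- A normalized 2-functor from a preorder is isomorphic to the 2-functor given by its data. -/
theorem exists_iso_ofPseudofunctor :
    Nonempty ((PreorderData.ofPseudofunctor γ).toPseudofunctor ≅ γ) := by
  let α : Icon (PreorderData.ofPseudofunctor γ).toPseudofunctor.toPseudofunctor
      γ.toPseudofunctor :=
    { obj_eq := fun _ => rfl
      app := fun u => 𝟙 (γ.map u)
      naturality := fun {a b f g} η => by
        obtain rfl := LocallyDiscrete.eq_of_hom η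
        change 𝟙 _ ≫ 𝟙 _ = 𝟙 _ ≫ γ.map₂ η
        rw [map₂_loop]
      app_id := fun a => by
        refine (Category.id_comp (γ.mapId a).hom).trans
          (Eq.trans ?_ (Category.comp_id (eqToHom (γ.map_id a))).symm)
        rw [γ.mapId_eq_eqToIso]
        rfl
      app_comp := fun f g => by
        change 𝟙 _ ≫ (γ.mapComp f g).hom = (γ.mapComp f g).hom ≫ 𝟙 (γ.map f) ▷ γ.map g ≫
          γ.map f ◁ 𝟙 (γ.map g) ≫ 𝟙 _
        simp }
  have : IsIso (C := StrictlyUnitaryPseudofunctor (LocallyDiscrete J) C) (X := _) (Y := γ) α :=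
    isIso_of_invertible α fun a b f => inferInstanceAs (IsIso (𝟙 _))
  exact ⟨@asIso _ _ _ _ α this⟩

end NormalizedFunctors

/-! ### The nerve is fully faithful. -/

namespace Rect

open Framed

variable {E : Type u₁} [Category.{v₁} E] {p : E ⥤ SimplexCategory}
  [hp : p.IsFibered] [hs : IsSegal p] [hd : IsDiscrete (p.Fiber ⦋0⦌)]

theorem exists_factor {X Y : Rect p} {P : X ⟶ Y} {A' A : Framed p} {s : A' ⟶ A} (hs : Cart s)
    (κ : comps P ⟶ A) {i j : Fin (A'.len + 1)} (h : i ≤ j) (hi : base s i = src κ)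
    (hj : base s j = tgt κ) : ∃ κ' : comps P ⟶ A', κ' ≫ s = κ ∧ src κ' = i ∧ tgt κ' = j := by
  obtain ⟨κ', h₁, h₂⟩ := hs.exists_lift κ (edgeHom i j h)
    (Chain.forall_comps (P := P) (q := fun k => base s (edgeHom i j h k) = base κ k) hi hj)
  exact ⟨κ', h₂, h₁ 0, h₁ (Fin.last _)⟩

/-- A simplex is glued from its initial segment and its last edge, so induction on the length leaves
only consecutive edges. Any cartesian representative of such an edge serves as a test. -/
theorem spine_ext {A B : Framed p} {f g : A ⟶ B} (hb : ∀ i, base f i = base g i)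
    (H : ∀ i j : Fin (A.len + 1), i.val + 1 = j.val →
      ∃ L : EdgeLift A i j, L.map ≫ f = L.map ≫ g) : f = g := by
  obtain ⟨n, x, v, hv⟩ := A
  induction n with
  | zero => exact hom_ext_of_len_eq_zero rfl hb
  | succ n ih =>
    let A : Framed p := ⟨n + 1, x, v, hv⟩
    refine (isGluing_pullMap x v hv).hom_ext hb ?_ ?_
    · refine ih _ _ _ (f := A.pullMap (initialHom n) ≫ f) (g := A.pullMap (initialHom n) ≫ g)
        (fun i => hb _) fun i j h => ?_
      obtain ⟨L, hL⟩ := H (initialHom n i) (initialHom n j) h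
      obtain ⟨κ, h₁, h₂, h₃⟩ := exists_factor (A.cart_pullMap (initialHom n)) L.map
        (i := i) (j := j) (Fin.mk_le_mk.2 (by omega)) L.src_eq.symm L.tgt_eq.symm
      refine ⟨⟨L.hom, κ, (A.cart_pullMap (initialHom n)).of_comp (by rw [h₁]; exact L.cart),
        h₂, h₃⟩, ?_⟩
      refine (Category.assoc _ _ _).symm.trans (Eq.trans ?_ (Category.assoc _ _ _))
      exact (congrArg (· ≫ f) h₁).trans (hL.trans (congrArg (· ≫ g) h₁).symm)
    · obtain ⟨L, hL⟩ := H (Fin.last n).castSucc (Fin.last (n + 1)) rfl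
      refine L.cart.comp_eq_of_comp_eq (κ' := A.pullMap (terminalHom n)) OrderHom.id ?_ hL
      refine Fin.forall_fin_two.2 ⟨L.src_eq.trans (Fin.ext ?_), L.tgt_eq.trans (Fin.ext ?_)⟩
      · exact (Nat.zero_add n).symm
      · exact Nat.add_comm n 1

theorem exists_spine_lift {A B : Framed p} (g : Fin (A.len + 1) →o Fin (B.len + 1))
    (hv : ∀ i, A.vtx i = B.vtx (g i))
    (L : ∀ i j : Fin (A.len + 1), i.val + 1 = j.val → EdgeLift A i j)
    (u : ∀ i j h, comps (L i j h).hom ⟶ B) (hu₀ : ∀ i j h, src (u i j h) = g i)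
    (hu₁ : ∀ i j h, tgt (u i j h) = g j) :
    ∃ f : A ⟶ B, base f = g ∧ ∀ i j h, (L i j h).map ≫ f = u i j h := by
  obtain ⟨n, x, v, hx⟩ := A
  induction n with
  | zero =>
    have e : v 0 = x := IsVertex.unique (hx 0) (isVertex_self x 0)
    let κ : (⟨0, x, v, hx⟩ : Framed p) ⟶ point p x :=
      ⟨OrderHom.id, 𝟙 _, CategoryTheory.IsHomLift.id x.2⟩
    refine ⟨κ ≫ vertex B (g 0) (by rw [← hv]; exact e), ?_, ?_⟩
    · refine OrderHom.ext _ _ (funext fun i => ?_)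
      obtain rfl : i = 0 := Subsingleton.elim (α := Fin 1) _ _
      exact base_vertex _ _ _ _
    · intro i j h
      have := j.isLt
      simp only at this
      omega
  | succ n ih =>
    let A : Framed p := ⟨n + 1, x, v, hx⟩
    let s := A.pullMap (initialHom n)
    let t := A.pullMap (terminalHom n)
    have cs : Cart s := A.cart_pullMap _
    have ct : Cart t := A.cart_pullMap _
    have H : ∀ (i j : Fin (n + 1)) (h : i.val + 1 = j.val),
        ∃ κ : comps (L (initialHom n i) (initialHom n j) h).hom ⟶ A.pull (initialHom n),
          κ ≫ s = (L (initialHom n i) (initialHom n j) h).map ∧ src κ = i ∧ tgt κ = j :=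
      fun i j h => exists_factor cs _ (Fin.mk_le_mk.2 (by omega)) (L _ _ h).src_eq.symm
        (L _ _ h).tgt_eq.symm
    choose κ hκ hκ₀ hκ₁ using H
    obtain ⟨f', bf', hf'⟩ := ih _ _ _ (g.comp (initialHom n)) (fun i => hv _)
      (fun i j h => ⟨(L (initialHom n i) (initialHom n j) h).hom, κ i j h,
        cs.of_comp (by rw [hκ]; exact (L _ _ h).cart), hκ₀ i j h, hκ₁ i j h⟩)
      (fun i j h => u (initialHom n i) (initialHom n j) h) (fun i j h => hu₀ _ _ _)
      (fun i j h => hu₁ _ _ _)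
    let l₀ : Fin (n + 1 + 1) := (Fin.last n).castSucc
    let l₁ := Fin.last (n + 1)
    have hl : l₀.val + 1 = l₁.val := rfl
    have e₀ : l₀ = terminalHom n 0 := Fin.ext (Nat.zero_add n).symm
    have e₁ : l₁ = terminalHom n 1 := Fin.ext (Nat.add_comm n 1)
    obtain ⟨τ, bτ, hτ⟩ := (L l₀ l₁ hl).cart.exists_lift t OrderHom.id
      (Fin.forall_fin_two.2 ⟨(L l₀ l₁ hl).src_eq.trans e₀, (L l₀ l₁ hl).tgt_eq.trans e₁⟩)
    obtain ⟨f, hf, hfs, hft⟩ := (isGluing_pullMap x v hx).exists_lift g f' (τ ≫ u l₀ l₁ hl)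
      (fun i => congrArg (fun b => b i) bf')
      (Fin.forall_fin_two.2 ⟨(congrArg (base (u l₀ l₁ hl)) (bτ 0)).trans
        ((hu₀ l₀ l₁ hl).trans (congrArg g e₀)), (congrArg (base (u l₀ l₁ hl)) (bτ 1)).trans
        ((hu₁ l₀ l₁ hl).trans (congrArg g e₁))⟩)
    refine ⟨f, hf, fun i j h => ?_⟩
    -- The last edge has two cartesian models, the given `L` and the pullback used for gluing. The
    -- factorization `σ` of `L` through the latter is a section of `τ`.
    have hlast : (L l₀ l₁ hl).map ≫ f = u l₀ l₁ hl := by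
      obtain ⟨σ, hσ, hσ₀, hσ₁⟩ := exists_factor ct (L l₀ l₁ hl).map (i := (0 : Fin (1 + 1)))
        (j := (1 : Fin (1 + 1))) (Fin.zero_le _) (e₀.symm.trans (L l₀ l₁ hl).src_eq.symm)
        (e₁.symm.trans (L l₀ l₁ hl).tgt_eq.symm)
      have hστ : σ ≫ τ = 𝟙 _ := by
        refine (L l₀ l₁ hl).cart.ext ?_ ?_
        · exact base_ext (P := (L l₀ l₁ hl).hom) ((congrArg (base τ) hσ₀).trans (bτ 0))
            ((congrArg (base τ) hσ₁).trans (bτ 1))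
        · rw [Category.assoc, hτ, hσ, Category.id_comp]
      rw [← hσ, Category.assoc, hft, ← Category.assoc, hστ, Category.id_comp]
    by_cases hj : j.val ≤ n
    · obtain ⟨j, hj'⟩ := j
      obtain ⟨i, hi'⟩ := i
      have hj₂ : j < n + 1 := Nat.lt_succ_of_le hj
      have hi₂ : i < n + 1 := by
        have h₃ : i + 1 = j := h
        omega
      have := hf' ⟨i, hi₂⟩ ⟨j, hj₂⟩ h
      have h₂ := hκ ⟨i, hi₂⟩ ⟨j, hj₂⟩ h
      refine (congrArg (· ≫ f) h₂).symm.trans ((Category.assoc _ _ _).trans ?_)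
      exact (congrArg (_ ≫ ·) hfs).trans this
    · have hj' := j.isLt
      simp only at hj'
      obtain rfl : j = l₁ := Fin.ext (show j.val = n + 1 by omega)
      obtain rfl : i = l₀ := Fin.ext (show i.val = n by simp only [l₁, Fin.val_last] at h; omega)
      exact hlast

section

variable {A B : Framed p} (φ : nerveObj A ⟶ nerveObj B)

/-- The order-preserving map under a morphism of nerves. -/
noncomputable def nerveBase : Fin (A.len + 1) →o Fin (B.len + 1) := φ.base.toOrderHom

theorem obj_eq_of_nerve (i : Fin (A.len + 1)) :
    (⟨A.vtx i⟩ : Rect p) = ⟨B.vtx (nerveBase φ i)⟩ := Icon.obj_eq φ.fiber ⟨i⟩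

/-- The component of a morphism of nerves. -/
noncomputable def nerveApp {i j : Fin (A.len + 1)} (h : i ≤ j) : (edgeLift A h).hom ⟶
    (homCast (obj_eq_of_nerve φ i) (obj_eq_of_nerve φ j)).obj
      (edgeLift B ((nerveBase φ).monotone h)).hom := Icon.app φ.fiber (seg h)

/-- The edge of the target corresponding to an edge of the source. -/
noncomputable def realEdge {i j : Fin (A.len + 1)} (h : i ≤ j) : comps (edgeLift A h).hom ⟶ B :=
  mor (nerveApp φ h) ≫ castMap (obj_eq_of_nerve φ i) (obj_eq_of_nerve φ j) _ ≫
    edgeMap B ((nerveBase φ).monotone h)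

@[simp] theorem src_realEdge {i j : Fin (A.len + 1)} (h : i ≤ j) :
    src (realEdge φ h) = nerveBase φ i := by simp [realEdge]

@[simp] theorem tgt_realEdge {i j : Fin (A.len + 1)} (h : i ≤ j) :
    tgt (realEdge φ h) = nerveBase φ j := by simp [realEdge]

/-- The compatibility of the 2-morphism with composition, read off inside `B` by composing with the
join of the two chosen edges. -/
theorem realEdge_trans {i j k : Fin (A.len + 1)} (h : i ≤ j) (h' : j ≤ k) :
    realEdge φ (h.trans h') =
      mor (edgeComp A h h').hom ≫ jn (realEdge φ h) (realEdge φ h') (by simp) := by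
  have key : nerveApp φ (h.trans h') ≫
      (homCast (obj_eq_of_nerve φ i) (obj_eq_of_nerve φ k)).map
        (edgeComp B ((nerveBase φ).monotone h) ((nerveBase φ).monotone h')).hom =
      (edgeComp A h h').hom ≫ nerveApp φ h ▷ (edgeLift A h').hom ≫
        (homCast (obj_eq_of_nerve φ i) (obj_eq_of_nerve φ j)).obj
          (edgeLift B ((nerveBase φ).monotone h)).hom ◁ nerveApp φ h' ≫
        eqToHom (homCast_comp (obj_eq_of_nerve φ i) (obj_eq_of_nerve φ j)
          (obj_eq_of_nerve φ k) _ _) := Icon.app_comp φ.fiber (seg h) (seg h')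
  have h₁ := congrArg (fun η => mor η ≫ castMap (obj_eq_of_nerve φ i) (obj_eq_of_nerve φ k) _ ≫
    jn (edgeMap B ((nerveBase φ).monotone h)) (edgeMap B ((nerveBase φ).monotone h'))
      (by simp)) key
  simp only [mor_comp, Category.assoc] at h₁
  rw [mor_homCast_map, edgeComp_jn, castMap_jn, mor_whiskerLeft_jn, mor_whiskerRight_jn] at h₁
  exact h₁

theorem realEdge_refl (i : Fin (A.len + 1)) : realEdge φ (le_refl i) =
    mor (eqToHom (edgeLift_refl_hom A i)) ≫ deg B (nerveBase φ i)
      (congrArg Rect.pt (obj_eq_of_nerve φ i)).symm := by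
  have key : nerveApp φ (le_refl i) ≫
      (homCast (obj_eq_of_nerve φ i) (obj_eq_of_nerve φ i)).map
        (eqToHom (edgeLift_refl_hom B (nerveBase φ i))) =
      eqToHom (edgeLift_refl_hom A i) ≫ eqToHom (homCast_id (obj_eq_of_nerve φ i)) :=
    Icon.app_id φ.fiber ⟨i⟩
  have h₁ := congrArg (fun η => mor η ≫ castMap (obj_eq_of_nerve φ i) (obj_eq_of_nerve φ i) _ ≫
    deg B (nerveBase φ i) rfl) key
  simp only [mor_comp, Category.assoc] at h₁
  rw [mor_homCast_map, mor_eqToHom_deg, castMap_deg] at h₁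
  exact h₁

/-- By `realEdge_refl` and `realEdge_trans` the components at consecutive vertices determine all
others, by induction on `j - i`. A component is recovered from its edge in `B` because the chosen
edges are cartesian. -/
theorem nerve_hom_ext {φ ψ : nerveObj A ⟶ nerveObj B} (hb : φ.base = ψ.base)
    (h : ∀ i j : Fin (A.len + 1), ∀ h : i ≤ j, i.val + 1 = j.val →
      realEdge φ h = realEdge ψ h) : φ = ψ := by
  have hb' : ∀ i, nerveBase φ i = nerveBase ψ i := fun i =>
    congrArg (fun f : (nerveObj A).base ⟶ (nerveObj B).base => f.toOrderHom i) hb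
  have key : ∀ (d : ℕ) (i j : Fin (A.len + 1)) (hij : i ≤ j), i.val + d = j.val →
      realEdge φ hij = realEdge ψ hij := by
    intro d
    induction d with
    | zero =>
      intro i j hij e
      obtain rfl : i = j := Fin.ext e
      rw [realEdge_refl, realEdge_refl]
      congr 2
      exact hb' i
    | succ d ih =>
      intro i j hij e
      have hk : i.val + d < A.len + 1 := by have := j.isLt; omega
      have h₁ : i ≤ ⟨i.val + d, hk⟩ := Fin.mk_le_mk.2 (by omega)
      have h₂ : ⟨i.val + d, hk⟩ ≤ j := Fin.mk_le_mk.2 (by omega)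
      rw [realEdge_trans φ h₁ h₂, realEdge_trans ψ h₁ h₂]
      exact congrArg (_ ≫ ·) (jn_congr _ (ih i _ h₁ rfl) (h _ _ h₂ e))
  have key' : ∀ (i j : Fin (A.len + 1)) (hij : i ≤ j), realEdge φ hij = realEdge ψ hij :=
    fun i j hij => key (j.val - i.val) i j hij (by have : i.val ≤ j.val := hij; omega)
  clear key h hb'
  obtain ⟨b, α⟩ := φ
  obtain ⟨b', β⟩ := ψ
  obtain rfl : b = b' := hb
  refine congrArg _ (Icon.ext_app fun {i j} u => ?_)
  have hu := leOfHom u.as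
  exact hom_ext_cart (cart_castMap_comp (Icon.obj_eq α i) (Icon.obj_eq α j) _
    (cart_edgeMap B _)) (key' i.as j.as hu)

theorem realEdge_nerveMap (f : A ⟶ B) {i j : Fin (A.len + 1)} (h : i ≤ j) :
    realEdge (nerveMap f) h = edgeMap A h ≫ f := edgeApp_comp f h

end

instance : (nerve p).Faithful where
  map_injective {A B f g} h := by
    have hb : base f = base g :=
      congrArg (fun φ : nerveObj A ⟶ nerveObj B => φ.base.toOrderHom) h
    refine spine_ext (fun i => congrArg (fun b => b i) hb) fun i j hij => ?_
    have hle : i ≤ j := Fin.mk_le_mk.2 (by omega)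
    refine ⟨edgeLift A hle, ?_⟩
    have h₁ := congrArg (fun φ : nerveObj A ⟶ nerveObj B => realEdge φ hle) h
    exact (realEdge_nerveMap f hle).symm.trans (h₁.trans (realEdge_nerveMap g hle))

/-- The components of `φ` on consecutive edges prescribe a morphism of simplices; its nerve agrees
with `φ` on those edges, hence everywhere by `nerve_hom_ext`. -/
instance : (nerve p).Full where
  map_surjective {A B} φ := by
    have hle : ∀ i j : Fin (A.len + 1), i.val + 1 = j.val → i ≤ j :=
      fun i j h => Fin.mk_le_mk.2 (by omega)
    obtain ⟨f, hf, hf'⟩ := exists_spine_lift (A := A) (B := B) (nerveBase φ)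
      (fun i => congrArg Rect.pt (obj_eq_of_nerve φ i)) (fun i j h => edgeLift A (hle i j h))
      (fun i j h => realEdge φ (hle i j h)) (fun i j h => src_realEdge φ _)
      (fun i j h => tgt_realEdge φ _)
    refine ⟨f, nerve_hom_ext (φ := nerveMap f) (ψ := φ) (congrArg SimplexCategory.mkHom hf)
      fun i j hij e => ?_⟩
    exact (realEdge_nerveMap f hij).trans (hf' i j e)

end Rect

/-- Precomposition of the data of a normalized 2-functor with a monotone map. -/
def PreorderData.restrict {J : Type u₁} {K : Type u₂} [Preorder J] [Preorder K] {C : Type u₃}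
    [Bicategory.{w₂, v₂} C] (D : PreorderData K C) (f : J →o K) : PreorderData J C where
  obj i := D.obj (f i)
  hom h := D.hom (f.monotone h)
  hom_refl i := D.hom_refl (f i)
  comp h h' := D.comp (f.monotone h) (f.monotone h')
  assoc _ _ _ := D.assoc _ _ _
  refl_comp _ := D.refl_comp _
  comp_refl _ := D.comp_refl _

/-! ### Realizing a normalized 2-functor by a simplex. -/

namespace Rect

open Framed

variable {E : Type u₁} [Category.{v₁} E] {p : E ⥤ SimplexCategory}
  [hp : p.IsFibered] [hs : IsSegal p] [hd : IsDiscrete (p.Fiber ⦋0⦌)]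

section

variable {n : ℕ} (D : PreorderData (Fin (n + 1)) (Rect p)) (A : Framed p)

theorem comp_refl_jn {i j : Fin (n + 1)} (h : i ≤ j) (κ : comps (D.hom h) ⟶ A) :
    mor (D.comp h (le_refl j)).hom ≫ jn κ (mor (eqToHom (D.hom_refl j)) ≫
      deg A (tgt κ) (vtx_tgt κ)) (by simp) = κ := by
  have h₁ := congrArg (fun η => mor η ≫ κ) (D.comp_refl h)
  simp only [mor_comp, Category.assoc] at h₁
  rw [mor_rightUnitor, mor_whiskerLeft_jn, mor_id, Category.id_comp] at h₁
  exact h₁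

/-- The degenerate edge of a framed object, as an edge between equal vertices. -/
noncomputable def degEdge {i j : Fin (n + 1)} (h : i ≤ j) (e : i = j) (k : Fin (A.len + 1))
    (hk : A.vtx k = (D.obj i).pt) : comps (D.hom h) ⟶ A := by
  subst e
  exact mor (eqToHom (D.hom_refl i)) ≫ deg A k hk

theorem degEdge_spec {i j : Fin (n + 1)} (h : i ≤ j) (e : i = j) (k : Fin (A.len + 1))
    (hk : A.vtx k = (D.obj i).pt) : Cart (degEdge D A h e k hk) ∧ src (degEdge D A h e k hk) = k ∧
      tgt (degEdge D A h e k hk) = k := by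
  subst e
  refine ⟨cart_mor_comp _ (cart_deg k hk), ?_, ?_⟩
  · exact (src_mor_comp _ _).trans (src_deg k hk)
  · exact (tgt_mor_comp _ _).trans (tgt_deg k hk)

end

/-- A compatible system of edges of a framed object realizing a normalized 2-functor. -/
structure Realization {n : ℕ} (D : PreorderData (Fin (n + 1)) (Rect p)) where
  fib : p.Fiber ⦋n⦌
  isVertex (i : Fin (n + 1)) : IsVertex p fib i (D.obj i).pt
  edge {i j : Fin (n + 1)} (h : i ≤ j) :
    comps (D.hom h) ⟶ (⟨n, fib, fun i => (D.obj i).pt, isVertex⟩ : Framed p)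
  cart {i j : Fin (n + 1)} (h : i ≤ j) : Cart (edge h)
  src_edge {i j : Fin (n + 1)} (h : i ≤ j) : src (edge h) = i
  tgt_edge {i j : Fin (n + 1)} (h : i ≤ j) : tgt (edge h) = j
  edge_trans {i j k : Fin (n + 1)} (h : i ≤ j) (h' : j ≤ k) :
    edge (h.trans h') = mor (D.comp h h').hom ≫ jn (edge h) (edge h')
      ((tgt_edge h).trans (src_edge h').symm)
  edge_refl (i : Fin (n + 1)) : edge (le_refl i) = mor (eqToHom (D.hom_refl i)) ≫ deg _ i rfl

theorem exists_realization_zero (D : PreorderData (Fin (0 + 1)) (Rect p)) :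
    Nonempty (Realization D) := by
  have hi : ∀ i : Fin (0 + 1), i = 0 := fun i => Subsingleton.elim (α := Fin 1) _ _
  have hx : ∀ i : Fin (0 + 1), IsVertex p (D.obj 0).pt i (D.obj i).pt := fun i => by
    rw [hi i]; exact isVertex_self _ _
  let A : Framed p := ⟨0, (D.obj 0).pt, fun i => (D.obj i).pt, hx⟩
  have he : ∀ i j : Fin (0 + 1), i = j := fun i j => (hi i).trans (hi j).symm
  exact ⟨{
    fib := (D.obj 0).pt
    isVertex := hx
    edge := fun {i j} h => degEdge D A h (he i j) i rfl
    cart := fun h => (degEdge_spec D A h _ _ _).1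
    src_edge := fun h => (degEdge_spec D A h _ _ _).2.1
    tgt_edge := fun h => he _ _
    edge_trans := fun {i j k} h h' => by
      obtain rfl := he j k
      refine (comp_refl_jn D A h (degEdge D A h (he i j) i rfl)).symm.trans
        (congrArg (_ ≫ ·) (jn_congr _ rfl ?_))
      change _ = _ ≫ deg A j rfl
      congr 2
      exact he _ _
    edge_refl := fun i => rfl }⟩

/-- Case distinction on whether an element of `[n + 1]` is the last one. -/
@[elab_as_elim]
def initialCases {n : ℕ} {motive : Fin (n + 1 + 1) → Sort*} (last : motive (Fin.last (n + 1)))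
    (cast : ∀ i : Fin (n + 1), motive (initialHom n i)) (j : Fin (n + 1 + 1)) : motive j :=
  Fin.lastCases last cast j

theorem initialCases_last {n : ℕ} {motive : Fin (n + 1 + 1) → Sort*}
    (last : motive (Fin.last (n + 1))) (cast : ∀ i : Fin (n + 1), motive (initialHom n i)) :
    initialCases last cast (Fin.last (n + 1)) = last := Fin.lastCases_last

theorem initialCases_cast {n : ℕ} {motive : Fin (n + 1 + 1) → Sort*}
    (last : motive (Fin.last (n + 1))) (cast : ∀ i : Fin (n + 1), motive (initialHom n i))
    (i : Fin (n + 1)) : initialCases last cast (initialHom n i) = cast i :=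
  Fin.lastCases_castSucc i

theorem not_last_le_initialHom {n : ℕ} (i : Fin (n + 1)) : ¬ Fin.last (n + 1) ≤ initialHom n i :=
  not_le.2 (Fin.castSucc_lt_last i)

/-- The composite edge of the value of `D` from `n` to `n + 1` is glued to the realization of the
restriction. Edges ending earlier are old, and an edge ending at the new vertex is forced to be a
join by the structure isomorphism of `D`; the remaining compatibility is associativity of `D`. -/
theorem exists_realization_succ {n : ℕ} (D : PreorderData (Fin (n + 1 + 1)) (Rect p))
    (r : Realization (D.restrict (initialHom n))) : Nonempty (Realization D) := by
  let N := Fin.last (n + 1)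
  let m : Fin (n + 1 + 1) := initialHom n (Fin.last n)
  have hm : m ≤ N := Fin.le_last _
  let A' : Framed p := ⟨n, r.fib, fun i => (D.obj (initialHom n i)).pt, r.isVertex⟩
  -- The same realization, restated through `D` itself so that the rules for joins match
  -- syntactically.
  obtain ⟨re, re_cart, re_src, re_tgt, re_trans, re_refl⟩ :
      ∃ re : ∀ {i j : Fin (n + 1)} (h : i ≤ j), comps (D.hom ((initialHom n).monotone h)) ⟶ A',
      ∃ (_ : ∀ {i j} (h : i ≤ j), Cart (re h)) (h₁ : ∀ {i j} (h : i ≤ j), src (re h) = i)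
        (h₂ : ∀ {i j} (h : i ≤ j), tgt (re h) = j),
      (∀ {i j k : Fin (n + 1)} (h : i ≤ j) (h' : j ≤ k), re (h.trans h') =
        mor (D.comp ((initialHom n).monotone h) ((initialHom n).monotone h')).hom ≫
          jn (re h) (re h') ((h₂ h).trans (h₁ h').symm)) ∧
      ∀ i, re (le_refl i) = mor (eqToHom (D.hom_refl (initialHom n i))) ≫
        deg (X := D.obj (initialHom n i)) A' i rfl :=
    ⟨r.edge, r.cart, r.src_edge, r.tgt_edge, r.edge_trans, r.edge_refl⟩
  obtain ⟨X, s, t, g⟩ := exists_gluing A' (comps (D.hom hm)) rfl rfl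
  have hl := g.len_left
  obtain ⟨k, x, v, hx⟩ := X
  obtain rfl : n + 1 = k := hl
  have bs : ∀ i, base s i = initialHom n i := fun i => Fin.ext (g.base_left i)
  have bt₀ : src t = m := Fin.ext ((g.base_right 0).trans (Nat.zero_add n))
  have bt₁ : tgt t = N := Fin.ext ((g.base_right (Fin.last _)).trans (Nat.add_comm 1 n))
  -- The vertices of the glued simplex are forced by its pieces; substituting them makes the types
  -- of the edges those demanded by `Realization`.
  obtain rfl : v = fun i => (D.obj i).pt := by
    refine funext (initialCases ?_ fun i => ?_)
    · have := vtx_tgt (P := D.hom hm) t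
      rw [bt₁] at this
      exact this
    · have := vtx_eq s i
      rw [bs] at this
      exact this.symm
  let X : Framed p := ⟨n + 1, x, fun i => (D.obj i).pt, hx⟩
  let s : A' ⟶ X := s
  let t : comps (D.hom hm) ⟶ X := t
  let e₀ {i j : Fin (n + 1)} (h : i ≤ j) : comps (D.hom ((initialHom n).monotone h)) ⟶ X :=
    re h ≫ s
  have src_e₀ : ∀ {i j : Fin (n + 1)} (h : i ≤ j), src (e₀ h) = initialHom n i := fun {i j} h =>
    (congrArg (base s) (re_src h)).trans (bs i)
  have tgt_e₀ : ∀ {i j : Fin (n + 1)} (h : i ≤ j), tgt (e₀ h) = initialHom n j := fun {i j} h =>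
    (congrArg (base s) (re_tgt h)).trans (bs j)
  have cart_e₀ : ∀ {i j : Fin (n + 1)} (h : i ≤ j), Cart (e₀ h) := fun h =>
    (re_cart h).comp g.cart_left
  let e₁ (i : Fin (n + 1)) : comps (D.hom (Fin.le_last (initialHom n i))) ⟶ X :=
    mor (D.comp (i := initialHom n i) (j := m) (k := N) ((initialHom n).monotone (Fin.le_last i))
      hm).hom ≫ jn (e₀ (Fin.le_last i)) t ((tgt_e₀ _).trans bt₀.symm)
  have H : ∃ ν : ∀ {i j : Fin (n + 1 + 1)} (h : i ≤ j), comps (D.hom h) ⟶ X,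
      (∀ {i j : Fin (n + 1)} (h : i ≤ j),
        ν (i := initialHom n i) (j := initialHom n j) ((initialHom n).monotone h) = e₀ h) ∧
      (∀ i : Fin (n + 1), ν (i := initialHom n i) (j := N) (Fin.le_last _) = e₁ i) ∧
      ν (le_refl N) = mor (eqToHom (D.hom_refl N)) ≫ deg X N rfl := by
    let ν (j : Fin (n + 1 + 1)) : ∀ (i : Fin (n + 1 + 1)) (h : i ≤ j), comps (D.hom h) ⟶ X :=
      initialCases (motive := fun j => ∀ (i : Fin (n + 1 + 1)) (h : i ≤ j), comps (D.hom h) ⟶ X)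
        (fun i => initialCases (motive := fun i => ∀ h : i ≤ N, comps (D.hom h) ⟶ X)
          (fun h => mor (eqToHom (D.hom_refl N)) ≫ deg X N rfl) (fun i h => e₁ i) i)
        (fun j i => initialCases (motive := fun i => ∀ h : i ≤ initialHom n j, comps (D.hom h) ⟶ X)
          (fun h => absurd h (not_last_le_initialHom j))
          (fun i h => e₀ (i := i) (j := j) h) i) j
    refine ⟨fun {i j} h => ν j i h, fun {i j} h => ?_, fun i => ?_, ?_⟩
    · simp only [ν, initialCases_cast]
    · simp only [ν, N, initialCases_cast, initialCases_last]
    · simp only [ν, N, initialCases_last]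
  obtain ⟨ν, h₁, h₂, h₃⟩ := H
  have hsrc : ∀ {i j : Fin (n + 1 + 1)} (h : i ≤ j), src (ν h) = i := by
    intro i j
    refine initialCases ?_ (fun j => ?_) j
    · refine initialCases ?_ (fun i => ?_) i
      · intro h; rw [h₃, src_mor_comp, src_deg]
      · intro h
        rw [h₂ i, src_mor_comp, src_jn, src_e₀]
    · refine initialCases ?_ (fun i => ?_) i
      · intro h; exact absurd h (not_last_le_initialHom j)
      · intro h
        exact (congrArg src (h₁ (i := i) (j := j) h)).trans (src_e₀ _)
  have htgt : ∀ {i j : Fin (n + 1 + 1)} (h : i ≤ j), tgt (ν h) = j := by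
    intro i j
    refine initialCases ?_ (fun j => ?_) j
    · refine initialCases ?_ (fun i => ?_) i
      · intro h; rw [h₃, tgt_mor_comp, tgt_deg]
      · intro h
        rw [h₂ i, tgt_mor_comp, tgt_jn, bt₁]
    · refine initialCases ?_ (fun i => ?_) i
      · intro h; exact absurd h (not_last_le_initialHom j)
      · intro h
        exact (congrArg tgt (h₁ (i := i) (j := j) h)).trans (tgt_e₀ _)
  have hcart : ∀ {i j : Fin (n + 1 + 1)} (h : i ≤ j), Cart (ν h) := by
    intro i j
    refine initialCases ?_ (fun j => ?_) j
    · refine initialCases ?_ (fun i => ?_) i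
      · intro h; rw [h₃]; exact cart_mor_comp _ (cart_deg _ _)
      · intro h
        rw [h₂ i]
        exact cart_mor_comp _ (cart_jn _ (cart_e₀ _) g.cart_right)
    · refine initialCases ?_ (fun i => ?_) i
      · intro h; exact absurd h (not_last_le_initialHom j)
      · intro h
        exact (congrArg Cart (h₁ (i := i) (j := j) h)).mpr (cart_e₀ _)
  have hrefl : ∀ i, ν (le_refl i) = mor (eqToHom (D.hom_refl i)) ≫ deg X i rfl := by
    refine initialCases h₃ fun i => ?_
    have A₀ : e₀ (le_refl i) =
        (mor (eqToHom (D.hom_refl (initialHom n i))) ≫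
          deg (X := D.obj (initialHom n i)) A' i rfl) ≫ s :=
      congrArg (fun f => f ≫ s) (re_refl i)
    have A₁ : deg (X := D.obj (initialHom n i)) A' i rfl ≫ s =
        deg (X := D.obj (initialHom n i)) X (initialHom n i) rfl :=
      deg_comp (X := D.obj (initialHom n i)) (A := A') (B := X) i rfl s (initialHom n i) (bs i)
    rw [Category.assoc, A₁] at A₀
    exact (h₁ (le_refl i)).trans A₀
  refine ⟨⟨x, hx, ν, hcart, hsrc, htgt, ?_, hrefl⟩⟩
  intro i j k h h'
  -- For `j = k` the condition is the right unit law of `D`. Otherwise `j` is an old vertex, and the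
  -- edge from `j` to `k` is either old or one of the edges `e₁`.
  by_cases hjk : j = k
  · subst hjk
    refine (comp_refl_jn D X h (ν h)).symm.trans (congrArg (_ ≫ ·) (jn_congr _ rfl ?_))
    refine Eq.trans ?_ (hrefl j).symm
    congr 2
    exact htgt _
  · have hj : j ≠ N := fun e => hjk (le_antisymm h' (e ▸ Fin.le_last k))
    revert h h' hjk hj
    refine initialCases (fun h h' hjk hj => absurd rfl hj) (fun j => ?_) j
    refine initialCases (fun h => absurd h (not_last_le_initialHom j)) (fun i => ?_) i
    refine initialCases ?_ (fun k => ?_) k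
    · intro h h' _ _
      have hij : i ≤ j := h
      have hjn : j ≤ Fin.last n := Fin.le_last j
      have A₁ : ν (i := initialHom n i) (j := N) (h.trans h') = e₁ i := h₂ i
      have A₂ : ν (i := initialHom n j) (j := N) h' = e₁ j := h₂ j
      have A₃ : ν h = e₀ hij := h₁ hij
      have A₄ : e₀ (Fin.le_last i) = mor (D.comp h ((initialHom n).monotone hjn)).hom ≫
          jn (e₀ hij) (e₀ hjn) ((tgt_e₀ _).trans (src_e₀ _).symm) := by
        have A₀ := congrArg (fun f => f ≫ s) (re_trans hij hjn)
        simp only [Category.assoc, jn_comp] at A₀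
        exact A₀
      -- Associativity for `i ≤ j ≤ n ≤ n + 1`, evaluated on the join of the edges `i → j`, `j → n`
      -- and `t`.
      have A₅ := D.assoc h ((initialHom n).monotone hjn) hm
      have h₅ := congrArg (fun η => mor η ≫ jn (e₀ hij) (jn (e₀ hjn) t ((tgt_e₀ _).trans bt₀.symm))
        (by rw [src_jn, src_e₀, tgt_e₀])) A₅
      simp only [mor_comp, Category.assoc] at h₅
      rw [mor_associator_jn _ _ _ ((tgt_e₀ _).trans (src_e₀ _).symm) ((tgt_e₀ _).trans bt₀.symm),
        mor_whiskerRight_jn, mor_whiskerLeft_jn] at h₅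
      refine A₁.trans (Eq.trans ?_ (h₅.trans ?_))
      · exact congrArg (_ ≫ ·) (jn_congr _ A₄ rfl)
      · exact congrArg (_ ≫ ·) (jn_congr _ A₃.symm A₂.symm)
    · intro h h' _ _
      have hij : i ≤ j := h
      have hjk : j ≤ k := h'
      have A₀ := congrArg (fun f => f ≫ s) (re_trans hij hjk)
      simp only [Category.assoc, jn_comp] at A₀
      refine (h₁ (hij.trans hjk)).trans (A₀.trans ?_)
      exact congrArg (mor (D.comp h h').hom ≫ ·) (jn_congr _ (h₁ hij).symm (h₁ hjk).symm)

end Rect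

/-! ### Cartesian morphisms of the simplicial replacement. -/

section CartesianMorphisms

variable {C : Type u₃} [Bicategory.{w₂, v₂} C]

open SimplicialReplacement

theorem base_eq_of_isHomLift {Y Z : SimplicialReplacement C} (b : Z.base ⟶ Y.base) (φ : Z ⟶ Y)
    (h : (proj C).IsHomLift b φ) : b = φ.base := by
  have := CategoryTheory.IsHomLift.fac (proj C) b φ
  refine this.trans ?_
  exact (Category.id_comp _).trans (Category.comp_id _)

theorem isHomLift_base {X Y : SimplicialReplacement C} (φ : X ⟶ Y) :
    (proj C).IsHomLift φ.base φ := inferInstanceAs ((proj C).IsHomLift ((proj C).map φ) φ)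

theorem vertical_comp {c : SimplexCategory}
    {γ γ' : StrictlyUnitaryPseudofunctor (LocallyDiscrete (Fin (c.len + 1))) C}
    (δ : γ' ⟶ γ) {Y : SimplicialReplacement C} (b : c ⟶ Y.base)
    (α : γ ⟶ (restrict b.toOrderHom).obj Y.fiber) :
    @CategoryStruct.comp (SimplicialReplacement C) _ ⟨c, γ'⟩ ⟨c, γ⟩ Y
      (Hom.mk (𝟙 c) δ) (Hom.mk b α) = Hom.mk b (δ ≫ α) := by
  with_unfolding_all rfl

theorem fiber_injective {c : SimplexCategory}
    {γ : StrictlyUnitaryPseudofunctor (LocallyDiscrete (Fin (c.len + 1))) C}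
    {Y : SimplicialReplacement C} {b : c ⟶ Y.base}
    {α α' : γ ⟶ (restrict b.toOrderHom).obj Y.fiber}
    (h : (Hom.mk b α : (⟨c, γ⟩ : SimplicialReplacement C) ⟶ Y) = Hom.mk b α') : α = α' := by
  injection h

theorem isCartesian_of_isIso {X Y : SimplicialReplacement C} (φ : X ⟶ Y) (h : IsIso φ.fiber) :
    (proj C).IsCartesian ((proj C).map φ) φ where
  universal_property {Z} ψ hψ := by
    obtain ⟨c, γ⟩ := Z
    obtain ⟨c', γ'⟩ := X
    obtain rfl : c = c' := CategoryTheory.IsHomLift.domain_eq (proj C) ((proj C).map φ) ψ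
    obtain ⟨b, α⟩ := φ
    obtain ⟨b', β⟩ := ψ
    obtain rfl : b = b' := base_eq_of_isHomLift (Y := Y) (Z := ⟨c, γ⟩) b ⟨b', β⟩ hψ
    obtain ⟨α', h₁, h₂⟩ := h
    have h₃ : (β ≫ α') ≫ α = β :=
      (Category.assoc (X := (restrict b.toOrderHom).obj Y.fiber) (Y := γ') β α' α).trans
        ((congrArg (β ≫ ·) h₂).trans (Category.comp_id β))
    refine ⟨Hom.mk (𝟙 c) (β ≫ α'), ⟨isHomLift_base (X := ⟨c, γ⟩) (Y := ⟨c, γ'⟩)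
      (Hom.mk (𝟙 c) (β ≫ α')), ?_⟩, ?_⟩
    · refine (vertical_comp (γ := γ') (γ' := γ) (β ≫ α') b α).trans ?_
      exact congrArg (fun β : γ ⟶ (restrict b.toOrderHom).obj Y.fiber =>
        (Hom.mk b β : Hom ⟨c, γ⟩ Y)) h₃
    · rintro ⟨b', δ⟩ ⟨h₃, h₄⟩
      obtain rfl : 𝟙 c = b' := base_eq_of_isHomLift (Z := ⟨c, γ⟩) (Y := ⟨c, γ'⟩) (𝟙 c) ⟨b', δ⟩ h₃
      have h₆ : δ ≫ α = β := fiber_injective ((vertical_comp (γ' := γ) (γ := γ') δ b α).symm.trans h₄)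
      have h₇ : δ = β ≫ α' := by
        subst h₆
        exact ((Category.assoc (W := γ) (X := γ') (Y := (restrict b.toOrderHom).obj Y.fiber) (Z := γ') δ α α').trans
          ((congrArg (CategoryStruct.comp (X := γ) (Y := γ') δ) h₁).trans
            (Category.comp_id (X := γ) (Y := γ') δ))).symm
      exact congrArg (fun δ : γ ⟶ γ' => (Hom.mk (𝟙 c) δ : Hom ⟨c, γ⟩ ⟨c, γ'⟩)) h₇

/-- The canonical lift, with identity fiber part, factors through `φ` and gives `δ` with `δ ≫ α =
𝟙`. Uniqueness of factorizations through `φ` gives `α ≫ δ = 𝟙`. -/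
theorem isIso_fiber_of_isCartesian {X Y : SimplicialReplacement C} (φ : X ⟶ Y)
    (h : (proj C).IsCartesian ((proj C).map φ) φ) : IsIso φ.fiber := by
  obtain ⟨c, γ⟩ := X
  obtain ⟨b, α⟩ := φ
  obtain ⟨⟨b', δ⟩, ⟨h₁, h₂⟩, -⟩ := @Functor.IsCartesian.universal_property _ _ _ _ (proj C) _ _ _ _
    ((proj C).map _) _ h ⟨c, (restrict b.toOrderHom).obj Y.fiber⟩ (Hom.mk b (𝟙 _))
    (isHomLift_base (X := ⟨c, (restrict b.toOrderHom).obj Y.fiber⟩) (Hom.mk b (𝟙 _)))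
  obtain rfl : 𝟙 c = b' :=
    base_eq_of_isHomLift (Y := ⟨c, γ⟩) (Z := ⟨c, _⟩) (𝟙 c) ⟨b', δ⟩ h₁
  have h₄ : CategoryStruct.comp (Y := γ) δ α = 𝟙 _ :=
    fiber_injective ((vertical_comp (γ := γ) δ b α).symm.trans h₂)
  have h₅ : (α ≫ δ) ≫ α = α := (Category.assoc (W := γ)
    (X := (restrict b.toOrderHom).obj Y.fiber) (Y := γ) α δ α).trans
    ((congrArg (α ≫ ·) h₄).trans (Category.comp_id α))
  have e := (@Functor.IsCartesian.universal_property _ _ _ _ (proj C) _ _ _ _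
      ((proj C).map _) _ h ⟨c, γ⟩ _ (isHomLift_base (X := ⟨c, γ⟩) (Hom.mk b α))).unique
    ⟨isHomLift_base (X := ⟨c, γ⟩) (Y := ⟨c, γ⟩) (Hom.mk (𝟙 c) (α ≫ δ)),
      (vertical_comp (γ := γ) (γ' := γ) (α ≫ δ) b α).trans (congrArg (Hom.mk b) h₅)⟩
    ⟨isHomLift_base (𝟙 (⟨c, γ⟩ : SimplicialReplacement C)), Category.id_comp _⟩
  have h₆ : α ≫ δ = 𝟙 γ := fiber_injective (Y := ⟨c, γ⟩) (b := 𝟙 c) e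
  exact ⟨δ, h₆, h₄⟩

theorem isSplitEpi_of_comp_comp {D : Type*} [Category* D] {X Y Z W : D} (x : X ⟶ Y) (y : Y ⟶ Z)
    (e : Z ⟶ W) [IsIso e] (s : W ⟶ X) (h : s ≫ x ≫ y ≫ e = 𝟙 W) : IsSplitEpi y :=
  ⟨⟨⟨e ≫ s ≫ x, by rw [← cancel_mono e]; simp [h]⟩⟩⟩

theorem homCast_isSplitEpi {a a' b b' : C} (ha : a = a') (hb : b = b') {f g : a' ⟶ b'}
    (θ : f ⟶ g) (h : IsSplitEpi ((homCast ha hb).map θ)) : IsSplitEpi θ := by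
  subst ha; subst hb; exact h

theorem Icon.app_comp_app {B : Type u₁} [Bicategory.{w₁, v₁} B]
    {F G : StrictlyUnitaryPseudofunctor B C} (α : F ⟶ G) (β : G ⟶ F) (h : α ≫ β = 𝟙 F) {a b : B}
    (f : a ⟶ b) : Icon.app α f ≫
      (homCast (Icon.obj_eq α a) (Icon.obj_eq α b)).map (Icon.app β f) ≫
          eqToHom (homCast_trans _ _ (Icon.obj_eq β a) (Icon.obj_eq β b) _) = 𝟙 (F.map f) := by
  have key : ∀ (γ : F ⟶ F), γ = 𝟙 F → Icon.app γ f = 𝟙 (F.map f) := by rintro _ rfl; rfl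
  exact key _ h

/-- One inverse law makes a component a split monomorphism. The other makes a transport of it a
split epimorphism, and transport reflects this, so no explicit transported inverse is needed. -/
theorem Icon.invertible_of_isIso {B : Type u₁} [Bicategory.{w₁, v₁} B]
    {F G : StrictlyUnitaryPseudofunctor B C} (α : F ⟶ G) (h : IsIso α) : Icon.Invertible α := by
  intro a b f
  obtain ⟨β, h₁, h₂⟩ := h
  have e₁ := Icon.app_comp_app α β h₁ f
  have e₂ := Icon.app_comp_app β α h₂ f
  have m : IsSplitMono (Icon.app α f) := ⟨⟨⟨_, e₁⟩⟩⟩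
  have s : IsSplitEpi ((homCast (Icon.obj_eq β a) (Icon.obj_eq β b)).map (Icon.app α f)) :=
    isSplitEpi_of_comp_comp (Icon.app β f) _ (eqToHom (homCast_trans (Icon.obj_eq β a)
      (Icon.obj_eq β b) (Icon.obj_eq α a) (Icon.obj_eq α b) (G.map f))) (𝟙 _)
      ((Category.id_comp _).trans e₂)
  have s' := homCast_isSplitEpi _ _ _ s
  exact isIso_of_mono_of_isSplitEpi _

end CartesianMorphisms

/-! ### The nerve preserves cartesian morphisms. -/

namespace Rect

open Framed

variable {E : Type u₁} [Category.{v₁} E] {p : E ⥤ SimplexCategory}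
  [hp : p.IsFibered] [hs : IsSegal p] [hd : IsDiscrete (p.Fiber ⦋0⦌)]

/-- Each component compares two cartesian edges of `B` with the same endpoints: the image of a
chosen edge of `A` and a chosen edge of `B`. -/
theorem isCartesian_nerve {A B : Framed p} {f : A ⟶ B} (hf : Cart f) :
    (SimplicialReplacement.proj (Rect p)).IsCartesian
      ((SimplicialReplacement.proj (Rect p)).map ((nerve p).map f)) ((nerve p).map f) := by
  refine isCartesian_of_isIso _ ?_
  refine isIso_of_invertible (F := (nerveObj A).fiber)
    (G := restrictObj (base f) (nerveObj B).fiber) (nerveIcon f) ?_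
  intro i j u
  refine isIso_of_cart (edgeApp f (leOfHom u.as)) (cart_castMap_comp (obj_eq_of_hom f i.as)
    (obj_eq_of_hom f j.as) _ (cart_edgeMap B ((base f).monotone (leOfHom u.as)))) ?_
  exact (congrArg Cart (edgeApp_comp f (leOfHom u.as))).mpr ((cart_edgeMap A _).comp hf)

end Rect

/-- An isomorphism in the fiber of the simplicial replacement. -/
def SimplicialReplacement.isoMk {C : Type u₃} [Bicategory.{w₂, v₂} C] {c : SimplexCategory}
    {γ γ' : StrictlyUnitaryPseudofunctor (LocallyDiscrete (Fin (c.len + 1))) C} (e : γ ≅ γ') :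
    (⟨c, γ⟩ : SimplicialReplacement C) ≅ ⟨c, γ'⟩ where
  hom := Hom.mk (𝟙 c) e.hom
  inv := Hom.mk (𝟙 c) e.inv
  hom_inv_id := (vertical_comp (Y := ⟨c, γ⟩) e.hom (𝟙 c) e.inv).trans
    (congrArg (fun δ : γ ⟶ γ => (Hom.mk (𝟙 c) δ : Hom ⟨c, γ⟩ ⟨c, γ⟩)) e.hom_inv_id)
  inv_hom_id := (vertical_comp (Y := ⟨c, γ'⟩) e.inv (𝟙 c) e.hom).trans
    (congrArg (fun δ : γ' ⟶ γ' => (Hom.mk (𝟙 c) δ : Hom ⟨c, γ'⟩ ⟨c, γ'⟩)) e.inv_hom_id)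

/-! ### Naming vertices does not change the total category. -/

section Comparison

variable {E : Type u₁} [Category.{v₁} E] (p : E ⥤ SimplexCategory) [hp : p.IsFibered]

open Functor Functor.IsPreFibered

/-- An object of the total category with vertices chosen by the cleavage. -/
noncomputable def Framed.mk' (x : E) : Framed p where
  len := (p.obj x).len
  obj := ⟨x, rfl⟩
  vtx i := ⟨pullbackObj rfl (SimplexCategory.const ⦋0⦌ ⦋(p.obj x).len⦌ i), pullbackObj_proj _ _⟩
  isVertex i := ⟨pullbackMap rfl (SimplexCategory.const ⦋0⦌ ⦋(p.obj x).len⦌ i),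
    (pullbackMap.IsCartesian (p := p) (S := ⦋(p.obj x).len⦌) (a := x) rfl _).toIsHomLift⟩

/-- The equivalence of the total category with the category of framed objects. -/
noncomputable def framing : E ⥤ Framed p where
  obj x := Framed.mk' p x
  map f := ⟨(p.map f).toOrderHom, f, inferInstanceAs (p.IsHomLift (p.map f) f)⟩
  map_id _ := Framed.hom_ext rfl
  map_comp _ _ := Framed.hom_ext rfl

instance : (framing p).Faithful where
  map_injective {x y _ _} h :=
    congrArg (fun φ : Framed.mk' p x ⟶ Framed.mk' p y => φ.hom) h

instance : (framing p).Full where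
  map_surjective φ := ⟨φ.hom, Framed.hom_ext rfl⟩

instance : (framing p).EssSurj where
  mem_essImage X := by
    obtain ⟨n, ⟨x, hx⟩, v, hv⟩ := X
    obtain rfl : n = (p.obj x).len := congrArg SimplexCategory.len hx.symm
    exact ⟨x, ⟨{
      hom := ⟨OrderHom.id, 𝟙 x, CategoryTheory.IsHomLift.id hx⟩
      inv := ⟨OrderHom.id, 𝟙 x, CategoryTheory.IsHomLift.id hx⟩
      hom_inv_id := Framed.hom_ext (Category.id_comp _)
      inv_hom_id := Framed.hom_ext (Category.id_comp _) }⟩⟩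

instance : (framing p).IsEquivalence where

end Comparison

/-! ### The nerve is an equivalence: existence of the rectification. -/

namespace Rect

open Framed

variable {E : Type u₁} [Category.{v₁} E] {p : E ⥤ SimplexCategory}
  [hp : p.IsFibered] [hs : IsSegal p] [hd : IsDiscrete (p.Fiber ⦋0⦌)]

theorem exists_realization {n : ℕ} (D : PreorderData (Fin (n + 1)) (Rect p)) :
    Nonempty (Realization D) := by
  induction n with
  | zero => exact exists_realization_zero D
  | succ n ih => exact (ih (D.restrict (initialHom n))).elim (exists_realization_succ D)

/-- The chosen edges of the simplex and the edges of the realization are cartesian with the same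
endpoints. The isomorphisms between them respect units and compositions because both families do so
inside the simplex. -/
theorem Realization.exists_iso_preorderData {n : ℕ} {D : PreorderData (Fin (n + 1)) (Rect p)}
    (r : Realization D) : Nonempty
      ((preorderData ⟨n, r.fib, fun i => (D.obj i).pt, r.isVertex⟩).toPseudofunctor ≅
        D.toPseudofunctor) := by
  let A : Framed p := ⟨n, r.fib, fun i => (D.obj i).pt, r.isVertex⟩
  have H : ∀ {i j : Fin (n + 1)} (h : i ≤ j), ∃ η : (edgeLift A h).hom ≅ D.hom h,
      mor η.hom ≫ r.edge h = edgeMap A h := fun h =>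
    exists_iso (r.cart h) (cart_edgeMap A h) (by rw [r.src_edge, src_edgeMap])
      (by rw [r.tgt_edge, tgt_edgeMap])
  choose η hη using @H
  have h_refl : ∀ i, (η (le_refl i)).hom ≫ eqToHom (D.hom_refl i) =
      eqToHom (edgeLift_refl_hom A i) := by
    intro i
    refine hom_ext_cart (cart_deg (X := D.obj i) (A := A) i rfl) ?_
    rw [mor_comp, Category.assoc]
    exact (congrArg (mor (η (le_refl i)).hom ≫ ·) (r.edge_refl i).symm).trans
      ((hη (le_refl i)).trans (mor_eqToHom_deg A i).symm)
  have h_comp : ∀ {i j k : Fin (n + 1)} (h : i ≤ j) (h' : j ≤ k),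
      (η (h.trans h')).hom ≫ (D.comp h h').hom = (edgeComp A h h').hom ≫
        (η h).hom ▷ (edgeLift A h').hom ≫ D.hom h ◁ (η h').hom := by
    intro i j k h h'
    refine hom_ext_cart (cart_jn ((r.tgt_edge h).trans (r.src_edge h').symm) (r.cart h)
      (r.cart h')) ?_
    simp only [mor_comp, Category.assoc]
    rw [mor_whiskerLeft_jn, mor_whiskerRight_jn, jn_congr _ (hη h) (hη h'), edgeComp_jn]
    exact (congrArg (mor (η (h.trans h')).hom ≫ ·) (r.edge_trans h h').symm).trans (hη _)
  let α : Icon (preorderData A).toPseudofunctor.toPseudofunctor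
      D.toPseudofunctor.toPseudofunctor :=
    { obj_eq := fun _ => rfl
      app := fun u => (η (leOfHom u.as)).hom
      naturality := fun {a b f g} θ => by
        obtain rfl := LocallyDiscrete.eq_of_hom θ
        exact (Category.id_comp _).trans (Category.comp_id _).symm
      app_id := fun a => (h_refl a.as).trans (Category.comp_id _).symm
      app_comp := fun f g => (h_comp (leOfHom f.as) (leOfHom g.as)).trans
        (congrArg (fun x => (edgeComp A (leOfHom f.as) (leOfHom g.as)).hom ≫
          (η (leOfHom f.as)).hom ▷ _ ≫ x) (Category.comp_id _).symm) }
  have : IsIso (C := StrictlyUnitaryPseudofunctor (LocallyDiscrete (Fin (n + 1))) (Rect p))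
      (X := (preorderData A).toPseudofunctor) (Y := D.toPseudofunctor) α :=
    isIso_of_invertible α fun a b f => inferInstanceAs (IsIso (η (leOfHom f.as)).hom)
  exact ⟨@asIso _ _ _ _ α this⟩

instance : (nerve p).EssSurj where
  mem_essImage X := by
    obtain ⟨c, γ⟩ := X
    obtain ⟨r⟩ := exists_realization (n := c.len) (PreorderData.ofPseudofunctor γ)
    obtain ⟨e⟩ := r.exists_iso_preorderData
    obtain ⟨e'⟩ := exists_iso_ofPseudofunctor γ
    exact ⟨⟨c.len, r.fib, _, r.isVertex⟩, ⟨SimplicialReplacement.isoMk (c := c) (e ≪≫ e')⟩⟩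

instance : (nerve p).IsEquivalence where

variable (p) in
/-- The equivalence of a 2-category with the simplicial replacement of its rectification. -/
noncomputable def rectification : TwoFunctor p (SimplicialReplacement.proj (Rect p)) where
  functor := framing p ⋙ nerve p
  comm := NatIso.ofComponents (fun x => Iso.refl (p.obj x)) fun f =>
    (Category.comp_id (p.map f)).trans (Category.id_comp (p.map f)).symm
  cartesian f hf := isCartesian_nerve (cart_of_isCartesian ((framing p).map f) hf)

theorem equivalent : Equivalent p (SimplicialReplacement.proj (Rect p)) :=
  ⟨rectification p, inferInstanceAs (framing p ⋙ nerve p).IsEquivalence⟩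

end Rect

/-! ### Local equivalences of 2-categories and strong equivalence. -/

section LocalEquivalence

variable {B : Type u₁} [Bicategory.{w₁, v₁} B] {C : Type u₂} [Bicategory.{w₂, v₂} C]

/-- A 2-functor that is bijective on objects and an equivalence on categories of morphisms. -/
structure IsLocalEquivalence (F : B ⥤ᵖ C) : Prop where
  obj_bijective : Function.Bijective F.obj
  map₂_bijective {a b : B} (f g : a ⟶ b) : Function.Bijective fun η : f ⟶ g => F.map₂ η
  exists_iso {a b : B} (h : F.obj a ⟶ F.obj b) : ∃ f : a ⟶ b, Nonempty (F.map f ≅ h)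

namespace IsLocalEquivalence

variable {F : B ⥤ᵖ C} (hF : IsLocalEquivalence F)
include hF

theorem exists_map₂ {a b : B} {f g : a ⟶ b} (θ : F.map f ⟶ F.map g) :
    ∃ η : f ⟶ g, F.map₂ η = θ := (hF.map₂_bijective f g).2 θ

theorem map₂_injective {a b : B} {f g : a ⟶ b} {η η' : f ⟶ g} (h : F.map₂ η = F.map₂ η') :
    η = η' := (hF.map₂_bijective f g).1 h

theorem exists_map₂Iso {a b : B} {f g : a ⟶ b} (θ : F.map f ≅ F.map g) :
    ∃ η : f ≅ g, F.map₂ η.hom = θ.hom ∧ F.map₂ η.inv = θ.inv := by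
  obtain ⟨η, h₁⟩ := hF.exists_map₂ θ.hom
  obtain ⟨η', h₂⟩ := hF.exists_map₂ θ.inv
  exact ⟨⟨η, η', hF.map₂_injective (by simp [h₁, h₂]), hF.map₂_injective (by simp [h₁, h₂])⟩,
    h₁, h₂⟩

theorem isIso_of_map₂ {a b : B} {f g : a ⟶ b} (η : f ⟶ g) (h : IsIso (F.map₂ η)) : IsIso η := by
  obtain ⟨e, h₁, -⟩ := hF.exists_map₂Iso (asIso (F.map₂ η))
  rw [← hF.map₂_injective h₁]
  infer_instance

end IsLocalEquivalence

end LocalEquivalence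

section Lifting

variable {B : Type u₁} [Bicategory.{w₁, v₁} B] {C : Type u₂} [Bicategory.{w₂, v₂} C]
  {D : Type u₃} [Bicategory.{w₂, v₃} D]

/-- For every 1-morphism a preimage under `F` up to an isomorphism `φ` is chosen. Conjugating the
structure of `H` by `φ` puts it in the image of `F`, and faithfulness on 2-morphisms transfers the
axioms. -/
theorem IsLocalEquivalence.exists_lift {F : B ⥤ᵖ C} (hF : IsLocalEquivalence F) (H : D ⥤ᵖ C)
    (g : D → B) (hg : ∀ d, H.obj d = F.obj (g d)) :
    ∃ (G : D ⥤ᵖ B) (α : Icon H (G.comp F)), G.obj = g ∧ α.Invertible := by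
  obtain ⟨⟨⟨⟨Hobj, H₁⟩, H₂⟩, h₁, h₂⟩, HI, HC, h₃, h₄, h₅, h₆, h₇⟩ := H
  obtain rfl : Hobj = fun d => F.obj (g d) := funext hg
  dsimp only at H₁ H₂ h₁ h₂ HI HC h₃ h₄ h₅ h₆ h₇
  have e : ∀ {d d' : D} (f : d ⟶ d'), ∃ m : g d ⟶ g d', Nonempty (F.map m ≅ H₁ f) :=
    fun f => hF.exists_iso (H₁ f)
  choose G₁ φ using @e
  replace φ {d d' : D} (f : d ⟶ d') : F.map (G₁ f) ≅ H₁ f := (φ f).some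
  have e₂ : ∀ {d d' : D} {f f' : d ⟶ d'} (η : f ⟶ f'), ∃ θ : G₁ f ⟶ G₁ f',
      F.map₂ θ = (φ f).hom ≫ H₂ η ≫ (φ f').inv := fun η => hF.exists_map₂ _
  choose G₂ hG₂ using @e₂
  have eI : ∀ d : D, ∃ θ : G₁ (𝟙 d) ≅ 𝟙 (g d),
      F.map₂ θ.hom = (φ (𝟙 d) ≪≫ HI d ≪≫ (F.mapId (g d)).symm).hom ∧
        F.map₂ θ.inv = (φ (𝟙 d) ≪≫ HI d ≪≫ (F.mapId (g d)).symm).inv :=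
    fun d => hF.exists_map₂Iso _
  choose GI hGI hGI' using eI
  have eC : ∀ {d d' d'' : D} (f : d ⟶ d') (f' : d' ⟶ d''), ∃ θ : G₁ (f ≫ f') ≅ G₁ f ≫ G₁ f',
      F.map₂ θ.hom = (φ (f ≫ f')).hom ≫ (HC f f').hom ≫ (φ f).inv ▷ H₁ f' ≫
        F.map (G₁ f) ◁ (φ f').inv ≫ (F.mapComp (G₁ f) (G₁ f')).inv ∧
      F.map₂ θ.inv = (F.mapComp (G₁ f) (G₁ f')).hom ≫ F.map (G₁ f) ◁ (φ f').hom ≫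
        (φ f).hom ▷ H₁ f' ≫ (HC f f').inv ≫ (φ (f ≫ f')).inv := fun f f' => by
    obtain ⟨θ, h, h'⟩ := hF.exists_map₂Iso (φ (f ≫ f') ≪≫ HC f f' ≪≫
      whiskerRightIso (φ f).symm (H₁ f') ≪≫ whiskerLeftIso (F.map (G₁ f)) (φ f').symm ≪≫
        (F.mapComp (G₁ f) (G₁ f')).symm)
    exact ⟨θ, by simpa using h, by simpa using h'⟩
  choose GC hGC hGC' using @eC
  let G : D ⥤ᵖ B :=
    { obj := g
      map := G₁
      map₂ := G₂
      map₂_id := fun f => hF.map₂_injective (by simp [hG₂, h₁])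
      map₂_comp := fun η θ => hF.map₂_injective (by simp [hG₂, h₂])
      mapId := GI
      mapComp := GC
      map₂_whisker_left := fun f _ _ η => hF.map₂_injective (by
        simp [hG₂, hGC, hGC', h₃, whisker_exchange_assoc])
      map₂_whisker_right := fun η f => hF.map₂_injective (by
        simp [hG₂, hGC, hGC', h₄, whisker_exchange_assoc])
      map₂_associator := fun f f' f'' => hF.map₂_injective (by
        -- The interchange needed to cancel the conjugations at the two outer 1-morphisms, which
        -- `simp` does not find in this bracketing.
        have x := whisker_exchange (φ f).inv (H₁ f' ◁ (φ f'').hom)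
        simp only [whiskerRight_comp, Category.assoc] at x
        simp only [hG₂, hGC, hGC', h₅, whisker_exchange_assoc, F.map₂_comp, F.map₂_whisker_left,
          F.map₂_whisker_right, F.map₂_associator]
        simp [whisker_exchange_assoc, ← reassoc_of% x])
      map₂_left_unitor := fun f => hF.map₂_injective (by
        simp [hG₂, hGC, hGI, h₆, whisker_exchange_assoc])
      map₂_right_unitor := fun f => hF.map₂_injective (by
        simp [hG₂, hGC, hGI, h₇, ← whisker_exchange_assoc]) }
  refine ⟨G, ⟨fun _ => rfl, fun f => (φ f).inv, ?_, ?_, ?_⟩, rfl, ?_⟩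
  · intro a b f f' η
    change H₂ η ≫ (φ f').inv = (φ f).inv ≫ F.map₂ (G₂ η)
    simp [hG₂]
  · intro a
    change (φ (𝟙 a)).inv ≫ F.map₂ (GI a).hom ≫ (F.mapId (g a)).hom = (HI a).hom ≫ 𝟙 _
    simp [hGI]
  · intro a b c f f'
    change (φ (f ≫ f')).inv ≫ F.map₂ (GC f f').hom ≫ (F.mapComp (G₁ f) (G₁ f')).hom =
      (HC f f').hom ≫ (φ f).inv ▷ H₁ f' ≫ F.map (G₁ f) ◁ (φ f').inv ≫ 𝟙 _
    simp [hGC]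
  · intro a b f
    exact inferInstanceAs (IsIso (φ f).inv)

/-- A 2-morphism between 2-functors lifts through a local equivalence. -/
theorem IsLocalEquivalence.exists_icon {F : B ⥤ᵖ C} (hF : IsLocalEquivalence F) (P Q : D ⥤ᵖ B)
    (α : Icon (P.comp F) (Q.comp F)) (hα : α.Invertible) : ∃ β : Icon P Q, β.Invertible := by
  -- Agreement on objects is reflected by `F` because it is injective on objects; for this reason
  -- local equivalences are required to be bijective there.
  have hPQ : ∀ d, P.obj d = Q.obj d := fun d => hF.obj_bijective.1 (α.obj_eq d)
  obtain ⟨⟨⟨⟨Qobj, Q₁⟩, Q₂⟩, h₁, h₂⟩, QI, QC, h₃, h₄, h₅, h₆, h₇⟩ := Q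
  obtain rfl : P.obj = Qobj := funext hPQ
  let θ {a b : D} (f : a ⟶ b) : F.map (P.map f) ⟶ F.map (Q₁ f) := α.app f
  have hθ {a b : D} (f : a ⟶ b) : IsIso (θ f) := hα f
  have nat {a b : D} {f g : a ⟶ b} (η : f ⟶ g) :
      F.map₂ (P.map₂ η) ≫ θ g = θ f ≫ F.map₂ (Q₂ η) := α.naturality η
  have hid (a : D) : θ (𝟙 a) ≫ F.map₂ (QI a).hom ≫ (F.mapId (P.obj a)).hom =
      F.map₂ (P.mapId a).hom ≫ (F.mapId (P.obj a)).hom :=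
    (α.app_id a).trans (Category.comp_id _)
  have hcomp {a b c : D} (f : a ⟶ b) (g : b ⟶ c) :
      θ (f ≫ g) ≫ F.map₂ (QC f g).hom ≫ (F.mapComp (Q₁ f) (Q₁ g)).hom =
        (F.map₂ (P.mapComp f g).hom ≫ (F.mapComp (P.map f) (P.map g)).hom) ≫
          θ f ▷ F.map (P.map g) ≫ F.map (Q₁ f) ◁ θ g := by
    refine (α.app_comp f g).trans ?_
    exact congrArg (fun t => (F.map₂ (P.mapComp f g).hom ≫
      (F.mapComp (P.map f) (P.map g)).hom) ≫ θ f ▷ F.map (P.map g) ≫ t)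
      (Category.comp_id (F.map (Q₁ f) ◁ θ g))
  have e : ∀ {a b : D} (f : a ⟶ b), ∃ η : P.map f ⟶ Q₁ f, F.map₂ η = θ f :=
    fun f => hF.exists_map₂ _
  choose η hη using @e
  refine ⟨⟨fun _ => rfl, η, ?_, ?_, ?_⟩, ?_⟩
  · intro a b f g ξ
    change P.map₂ ξ ≫ η g = η f ≫ Q₂ ξ
    exact hF.map₂_injective (by simp [hη, nat])
  · intro a
    change η (𝟙 a) ≫ (QI a).hom = (P.mapId a).hom ≫ 𝟙 _
    refine hF.map₂_injective ?_
    rw [← cancel_mono (F.mapId (P.obj a)).hom]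
    simp [hη, hid]
  · intro a b c f g
    change η (f ≫ g) ≫ (QC f g).hom = (P.mapComp f g).hom ≫ η f ▷ P.map g ≫ Q₁ f ◁ η g ≫ 𝟙 _
    refine hF.map₂_injective ?_
    rw [← cancel_mono (F.mapComp (Q₁ f) (Q₁ g)).hom]
    simp [hη, hcomp]
  · intro a b f
    exact hF.isIso_of_map₂ (η f) (by rw [hη]; exact hθ f)

/-- The composition of a 2-functor with a 2-morphism from the identity to a composite. -/
def Icon.unitComp (F : B ⥤ᵖ C) (G : C ⥤ᵖ B) (α : Icon (Pseudofunctor.id C) (G.comp F)) :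
    Icon ((Pseudofunctor.id B).comp F) ((F.comp G).comp F) where
  obj_eq b := α.obj_eq (F.obj b)
  app f := α.app (F.map f)
  naturality η := α.naturality (F.map₂ η)
  app_id b := by
    have h : (((F.comp G).comp F).mapId b).hom =
        (G.comp F).map₂ (F.mapId b).hom ≫ ((G.comp F).mapId (F.obj b)).hom := by
      change F.map₂ (G.map₂ (F.mapId b).hom ≫ (G.mapId (F.obj b)).hom) ≫ (F.mapId _).hom =
        F.map₂ (G.map₂ (F.mapId b).hom) ≫ F.map₂ (G.mapId (F.obj b)).hom ≫ (F.mapId _).hom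
      rw [F.map₂_comp, Category.assoc]
    have h' : (((Pseudofunctor.id B).comp F).mapId b).hom = (F.mapId b).hom := by
      change F.map₂ (𝟙 (𝟙 b)) ≫ (F.mapId b).hom = _
      rw [F.map₂_id, Category.id_comp]
    refine (congrArg (fun x => α.app (F.map (𝟙 b)) ≫ (homCast _ _).map x) h).trans ?_
    refine Eq.trans ?_ (congrArg (· ≫ eqToHom _) h').symm
    refine Eq.trans ?_ ((congrArg (fun x => (F.mapId b).hom ≫ x) ((α.app_id (F.obj b)).trans
      (Category.id_comp _))))
    refine (congrArg (fun x => α.app (F.map (𝟙 b)) ≫ x) (Functor.map_comp _ _ _)).trans ?_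
    refine (Category.assoc _ _ _).symm.trans (Eq.trans ?_ (Category.assoc _ _ _))
    exact congrArg (· ≫ _) (α.naturality (F.mapId b).hom).symm
  app_comp {a b c} f g := by
    have h : (((F.comp G).comp F).mapComp f g).hom =
        (G.comp F).map₂ (F.mapComp f g).hom ≫ ((G.comp F).mapComp (F.map f) (F.map g)).hom := by
      change F.map₂ (G.map₂ (F.mapComp f g).hom ≫ (G.mapComp (F.map f) (F.map g)).hom) ≫
        (F.mapComp _ _).hom = F.map₂ (G.map₂ (F.mapComp f g).hom) ≫
          F.map₂ (G.mapComp (F.map f) (F.map g)).hom ≫ (F.mapComp _ _).hom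
      rw [F.map₂_comp, Category.assoc]
    have h' : (((Pseudofunctor.id B).comp F).mapComp f g).hom = (F.mapComp f g).hom := by
      change F.map₂ (𝟙 (f ≫ g)) ≫ (F.mapComp f g).hom = _
      rw [F.map₂_id, Category.id_comp]
    refine (congrArg (fun x => α.app (F.map (f ≫ g)) ≫ (homCast _ _).map x) h).trans ?_
    refine Eq.trans ?_ (congrArg (· ≫ _) h').symm
    refine Eq.trans ?_ ((congrArg (fun x => (F.mapComp f g).hom ≫ x)
      ((α.app_comp (F.map f) (F.map g)).trans (Category.id_comp _))))
    refine (congrArg (fun x => α.app (F.map (f ≫ g)) ≫ x) (Functor.map_comp _ _ _)).trans ?_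
    refine (Category.assoc _ _ _).symm.trans (Eq.trans ?_ (Category.assoc _ _ _))
    exact congrArg (· ≫ _) (α.naturality (F.mapComp f g).hom).symm

end Lifting

section Inverse

variable {B : Type u₁} [Bicategory.{w₁, v₁} B] {C : Type u₂} [Bicategory.{w₁, v₂} C]

theorem homCast_map_bijective {a a' b b' : C} (ha : a = a') (hb : b = b') (f g : a' ⟶ b') :
    Function.Bijective fun η : f ⟶ g => (homCast ha hb).map η := by
  subst ha; subst hb; exact Function.bijective_id

theorem exists_homCast_obj {a a' b b' : C} (ha : a = a') (hb : b = b') (h : a' ⟶ b') :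
    ∃ f : a ⟶ b, ∀ h' : a' ⟶ b', Nonempty (f ≅ (homCast ha hb).obj h') → Nonempty (h' ≅ h) := by
  subst ha; subst hb
  exact ⟨h, fun h' ⟨e⟩ => ⟨e.symm⟩⟩

theorem bijective_of_conj {D : Type*} [Category* D] {X Y X' Y' : D} (x : X ⟶ X') (y : Y ⟶ Y')
    (hx : IsIso x) (hy : IsIso y) (φ : (X ⟶ Y) → (X' ⟶ Y')) (h : ∀ η, η ≫ y = x ≫ φ η) :
    Function.Bijective φ := by
  constructor
  · intro η θ e
    rw [← cancel_mono y, h, h, e]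
  · intro θ
    refine ⟨x ≫ θ ≫ inv y, ?_⟩
    rw [← cancel_epi x, ← h]
    simp

/-- A section of a local equivalence is a local equivalence. -/
theorem IsLocalEquivalence.of_section {F : B ⥤ᵖ C} (hF : IsLocalEquivalence F) (G : C ⥤ᵖ B)
    (α : Icon (Pseudofunctor.id C) (G.comp F)) (hα : α.Invertible) : IsLocalEquivalence G where
  obj_bijective := by
    have h : F.obj ∘ G.obj = id := funext fun c => (α.obj_eq c).symm
    exact (Function.Bijective.of_comp_iff' hF.obj_bijective G.obj).1
      (h ▸ Function.bijective_id)
  map₂_bijective {a b} f g := by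
    -- Two out of three: up to transport, the composite with `F` is conjugation by the invertible
    -- `α`, hence bijective.
    refine (Function.Bijective.of_comp_iff' (hF.map₂_bijective (G.map f) (G.map g)) _).1 ?_
    refine (Function.Bijective.of_comp_iff'
      (homCast_map_bijective (α.obj_eq a) (α.obj_eq b) _ _) _).1 ?_
    exact bijective_of_conj (α.app f) (α.app g) (hα f) (hα g) _ α.naturality
  exists_iso {a b} h := by
    obtain ⟨f, hf⟩ := exists_homCast_obj (α.obj_eq a) (α.obj_eq b) (F.map h)
    obtain ⟨e⟩ := hf _ ⟨@asIso _ _ _ _ (α.app f) (hα f)⟩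
    obtain ⟨e', -⟩ := hF.exists_map₂Iso e
    exact ⟨f, ⟨e'⟩⟩

theorem IsLocalEquivalence.comp {D : Type u₃} [Bicategory.{w₂, v₃} D] {F : B ⥤ᵖ C} {G : C ⥤ᵖ D}
    (hF : IsLocalEquivalence F) (hG : IsLocalEquivalence G) : IsLocalEquivalence (F.comp G) where
  obj_bijective := hG.obj_bijective.comp hF.obj_bijective
  map₂_bijective f g := (hG.map₂_bijective (F.map f) (F.map g)).comp (hF.map₂_bijective f g)
  exists_iso h := by
    obtain ⟨f, ⟨e⟩⟩ := hG.exists_iso h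
    obtain ⟨f', ⟨e'⟩⟩ := hF.exists_iso f
    exact ⟨f', ⟨G.map₂Iso e' ≪≫ e⟩⟩

/-- A local equivalence has a section. -/
theorem IsLocalEquivalence.exists_section {F : B ⥤ᵖ C} (hF : IsLocalEquivalence F) :
    ∃ (G : C ⥤ᵖ B) (α : Icon (Pseudofunctor.id C) (G.comp F)),
      IsLocalEquivalence G ∧ α.Invertible := by
  obtain ⟨G, α, -, hα⟩ := hF.exists_lift (Pseudofunctor.id C)
    (Function.surjInv hF.obj_bijective.2)
    (fun c => (Function.surjInv_eq hF.obj_bijective.2 c).symm)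
  exact ⟨G, α, hF.of_section G α hα, hα⟩

/-- A section provides one of the two invertible 2-morphisms. Evaluated on the image of `F`, it
relates `F` to its composite with the round trip on `B`, and reflecting along `F` gives the other.
-/
theorem IsLocalEquivalence.stronglyEquivalent {F : B ⥤ᵖ C} (hF : IsLocalEquivalence F) :
    StronglyEquivalent B C := by
  obtain ⟨G, α, -, hα⟩ := hF.exists_section
  obtain ⟨β, hβ⟩ := hF.exists_icon (Pseudofunctor.id B) (F.comp G) (Icon.unitComp F G α)
    fun _ _ f => hα (F.map f)
  exact ⟨F, G, β, α.symm hα, hβ, α.symm_invertible hα⟩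

end Inverse

/-! ### Values of 2-functors between objects named in advance. -/

section Arrows

variable {J : Type u₁} [Preorder J] {C : Type u₂} [Bicategory.{w₂, v₂} C]
  (γ : StrictlyUnitaryPseudofunctor (LocallyDiscrete J) C)
  {i j k l : J} (h : i ≤ j) (h' : j ≤ k) (h'' : k ≤ l) {a b c d : C}

/-- The value of a 2-functor on an inequality as a 1-morphism between given objects. -/
def arrow (ha : a = γ.obj ⟨i⟩) (hb : b = γ.obj ⟨j⟩) : a ⟶ b :=
  (homCast ha hb).obj (γ.map (seg h))

theorem arrow_refl (ha ha' : a = γ.obj ⟨i⟩) : arrow γ (le_refl i) ha ha' = 𝟙 a := by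
  subst ha; exact γ.map_id ⟨i⟩

/-- The decomposition of the value of a 2-functor on an inequality. -/
def arrowComp (ha : a = γ.obj ⟨i⟩) (hb : b = γ.obj ⟨j⟩) (hc : c = γ.obj ⟨k⟩) :
    arrow γ (h.trans h') ha hc ≅ arrow γ h ha hb ≫ arrow γ h' hb hc :=
  (homCast ha hc).mapIso (γ.mapComp (seg h) (seg h')) ≪≫
    eqToIso (homCast_comp ha hb hc (γ.map (seg h)) (γ.map (seg h'))).symm

variable (ha : a = γ.obj ⟨i⟩) (hb : b = γ.obj ⟨j⟩) (hc : c = γ.obj ⟨k⟩) (hd : d = γ.obj ⟨l⟩)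

theorem arrowComp_rfl : arrowComp γ h h' rfl rfl rfl = γ.mapComp (seg h) (seg h') := by
  apply Iso.ext
  exact Category.comp_id _

theorem arrowComp_assoc :
    (arrowComp γ (h.trans h') h'' ha hc hd).hom ≫
      (arrowComp γ h h' ha hb hc).hom ▷ arrow γ h'' hc hd ≫ (α_ _ _ _).hom =
    (arrowComp γ h (h'.trans h'') ha hb hd).hom ≫
      arrow γ h ha hb ◁ (arrowComp γ h' h'' hb hc hd).hom := by
  subst ha; subst hb; subst hc; subst hd
  simp only [arrowComp_rfl]
  exact (PreorderData.ofPseudofunctor γ).assoc h h' h''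

theorem arrowComp_refl_left (ha' : a = γ.obj ⟨i⟩) :
    (arrowComp γ (le_refl i) h ha ha' hb).hom ≫ eqToHom (arrow_refl γ ha ha') ▷ arrow γ h ha' hb ≫
      (λ_ _).hom = 𝟙 _ := by
  subst ha; subst hb
  simp only [arrowComp_rfl]
  exact (PreorderData.ofPseudofunctor γ).refl_comp h

theorem arrowComp_refl_right (hb' : b = γ.obj ⟨j⟩) :
    (arrowComp γ h (le_refl j) ha hb hb').hom ≫ arrow γ h ha hb ◁ eqToHom (arrow_refl γ hb hb') ≫
      (ρ_ _).hom = 𝟙 _ := by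
  subst ha; subst hb
  simp only [arrowComp_rfl]
  exact (PreorderData.ofPseudofunctor γ).comp_refl h

end Arrows

/-! ### The action of morphisms of the simplicial replacement on arrows. -/

namespace SimplicialReplacement

variable {C : Type u₂} [Bicategory.{w₂, v₂} C] {X Y Z : SimplicialReplacement C} {a b c : C}

theorem obj_eq_of_hom (φ : X ⟶ Y) {i : Fin (X.base.len + 1)} {i' : Fin (Y.base.len + 1)}
    (hi : φ.base.toOrderHom i = i') : X.fiber.obj ⟨i⟩ = Y.fiber.obj ⟨i'⟩ := by
  subst hi; exact Icon.obj_eq φ.fiber ⟨i⟩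

/-- The component of a morphism of the simplicial replacement at an inequality. -/
def arrowMap (φ : X ⟶ Y) {i j : Fin (X.base.len + 1)} {i' j' : Fin (Y.base.len + 1)} {h : i ≤ j}
    {h' : i' ≤ j'} (hi : φ.base.toOrderHom i = i') (hj : φ.base.toOrderHom j = j')
    {ha : a = X.fiber.obj ⟨i⟩} {hb : b = X.fiber.obj ⟨j⟩} {ha' : a = Y.fiber.obj ⟨i'⟩}
    {hb' : b = Y.fiber.obj ⟨j'⟩} : arrow X.fiber h ha hb ⟶ arrow Y.fiber h' ha' hb' :=
  (homCast ha hb).map (Icon.app φ.fiber (seg h)) ≫ eqToHom (by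
    subst hi; subst hj; subst ha; subst hb; rfl)

section

variable {i j k : Fin (X.base.len + 1)} {i' j' k' : Fin (Y.base.len + 1)}
  {i'' j'' : Fin (Z.base.len + 1)} {h : i ≤ j} {h' : i' ≤ j'} {h'' : i'' ≤ j''}

theorem arrowMap_id {ha : a = X.fiber.obj ⟨i⟩} {hb : b = X.fiber.obj ⟨j⟩} :
    arrowMap (𝟙 X) rfl rfl = 𝟙 (arrow X.fiber h ha hb) := by
  subst ha; subst hb; exact Category.comp_id _

theorem arrowMap_congr {φ φ' : X ⟶ Y} (e : φ = φ') (hi : φ.base.toOrderHom i = i')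
    (hj : φ.base.toOrderHom j = j')
    {ha : a = X.fiber.obj ⟨i⟩} {hb : b = X.fiber.obj ⟨j⟩} {ha' : a = Y.fiber.obj ⟨i'⟩}
    {hb' : b = Y.fiber.obj ⟨j'⟩} :
    (arrowMap φ hi hj : arrow X.fiber h ha hb ⟶ arrow Y.fiber h' ha' hb') =
      arrowMap φ' (by rw [← e, hi]) (by rw [← e, hj]) := by
  subst e; rfl

theorem arrowMap_comp (φ : X ⟶ Y) (ψ : Y ⟶ Z) (hi : φ.base.toOrderHom i = i')
    (hj : φ.base.toOrderHom j = j') (hi' : ψ.base.toOrderHom i' = i'')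
    (hj' : ψ.base.toOrderHom j' = j'')
    {ha : a = X.fiber.obj ⟨i⟩} {hb : b = X.fiber.obj ⟨j⟩} {ha' : a = Y.fiber.obj ⟨i'⟩}
    {hb' : b = Y.fiber.obj ⟨j'⟩} {ha'' : a = Z.fiber.obj ⟨i''⟩} {hb'' : b = Z.fiber.obj ⟨j''⟩} :
    (arrowMap φ hi hj : arrow X.fiber h ha hb ⟶ arrow Y.fiber h' ha' hb') ≫
      (arrowMap ψ hi' hj' : arrow Y.fiber h' ha' hb' ⟶ arrow Z.fiber h'' ha'' hb'') =
    arrowMap (φ ≫ ψ) (hi' ▸ congrArg ψ.base.toOrderHom hi)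
      (hj' ▸ congrArg ψ.base.toOrderHom hj) := by
  subst hi; subst hj; subst hi'; subst hj'; subst ha; subst hb
  refine (congrArg (· ≫ _) (Category.comp_id _)).trans ?_
  exact (Category.comp_id _).symm

/-- Pure bookkeeping, stated for free variables so that the equality `e` can be substituted; with
the concrete transports this would be impossible. -/
theorem comp_of_comp_eqToHom {f f' : a ⟶ b} {g g' : b ⟶ c} {k k' l : a ⟶ c} (x : k ⟶ k')
    (m : k' ⟶ l) (e : l = f' ≫ g') (n : k ⟶ f ≫ g) (y : f ⟶ f') (z : g ⟶ g')
    (H : x ≫ m = n ≫ y ▷ g ≫ f' ◁ z ≫ eqToHom e.symm) :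
    (x ≫ 𝟙 _) ≫ m ≫ eqToHom e = (n ≫ 𝟙 _) ≫ (y ≫ 𝟙 _) ▷ g ≫ f' ◁ (z ≫ 𝟙 _) := by
  subst e; simpa using H

theorem refl_of_comp_eqToHom {D : Type*} [Category* D] {x y z w o : D} (f : x ⟶ y) (e : y = z)
    (e₁ : x = o) (e₂ : y = w) (e₃ : o = w) (e₄ : z = o)
    (H : f ≫ eqToHom e₂ = eqToHom e₁ ≫ eqToHom e₃) : (f ≫ eqToHom e) ≫ eqToHom e₄ = eqToHom e₁ := by
  subst e₃; subst e₂; subst e₁; simpa using H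

theorem arrowMap_arrowComp (φ : X ⟶ Y) (hi : φ.base.toOrderHom i = i')
    (hj : φ.base.toOrderHom j = j') (hk : φ.base.toOrderHom k = k') (g : j ≤ k) (g' : j' ≤ k')
    {ha : a = X.fiber.obj ⟨i⟩} {hb : b = X.fiber.obj ⟨j⟩} {hc : c = X.fiber.obj ⟨k⟩}
    {ha' : a = Y.fiber.obj ⟨i'⟩} {hb' : b = Y.fiber.obj ⟨j'⟩} {hc' : c = Y.fiber.obj ⟨k'⟩} :
    (arrowMap φ hi hk : arrow X.fiber (h.trans g) ha hc ⟶ arrow Y.fiber (h'.trans g') ha' hc') ≫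
      (arrowComp Y.fiber h' g' ha' hb' hc').hom =
    (arrowComp X.fiber h g ha hb hc).hom ≫ arrowMap φ hi hj ▷ arrow X.fiber g hb hc ≫
      arrow Y.fiber h' ha' hb' ◁ arrowMap φ hj hk := by
  subst hi; subst hj; subst hk; subst ha; subst hb; subst hc
  exact comp_of_comp_eqToHom _ _
    (homCast_comp ha' hb' hc' (Y.fiber.map (seg h')) (Y.fiber.map (seg g'))).symm _ _ _
    (Icon.app_comp φ.fiber (seg h) (seg g))

theorem arrowMap_refl (φ : X ⟶ Y) (hi : φ.base.toOrderHom i = i') (hj : φ.base.toOrderHom i = i')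
    {ha hb : a = X.fiber.obj ⟨i⟩} {ha' hb' : a = Y.fiber.obj ⟨i'⟩} :
    arrowMap φ hi hj ≫ eqToHom (arrow_refl Y.fiber ha' hb') = eqToHom (arrow_refl X.fiber ha hb) := by
  subst hi; subst ha
  have e := congrArg (homCast ha' ha').obj
    (Y.fiber.map_id ⟨φ.base.toOrderHom i⟩)
  refine refl_of_comp_eqToHom (Icon.app φ.fiber (seg (le_refl i))) _ (X.fiber.map_id ⟨i⟩) e
    (homCast_id ha') _ ?_
  have h := Icon.app_id φ.fiber ⟨i⟩
  rw [X.fiber.mapId_eq_eqToIso] at h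
  refine Eq.trans ?_ h
  refine congrArg (_ ≫ ·) ?_
  refine (homCast_map_eqToHom ha' ha' (Y.fiber.map_id ⟨φ.base.toOrderHom i⟩)).symm.trans ?_
  exact congrArg (fun e => (homCast ha' ha').map (Iso.hom e)) (Y.fiber.mapId_eq_eqToIso _).symm

theorem isIso_arrowMap (φ : X ⟶ Y) (hφ : Icon.Invertible φ.fiber) (hi : φ.base.toOrderHom i = i')
    (hj : φ.base.toOrderHom j = j') {ha : a = X.fiber.obj ⟨i⟩} {hb : b = X.fiber.obj ⟨j⟩}
    {ha' : a = Y.fiber.obj ⟨i'⟩} {hb' : b = Y.fiber.obj ⟨j'⟩} :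
    IsIso (arrowMap φ hi hj : arrow X.fiber h ha hb ⟶ arrow Y.fiber h' ha' hb') := by
  have := hφ (seg h)
  exact inferInstanceAs (IsIso ((homCast ha hb).map (Icon.app φ.fiber (seg h)) ≫ eqToHom _))

end

end SimplicialReplacement

/-! ### The 2-functor from the rectification induced by a comparison. -/

open Framed in
/-- A functor from framed objects to a simplicial replacement that lies over `Δ` and sends
cartesian morphisms to cartesian morphisms. -/
structure Comparison {E : Type u₁} [Category.{v₁} E] (p : E ⥤ SimplexCategory) (C : Type u₂)
    [Bicategory.{w₂, v₂} C] where
  functor : Framed p ⥤ SimplicialReplacement C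
  len_eq (X : Framed p) : X.len + 1 = (functor.obj X).base.len + 1
  base_eq {X Y : Framed p} (f : X ⟶ Y) (i : Fin (X.len + 1)) :
    (functor.map f).base.toOrderHom (Fin.cast (len_eq X) i) = Fin.cast (len_eq Y) (base f i)
  invertible {X Y : Framed p} {f : X ⟶ Y} (hf : Cart f) : Icon.Invertible (functor.map f).fiber

namespace Comparison

open Framed Rect

variable {E : Type u₁} [Category.{v₁} E] {p : E ⥤ SimplexCategory}
  {C : Type u₂} [Bicategory.{w₂, v₂} C] (T : Comparison p C)

section

variable {X Y Z W : Rect p} {A B D : Framed p}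

/-- The value on objects. -/
noncomputable def obj (X : Rect p) : C :=
  (T.functor.obj (point p X.pt)).fiber.obj ⟨Fin.cast (T.len_eq _) 0⟩

/-- 2-morphisms fix objects, so the embedding of a vertex turns the value at a point into an equal
value at that vertex of any simplex. -/
theorem obj_eq (A : Framed p) (i : Fin (A.len + 1)) (hX : A.vtx i = X.pt) :
    T.obj X = (T.functor.obj A).fiber.obj ⟨Fin.cast (T.len_eq A) i⟩ :=
  SimplicialReplacement.obj_eq_of_hom (T.functor.map (vertex A i hX))
    ((T.base_eq _ 0).trans (congrArg (Fin.cast (T.len_eq A)) (base_vertex A i hX 0)))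

/-- The value on an edge of a framed object. -/
noncomputable def arr (A : Framed p) {i j : Fin (A.len + 1)} (h : i ≤ j) (hX : A.vtx i = X.pt)
    (hY : A.vtx j = Y.pt) : T.obj X ⟶ T.obj Y :=
  arrow (T.functor.obj A).fiber (i := Fin.cast (T.len_eq A) i) (j := Fin.cast (T.len_eq A) j) h
    (T.obj_eq A i hX) (T.obj_eq A j hY)

variable {i j k l : Fin (A.len + 1)} (h : i ≤ j) (h' : j ≤ k) (h'' : k ≤ l)
  (hX : A.vtx i = X.pt) (hY : A.vtx j = Y.pt) (hZ : A.vtx k = Z.pt) (hW : A.vtx l = W.pt)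

theorem arr_refl : T.arr A (le_refl i) hX hX = 𝟙 (T.obj X) := arrow_refl _ _ _

/-- The decomposition of the value on an edge. -/
noncomputable def arrComp :
    T.arr A (h.trans h') hX hZ ≅ T.arr A h hX hY ≫ T.arr A h' hY hZ := arrowComp _ _ _ _ _ _

theorem arrComp_assoc :
    (T.arrComp (h.trans h') h'' hX hZ hW).hom ≫
      (T.arrComp h h' hX hY hZ).hom ▷ T.arr A h'' hZ hW ≫ (α_ _ _ _).hom =
    (T.arrComp h (h'.trans h'') hX hY hW).hom ≫
      T.arr A h hX hY ◁ (T.arrComp h' h'' hY hZ hW).hom := arrowComp_assoc _ _ _ _ _ _ _ _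

theorem arrComp_refl_left :
    (T.arrComp (le_refl i) h hX hX hY).hom ≫ eqToHom (T.arr_refl hX) ▷ T.arr A h hX hY ≫
      (λ_ _).hom = 𝟙 _ := arrowComp_refl_left _ _ _ _ _

theorem arrComp_refl_right :
    (T.arrComp h (le_refl j) hX hY hY).hom ≫ T.arr A h hX hY ◁ eqToHom (T.arr_refl hY) ≫
      (ρ_ _).hom = 𝟙 _ := arrowComp_refl_right _ _ _ _ _

end

section

variable {X Y Z W : Rect p} {A B D : Framed p}
  {i j k : Fin (A.len + 1)} {i' j' k' : Fin (B.len + 1)} {i'' j'' : Fin (D.len + 1)}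
  {h : i ≤ j} {h' : i' ≤ j'} {h'' : i'' ≤ j''}
  {hX : A.vtx i = X.pt} {hY : A.vtx j = Y.pt} {hZ : A.vtx k = Z.pt}
  {hX' : B.vtx i' = X.pt} {hY' : B.vtx j' = Y.pt} {hZ' : B.vtx k' = Z.pt}
  {hX'' : D.vtx i'' = X.pt} {hY'' : D.vtx j'' = Y.pt}

theorem cast_base (f : A ⟶ B) (hi : base f i = i') :
    (T.functor.map f).base.toOrderHom (Fin.cast (T.len_eq A) i) = Fin.cast (T.len_eq B) i' :=
  (T.base_eq f i).trans (congrArg (Fin.cast (T.len_eq B)) hi)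

/-- The action of a morphism of framed objects on edges. -/
noncomputable def arrMap (f : A ⟶ B) (hi : base f i = i') (hj : base f j = j') :
    T.arr A h hX hY ⟶ T.arr B h' hX' hY' :=
  SimplicialReplacement.arrowMap (T.functor.map f) (T.cast_base f hi) (T.cast_base f hj)

theorem arrMap_congr {f f' : A ⟶ B} (e : f = f') (hi : base f i = i') (hj : base f j = j') :
    (T.arrMap f hi hj : T.arr A h hX hY ⟶ T.arr B h' hX' hY') =
      T.arrMap f' (by rw [← e, hi]) (by rw [← e, hj]) := by
  subst e; rfl

theorem arrMap_id : (T.arrMap (𝟙 A) rfl rfl : T.arr A h hX hY ⟶ T.arr A h hX hY) = 𝟙 _ :=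
  (SimplicialReplacement.arrowMap_congr (T.functor.map_id A) _ _).trans
    SimplicialReplacement.arrowMap_id

theorem arrMap_comp (f : A ⟶ B) (g : B ⟶ D) (hi : base f i = i') (hj : base f j = j')
    (hi' : base g i' = i'') (hj' : base g j' = j'') :
    (T.arrMap f hi hj : T.arr A h hX hY ⟶ T.arr B h' hX' hY') ≫
      (T.arrMap g hi' hj' : _ ⟶ T.arr D h'' hX'' hY'') =
    T.arrMap (f ≫ g) ((congrArg (base g) hi).trans hi') ((congrArg (base g) hj).trans hj') :=
  (SimplicialReplacement.arrowMap_comp _ _ _ _ _ _).trans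
    (SimplicialReplacement.arrowMap_congr (T.functor.map_comp f g).symm _ _)

theorem arrMap_arrComp (f : A ⟶ B) (hi : base f i = i') (hj : base f j = j')
    (hk : base f k = k') (g : j ≤ k) (g' : j' ≤ k') :
    (T.arrMap f hi hk : T.arr A (h.trans g) hX hZ ⟶ T.arr B (h'.trans g') hX' hZ') ≫
      (T.arrComp h' g' hX' hY' hZ').hom =
    (T.arrComp h g hX hY hZ).hom ≫ T.arrMap f hi hj ▷ T.arr A g hY hZ ≫
      T.arr B h' hX' hY' ◁ T.arrMap f hj hk :=
  SimplicialReplacement.arrowMap_arrowComp _ _ _ _ _ _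

theorem arrMap_refl (f : A ⟶ B) (hi hi' : base f i = i') :
    T.arrMap f hi hi' ≫ eqToHom (T.arr_refl hX') = eqToHom (T.arr_refl hX) :=
  SimplicialReplacement.arrowMap_refl _ _ _

theorem isIso_arrMap {f : A ⟶ B} (hf : Cart f) (hi : base f i = i') (hj : base f j = j') :
    IsIso (T.arrMap f hi hj : T.arr A h hX hY ⟶ T.arr B h' hX' hY') :=
  SimplicialReplacement.isIso_arrowMap _ (T.invertible hf) _ _

end

variable [hp : p.IsFibered] [hs : IsSegal p] [hd : IsDiscrete (p.Fiber ⦋0⦌)]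

section

variable {X Y Z W : Rect p} {P Q : X ⟶ Y} {A : Framed p}
  {i j k : Fin (A.len + 1)} {h : i ≤ j} {hX : A.vtx i = X.pt} {hY : A.vtx j = Y.pt}

/-- The value on 1-morphisms. -/
noncomputable def map (P : X ⟶ Y) : T.obj X ⟶ T.obj Y :=
  T.arr (comps P) (Fin.zero_le (Fin.last _)) (Chain.comps_vtx_zero P) (Chain.comps_vtx_last P)

/-- The comparison of the value on a 1-morphism and the value on an edge represented by it. -/
noncomputable def toArr (κ : comps P ⟶ A) (hi : src κ = i) (hj : tgt κ = j) :
    T.map P ⟶ T.arr A h hX hY := T.arrMap κ hi hj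

theorem toArr_congr {κ κ' : comps P ⟶ A} (e : κ = κ') (hi : src κ = i) (hj : tgt κ = j) :
    (T.toArr κ hi hj : T.map P ⟶ T.arr A h hX hY) =
      T.toArr κ' (by rw [← e, hi]) (by rw [← e, hj]) := T.arrMap_congr e _ _

theorem isIso_toArr {κ : comps P ⟶ A} (hκ : Cart κ) (hi : src κ = i) (hj : tgt κ = j) :
    IsIso (T.toArr κ hi hj : T.map P ⟶ T.arr A h hX hY) := T.isIso_arrMap hκ _ _

/-- The value on 2-morphisms. -/
noncomputable def map₂ (η : P ⟶ Q) : T.map P ⟶ T.map Q :=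
  T.arrMap (mor η) (Chain.base_mor_zero (P := P) (Q := Q) η)
    (Chain.base_mor_last (P := P) (Q := Q) η)

theorem map₂_toArr (η : P ⟶ Q) (κ : comps Q ⟶ A) (hi : src κ = i) (hj : tgt κ = j) :
    T.map₂ η ≫ (T.toArr κ hi hj : T.map Q ⟶ T.arr A h hX hY) =
      T.toArr (mor η ≫ κ) ((src_mor_comp η κ).trans hi) ((tgt_mor_comp η κ).trans hj) :=
  T.arrMap_comp _ _ _ _ _ _

theorem toArr_arrMap {B : Framed p} {i' j' : Fin (B.len + 1)} {h' : i' ≤ j'}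
    {hX' : B.vtx i' = X.pt} {hY' : B.vtx j' = Y.pt} (κ : comps P ⟶ A) (f : A ⟶ B)
    (hi : src κ = i) (hj : tgt κ = j) (hi' : base f i = i') (hj' : base f j = j') :
    (T.toArr κ hi hj : T.map P ⟶ T.arr A h hX hY) ≫
      (T.arrMap f hi' hj' : _ ⟶ T.arr B h' hX' hY') =
    T.toArr (κ ≫ f) ((congrArg (base f) hi).trans hi') ((congrArg (base f) hj).trans hj') :=
  T.arrMap_comp _ _ _ _ _ _

theorem map₂_id (P : X ⟶ Y) : T.map₂ (𝟙 P) = 𝟙 (T.map P) := T.arrMap_id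

theorem map₂_comp {R : X ⟶ Y} (η : P ⟶ Q) (θ : Q ⟶ R) :
    T.map₂ (η ≫ θ) = T.map₂ η ≫ T.map₂ θ := (T.arrMap_comp _ _ _ _ _ _).symm

end

theorem exists_triangle {X Y Z : Rect p} (P : X ⟶ Y) (Q : Y ⟶ Z) :
    ∃ (A : Framed p) (α : comps P ⟶ A) (β : comps Q ⟶ A) (_ : tgt α = src β), Cart α ∧ Cart β ∧
      ∀ (B : Framed p) (α' : comps P ⟶ B) (β' : comps Q ⟶ B), tgt α' = src β' →
        ∃ d : A ⟶ B, α ≫ d = α' ∧ β ≫ d = β' :=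
  have g := Chain.isGluing_triangle P Q
  ⟨Chain.triangle P Q, Chain.fstEdge P Q, Chain.sndEdge P Q, g.base_right_zero, g.cart_left,
    g.cart_right, fun _ α' β' h => g.exists_desc α' β' h⟩

theorem cancel_whiskers {a b c : C} {f f' f'' : a ⟶ b} {g g' g'' : b ⟶ c} {k k' : a ⟶ c}
    (x : k ⟶ k') (m : k' ⟶ f' ≫ g') (y : f ≅ f') (z : g ≅ g') (y' : f' ⟶ f'') (z' : g' ⟶ g'') :
    (x ≫ m ≫ y.inv ▷ g' ≫ f ◁ z.inv) ≫ (y.hom ≫ y') ▷ g ≫ f'' ◁ (z.hom ≫ z') =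
      x ≫ m ≫ y' ▷ g' ≫ f'' ◁ z' := by
  simp [whisker_exchange_assoc]

theorem leftUnitor_of_comp {a b : C} {u u' : a ⟶ a} {f g k : a ⟶ b} (m : k ⟶ u ≫ f) (x : u ⟶ u')
    (y : f ⟶ g) (e : u' ⟶ 𝟙 a) (j : k ⟶ g) (c : g ⟶ u' ≫ g)
    (H : m ≫ x ▷ f ≫ u' ◁ y = j ≫ c) (hc : c ≫ e ▷ g ≫ (λ_ g).hom = 𝟙 g) :
    j = (m ≫ (x ≫ e) ▷ f ≫ (λ_ f).hom) ≫ y := by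
  have h := congrArg (· ≫ e ▷ g ≫ (λ_ g).hom) H
  simp only [Category.assoc, hc, Category.comp_id] at h
  rw [← h]
  simp [whisker_exchange_assoc]

theorem rightUnitor_of_comp {a b : C} {u u' : b ⟶ b} {f g k : a ⟶ b} (m : k ⟶ f ≫ u) (x : u ⟶ u')
    (y : f ⟶ g) (e : u' ⟶ 𝟙 b) (j : k ⟶ g) (c : g ⟶ g ≫ u')
    (H : m ≫ y ▷ u ≫ g ◁ x = j ≫ c) (hc : c ≫ g ◁ e ≫ (ρ_ g).hom = 𝟙 g) :
    j = (m ≫ f ◁ (x ≫ e) ≫ (ρ_ f).hom) ≫ y := by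
  have h := congrArg (· ≫ g ◁ e ≫ (ρ_ g).hom) H
  simp only [Category.assoc, hc, Category.comp_id] at h
  rw [← h]
  simp [← whisker_exchange_assoc]

/-- The isomorphisms `x`, `y`, `z` move the claim to the primed objects, where it is the
associativity `h₅` of the decompositions in a single simplex. -/
theorem associator_of_comp {a b c d : C} {f f' : a ⟶ b} {g g' : b ⟶ c} {h h' : c ⟶ d}
    {fg fg' : a ⟶ c} {gh gh' : b ⟶ d} {k l k' : a ⟶ d} (x : f ⟶ f') (y : g ⟶ g') (z : h ⟶ h')
    (hx : IsIso x) (hy : IsIso y) (hz : IsIso z) (t : k ⟶ l)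
    {m₁ : fg ⟶ f ≫ g} {m₂ : gh ⟶ g ≫ h} {m₃ : k ⟶ fg ≫ h} {m₄ : l ⟶ f ≫ gh}
    {c₁ : fg' ⟶ f' ≫ g'} {c₂ : gh' ⟶ g' ≫ h'} {c₃ : k' ⟶ fg' ≫ h'} {c₄ : k' ⟶ f' ≫ gh'}
    {j₁ : fg ⟶ fg'} {j₂ : gh ⟶ gh'} {j₃ : k ⟶ k'} {j₄ : l ⟶ k'}
    (h₁ : m₁ ≫ x ▷ g ≫ f' ◁ y = j₁ ≫ c₁) (h₂ : m₂ ≫ y ▷ h ≫ g' ◁ z = j₂ ≫ c₂)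
    (h₃ : m₃ ≫ j₁ ▷ h ≫ fg' ◁ z = j₃ ≫ c₃) (h₄ : m₄ ≫ x ▷ gh ≫ f' ◁ j₂ = j₄ ≫ c₄)
    (h₅ : c₃ ≫ c₁ ▷ h' ≫ (α_ f' g' h').hom = c₄ ≫ f' ◁ c₂) (h₆ : t ≫ j₄ = j₃) :
    t ≫ m₄ ≫ f ◁ m₂ = m₃ ≫ m₁ ▷ h ≫ (α_ f g h).hom := by
  rw [← cancel_mono (x ▷ (g ≫ h) ≫ f' ◁ (y ▷ h ≫ g' ◁ z))]
  have e₁ : (t ≫ m₄ ≫ f ◁ m₂) ≫ x ▷ (g ≫ h) ≫ f' ◁ (y ▷ h ≫ g' ◁ z) =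
      t ≫ (m₄ ≫ x ▷ gh ≫ f' ◁ j₂) ≫ f' ◁ c₂ := by
    simp only [Category.assoc, whisker_exchange_assoc, ← whiskerLeft_comp, h₂]
  have e₂ : (m₃ ≫ m₁ ▷ h ≫ (α_ f g h).hom) ≫ x ▷ (g ≫ h) ≫ f' ◁ (y ▷ h ≫ g' ◁ z) =
      (m₃ ≫ j₁ ▷ h ≫ fg' ◁ z) ≫ c₁ ▷ h' ≫ (α_ f' g' h').hom := by
    have e₃ : (α_ f g h).hom ≫ x ▷ (g ≫ h) ≫ f' ◁ (y ▷ h ≫ g' ◁ z) =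
        (x ▷ g ≫ f' ◁ y) ▷ h ≫ (f' ≫ g') ◁ z ≫ (α_ f' g' h').hom := by
      simp
    simp only [Category.assoc]
    rw [e₃, ← comp_whiskerRight_assoc, h₁, comp_whiskerRight_assoc, whisker_exchange_assoc]
  rw [e₁, e₂, h₃, h₄]
  simp only [Category.assoc]
  rw [h₅, reassoc_of% h₆]

/-- The isomorphism is built in the universal triangle, where the comparisons with the edges are
invertible. Its property in any other simplex follows by naturality along the morphism from the
triangle. -/
theorem exists_mapComp {X Y Z : Rect p} (P : X ⟶ Y) (Q : Y ⟶ Z) :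
    ∃ μ : T.map (P ≫ Q) ≅ T.map P ≫ T.map Q, ∀ (A : Framed p) (α : comps P ⟶ A)
      (β : comps Q ⟶ A) (i j k : Fin (A.len + 1)) (hi : src α = i) (hj : tgt α = j)
      (hj' : src β = j) (hk : tgt β = k) (h : i ≤ j) (h' : j ≤ k) (hX : A.vtx i = X.pt)
      (hY : A.vtx j = Y.pt) (hZ : A.vtx k = Z.pt),
      μ.hom ≫ (T.toArr α hi hj : _ ⟶ T.arr A h hX hY) ▷ T.map Q ≫
        T.arr A h hX hY ◁ (T.toArr β hj' hk : _ ⟶ T.arr A h' hY hZ) =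
      T.toArr (jn α β (hj.trans hj'.symm)) ((src_jn _ _ _).trans hi) ((tgt_jn _ _ _).trans hk) ≫
        (T.arrComp h h' hX hY hZ).hom := by
  obtain ⟨A, α, β, e, hα, hβ, H⟩ := exists_triangle P Q
  have hY : A.vtx (tgt α) = Y.pt := vtx_tgt α
  have l₁ := src_le_tgt α
  have l₂ : tgt α ≤ tgt β := e ▸ src_le_tgt β
  let x : T.map (P ≫ Q) ⟶ T.arr A (l₁.trans l₂) (vtx_src α) (vtx_tgt β) :=
    T.toArr (jn α β e) (src_jn _ _ _) (tgt_jn _ _ _)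
  let y : T.map P ⟶ T.arr A l₁ (vtx_src α) hY := T.toArr α rfl rfl
  let z : T.map Q ⟶ T.arr A l₂ hY (vtx_tgt β) := T.toArr β e.symm rfl
  have hx : IsIso x := T.isIso_toArr (cart_jn e hα hβ) _ _
  have hy : IsIso y := T.isIso_toArr hα _ _
  have hz : IsIso z := T.isIso_toArr hβ _ _
  refine ⟨asIso x ≪≫ T.arrComp l₁ l₂ _ _ _ ≪≫ whiskerRightIso (asIso y).symm _ ≪≫
    whiskerLeftIso _ (asIso z).symm, ?_⟩
  intro B α' β' i j k hi hj hj' hk h h' hX hY' hZ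
  obtain ⟨d, rfl, rfl⟩ := H B α' β' (hj.trans hj'.symm)
  have ej : base d (src β) = j := hj'
  have ej' : base d (tgt α) = j := hj
  rw [← T.toArr_arrMap (h := l₁) (hX := vtx_src α) (hY := hY) α d rfl rfl hi hj,
    ← T.toArr_arrMap (h := l₂) (hX := hY) (hY := vtx_tgt β) β d e.symm rfl ej' hk]
  refine (cancel_whiskers x (T.arrComp l₁ l₂ _ _ _).hom (asIso y) (asIso z) _ _).trans ?_
  refine (congrArg (x ≫ ·) (T.arrMap_arrComp (h := l₁) (h' := h) (hX := vtx_src α) (hY := hY)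
    (hZ := vtx_tgt β) (hX' := hX) (hY' := hY') (hZ' := hZ) d hi ej' hk l₂ h').symm).trans ?_
  refine (Category.assoc _ _ _).symm.trans (congrArg (· ≫ _) ?_)
  exact (T.toArr_arrMap _ _ _ _ _ _).trans (T.toArr_congr (jn_comp α β e d) _ _)

/-- The universal simplex with a degenerate edge at `X` is the point; other degenerate edges come
from it by a vertex embedding. -/
theorem exists_mapId (X : Rect p) : ∃ ι : T.map (𝟙 X) ≅ 𝟙 (T.obj X),
    ∀ (A : Framed p) (i : Fin (A.len + 1)) (hX : A.vtx i = X.pt),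
      T.toArr (deg A i hX) (src_deg i hX) (tgt_deg i hX) ≫ eqToHom (T.arr_refl hX) = ι.hom := by
  let A := point p X.pt
  let x : T.map (𝟙 X) ⟶ T.arr A (le_refl 0) (X := X) (Y := X) rfl rfl :=
    T.toArr (deg A 0 rfl) (src_deg 0 rfl) (tgt_deg 0 rfl)
  have hx : IsIso x := T.isIso_toArr (cart_deg 0 rfl) _ _
  refine ⟨asIso x ≪≫ eqToIso (T.arr_refl rfl), fun B i hX => ?_⟩
  have hv : base (vertex B i hX) 0 = i := base_vertex B i hX 0
  have h₁ := T.toArr_arrMap (h := le_refl 0) (hX := rfl) (hY := rfl) (h' := le_refl i) (hX' := hX)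
    (hY' := hX) (deg A 0 rfl) (vertex B i hX) (src_deg 0 rfl) (tgt_deg 0 rfl) hv hv
  have h₂ := T.toArr_congr (h := le_refl i) (hX := hX) (hY := hX)
    (deg_comp (A := A) 0 rfl (vertex B i hX) i hv).symm (src_deg i hX) (tgt_deg i hX)
  refine (congrArg (· ≫ eqToHom _) (h₂.trans h₁.symm)).trans ?_
  refine (Category.assoc _ _ _).trans ?_
  exact congrArg (x ≫ ·) (T.arrMap_refl _ _ _)

/-- The compatibility with compositions. -/
noncomputable def mapComp {X Y Z : Rect p} (P : X ⟶ Y) (Q : Y ⟶ Z) :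
    T.map (P ≫ Q) ≅ T.map P ≫ T.map Q := (T.exists_mapComp P Q).choose

/-- The compatibility with identities. -/
noncomputable def mapId (X : Rect p) : T.map (𝟙 X) ≅ 𝟙 (T.obj X) := (T.exists_mapId X).choose

section

variable {X Y Z W : Rect p} {P P' : X ⟶ Y} {Q Q' : Y ⟶ Z} {R : Z ⟶ W}

theorem mapComp_toArr {A : Framed p} (α : comps P ⟶ A) (β : comps Q ⟶ A)
    {i j k : Fin (A.len + 1)} (hi : src α = i) (hj : tgt α = j)
    (hj' : src β = j) (hk : tgt β = k) (h : i ≤ j) (h' : j ≤ k) (hX : A.vtx i = X.pt)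
    (hY : A.vtx j = Y.pt) (hZ : A.vtx k = Z.pt) :
    (T.mapComp P Q).hom ≫ (T.toArr α hi hj : _ ⟶ T.arr A h hX hY) ▷ T.map Q ≫
        T.arr A h hX hY ◁ (T.toArr β hj' hk : _ ⟶ T.arr A h' hY hZ) =
      T.toArr (jn α β (hj.trans hj'.symm)) ((src_jn _ _ _).trans hi) ((tgt_jn _ _ _).trans hk) ≫
        (T.arrComp h h' hX hY hZ).hom :=
  (T.exists_mapComp P Q).choose_spec A α β i j k hi hj hj' hk h h' hX hY hZ

theorem toArr_deg {A : Framed p} (i : Fin (A.len + 1)) (hX : A.vtx i = X.pt) :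
    T.toArr (deg A i hX) (src_deg i hX) (tgt_deg i hX) ≫ eqToHom (T.arr_refl hX) =
      (T.mapId X).hom := (T.exists_mapId X).choose_spec A i hX

/-- Composing with the invertible comparisons `y`, `z` to a triangle turns both sides into the
comparison for a join, where `mor_whiskerRight_jn` applies. -/
theorem map₂_whiskerRight (η : P ⟶ P') (Q : Y ⟶ Z) :
    T.map₂ (η ▷ Q) ≫ (T.mapComp P' Q).hom = (T.mapComp P Q).hom ≫ T.map₂ η ▷ T.map Q := by
  obtain ⟨A, α, β, e, hα, hβ, -⟩ := exists_triangle P' Q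
  have hY : A.vtx (tgt α) = Y.pt := vtx_tgt α
  have l₁ := src_le_tgt α
  have l₂ : tgt α ≤ tgt β := e ▸ src_le_tgt β
  let y : T.map P' ⟶ T.arr A l₁ (vtx_src α) hY := T.toArr α rfl rfl
  let z : T.map Q ⟶ T.arr A l₂ hY (vtx_tgt β) := T.toArr β e.symm rfl
  have hy : IsIso y := T.isIso_toArr hα _ _
  have hz : IsIso z := T.isIso_toArr hβ _ _
  rw [← cancel_mono (y ▷ T.map Q ≫ T.arr A l₁ (vtx_src α) hY ◁ z), Category.assoc,
    T.mapComp_toArr α β rfl rfl e.symm rfl l₁ l₂, Category.assoc, ← comp_whiskerRight_assoc,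
    T.map₂_toArr, T.mapComp_toArr _ β _ _ e.symm rfl l₁ l₂, ← Category.assoc, T.map₂_toArr]
  exact congrArg (· ≫ _) (T.toArr_congr (mor_whiskerRight_jn η α β e) _ _)

theorem map₂_whiskerLeft (P : X ⟶ Y) (θ : Q ⟶ Q') :
    T.map₂ (P ◁ θ) ≫ (T.mapComp P Q').hom = (T.mapComp P Q).hom ≫ T.map P ◁ T.map₂ θ := by
  obtain ⟨A, α, β, e, hα, hβ, -⟩ := exists_triangle P Q'
  have hY : A.vtx (tgt α) = Y.pt := vtx_tgt α
  have l₁ := src_le_tgt α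
  have l₂ : tgt α ≤ tgt β := e ▸ src_le_tgt β
  let y : T.map P ⟶ T.arr A l₁ (vtx_src α) hY := T.toArr α rfl rfl
  let z : T.map Q' ⟶ T.arr A l₂ hY (vtx_tgt β) := T.toArr β e.symm rfl
  have hy : IsIso y := T.isIso_toArr hα _ _
  have hz : IsIso z := T.isIso_toArr hβ _ _
  rw [← cancel_mono (y ▷ T.map Q' ≫ T.arr A l₁ (vtx_src α) hY ◁ z), Category.assoc,
    T.mapComp_toArr α β rfl rfl e.symm rfl l₁ l₂, Category.assoc, whisker_exchange_assoc,
    ← whiskerLeft_comp, T.map₂_toArr, T.mapComp_toArr α _ rfl rfl _ _ l₁ l₂, ← Category.assoc,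
    T.map₂_toArr]
  exact congrArg (· ≫ _) (T.toArr_congr (mor_whiskerLeft_jn θ α β e) _ _)

theorem map₂_leftUnitor (P : X ⟶ Y) : T.map₂ (λ_ P).hom =
    (T.mapComp (𝟙 X) P).hom ≫ (T.mapId X).hom ▷ T.map P ≫ (λ_ (T.map P)).hom := by
  let A := comps P
  let α : comps P ⟶ A := 𝟙 _
  have l := src_le_tgt α
  let y : T.map P ⟶ T.arr A l (vtx_src α) (vtx_tgt α) := T.toArr α rfl rfl
  have hy : IsIso y := T.isIso_toArr (Cart.id _) _ _
  rw [← cancel_mono y, T.map₂_toArr, T.toArr_congr (mor_leftUnitor P α)]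
  have h₁ := T.mapComp_toArr (deg A (src α) (vtx_src α)) α (src_deg _ _) (tgt_deg _ _) rfl rfl
    le_rfl l (vtx_src α) (vtx_src α) (vtx_tgt α)
  rw [← T.toArr_deg (src α) (vtx_src α)]
  exact leftUnitor_of_comp _ _ y _ _ _ h₁ (T.arrComp_refl_left l (vtx_src α) (vtx_tgt α))

theorem map₂_rightUnitor (P : X ⟶ Y) : T.map₂ (ρ_ P).hom =
    (T.mapComp P (𝟙 Y)).hom ≫ T.map P ◁ (T.mapId Y).hom ≫ (ρ_ (T.map P)).hom := by
  let A := comps P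
  let α : comps P ⟶ A := 𝟙 _
  have l := src_le_tgt α
  let y : T.map P ⟶ T.arr A l (vtx_src α) (vtx_tgt α) := T.toArr α rfl rfl
  have hy : IsIso y := T.isIso_toArr (Cart.id _) _ _
  rw [← cancel_mono y, T.map₂_toArr, T.toArr_congr (mor_rightUnitor P α)]
  have h₁ := T.mapComp_toArr α (deg A (tgt α) (vtx_tgt α)) rfl rfl (src_deg _ _) (tgt_deg _ _)
    l le_rfl (vtx_src α) (vtx_tgt α) (vtx_tgt α)
  rw [← T.toArr_deg (tgt α) (vtx_tgt α)]
  exact rightUnitor_of_comp _ _ y _ _ _ h₁ (T.arrComp_refl_right l (vtx_src α) (vtx_tgt α))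

theorem map₂_associator (P : X ⟶ Y) (Q : Y ⟶ Z) (R : Z ⟶ W) :
    T.map₂ (α_ P Q R).hom ≫ (T.mapComp P (Q ≫ R)).hom ≫ T.map P ◁ (T.mapComp Q R).hom =
      (T.mapComp (P ≫ Q) R).hom ≫ (T.mapComp P Q).hom ▷ T.map R ≫ (α_ _ _ _).hom := by
  obtain ⟨A, α, β, γ, e, e', hα, hβ, hγ⟩ : ∃ (A : Framed p) (α : comps P ⟶ A) (β : comps Q ⟶ A)
      (γ : comps R ⟶ A) (_ : tgt α = src β) (_ : tgt β = src γ), Cart α ∧ Cart β ∧ Cart γ :=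
    Chain.exists_cart₃ P Q R
  have hX := vtx_src α
  have hY : A.vtx (tgt α) = Y.pt := vtx_tgt α
  have hZ : A.vtx (tgt β) = Z.pt := vtx_tgt β
  have hW := vtx_tgt γ
  have l₁ := src_le_tgt α
  have l₂ : tgt α ≤ tgt β := e ▸ src_le_tgt β
  have l₃ : tgt β ≤ tgt γ := e' ▸ src_le_tgt γ
  let x : T.map P ⟶ T.arr A l₁ hX hY := T.toArr α rfl rfl
  let y : T.map Q ⟶ T.arr A l₂ hY hZ := T.toArr β e.symm rfl
  let z : T.map R ⟶ T.arr A l₃ hZ hW := T.toArr γ e'.symm rfl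
  have hx : IsIso x := T.isIso_toArr hα _ _
  have hy : IsIso y := T.isIso_toArr hβ _ _
  have hz : IsIso z := T.isIso_toArr hγ _ _
  have h₁ := T.mapComp_toArr α β rfl rfl e.symm rfl l₁ l₂ hX hY hZ
  have h₂ := T.mapComp_toArr β γ e.symm rfl e'.symm rfl l₂ l₃ hY hZ hW
  have h₃ := T.mapComp_toArr (jn α β e) γ (src_jn _ _ _) (tgt_jn _ _ _) e'.symm rfl
    (l₁.trans l₂) l₃ hX hZ hW
  have h₄ := T.mapComp_toArr α (jn β γ e') rfl rfl ((src_jn _ _ _).trans e.symm) (tgt_jn _ _ _)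
    l₁ (l₂.trans l₃) hX hY hW
  have h₅ := T.arrComp_assoc l₁ l₂ l₃ hX hY hZ hW
  have h₆ := T.map₂_toArr (h := l₁.trans (l₂.trans l₃)) (hX := hX) (hY := hW) (α_ P Q R).hom
    (jn α (jn β γ e') (by simp [e])) (src_jn _ _ _) ((tgt_jn _ _ _).trans (tgt_jn _ _ _))
  rw [T.toArr_congr (mor_associator_jn α β γ e e')] at h₆
  exact associator_of_comp x y z hx hy hz _ h₁ h₂ h₃ h₄ h₅ h₆

end

/-- The 2-functor from the rectification. -/
noncomputable def pseudofunctor : Rect p ⥤ᵖ C where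
  obj := T.obj
  map := T.map
  map₂ := T.map₂
  map₂_id := T.map₂_id
  map₂_comp := T.map₂_comp
  mapId := T.mapId
  mapComp := T.mapComp
  map₂_whisker_left P _ _ θ := by
    rw [← reassoc_of% T.map₂_whiskerLeft P θ, Iso.hom_inv_id, Category.comp_id]
  map₂_whisker_right η Q := by
    rw [← reassoc_of% T.map₂_whiskerRight η Q, Iso.hom_inv_id, Category.comp_id]
  map₂_associator P Q R := by
    rw [← reassoc_of% T.map₂_associator P Q R, ← whiskerLeft_comp_assoc, Iso.hom_inv_id,
      whiskerLeft_id, Category.id_comp, Iso.hom_inv_id, Category.comp_id]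
  map₂_left_unitor := T.map₂_leftUnitor
  map₂_right_unitor := T.map₂_rightUnitor

end Comparison

/-! ### 2-functors on `[0]` and `[1]`: objects and 1-morphisms of the target. -/

section Ordinals

variable {C : Type u₂} [Bicategory.{w₂, v₂} C]

section IconsOfArrows

variable {J : Type u₁} [Preorder J] {γ γ' : StrictlyUnitaryPseudofunctor (LocallyDiscrete J) C}
  (e : ∀ k, γ.obj ⟨k⟩ = γ'.obj ⟨k⟩)
  (t : ∀ {k l : J} (h : k ≤ l), arrow γ h rfl rfl ⟶ arrow γ' h (e k) (e l))

theorem comp_eqToHom_of_eq {D : Type*} [Category* D] {x y z o : D} (f : x ⟶ y) (e₁ : x = o)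
    (e₂ : o = y) (e₃ : y = z) (e₄ : o = z) (h : f = eqToHom (e₁.trans e₂)) :
    f ≫ eqToHom e₃ = eqToHom e₁ ≫ eqToHom e₄ := by
  subst h; simp

theorem comp_eq_of_comp_eqToHom {D : Type*} [Category* D] {x y z o r s : D} (f : x ⟶ y) (m : y ⟶ z)
    (e₁ : z = s) (n : x ⟶ o) (g : o ⟶ r) {g' : r ⟶ s} (h : f ≫ m ≫ eqToHom e₁ = n ≫ g ≫ g') :
    f ≫ m = n ≫ g ≫ g' ≫ eqToHom e₁.symm := by
  subst e₁; simpa using h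

/-- The 2-morphism with the given components. -/
def iconOfArrows
    (hr : ∀ k, t (le_refl k) = eqToHom ((arrow_refl γ rfl rfl).trans (arrow_refl γ' _ _).symm))
    (hc : ∀ {i j k : J} (h : i ≤ j) (h' : j ≤ k),
      t (h.trans h') ≫ (arrowComp γ' h h' (e i) (e j) (e k)).hom =
        (arrowComp γ h h' rfl rfl rfl).hom ≫ t h ▷ arrow γ h' rfl rfl ≫
          arrow γ' h (e i) (e j) ◁ t h') : γ ⟶ γ' :=
  show Icon γ.toPseudofunctor γ'.toPseudofunctor from
  { obj_eq := fun a => e a.as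
    app := fun u => t (leOfHom u.as)
    naturality := fun {a b f g} η => by
      obtain rfl := LocallyDiscrete.eq_of_hom η
      have h₁ : γ.map₂ η = 𝟙 _ := (congrArg γ.map₂ (Subsingleton.elim η (𝟙 f))).trans (γ.map₂_id f)
      have h₂ : γ'.map₂ η = 𝟙 _ :=
        (congrArg γ'.map₂ (Subsingleton.elim η (𝟙 f))).trans (γ'.map₂_id f)
      refine (congrArg (· ≫ t (leOfHom f.as)) h₁).trans ((Category.id_comp _).trans ?_)
      refine Eq.trans ?_ (congrArg (fun x => t (leOfHom f.as) ≫ (homCast (e a.as) (e b.as)).map x)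
        h₂.symm)
      exact ((congrArg (t (leOfHom f.as) ≫ ·)
        (CategoryTheory.Functor.map_id (homCast (e a.as) (e b.as)) _)).trans (Category.comp_id _)).symm
    app_id := fun a => by
      have h₁ := congrArg Iso.hom (γ.mapId_eq_eqToIso a)
      have h₂ := (congrArg (fun x => (homCast (e a.as) (e a.as)).map (Iso.hom x))
        (γ'.mapId_eq_eqToIso a)).trans (homCast_map_eqToHom _ _ (γ'.map_id a))
      refine (congrArg (t (le_refl a.as) ≫ ·) h₂).trans ?_
      refine Eq.trans ?_ (congrArg (· ≫ eqToHom (homCast_id (e a.as))) h₁.symm)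
      exact comp_eqToHom_of_eq (t (le_refl a.as)) (arrow_refl γ rfl rfl)
        (arrow_refl γ' (e a.as) (e a.as)).symm _ _ (hr a.as)
    app_comp := fun {a b c} f g => by
      have h₁ := hc (leOfHom f.as) (leOfHom g.as)
      rw [arrowComp_rfl] at h₁
      exact comp_eq_of_comp_eqToHom (t (leOfHom (f ≫ g).as)) _
        (homCast_comp (e a.as) (e b.as) (e c.as) (γ'.map f) (γ'.map g)).symm _ _ h₁ }

theorem arrow_comp_of_refl_left {a b : C} {u u' : a ⟶ a} {f g : a ⟶ b} (hu : u = 𝟙 a)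
    (hu' : u' = 𝟙 a) (y : f ⟶ g) (c : f ⟶ u ≫ f) (c' : g ⟶ u' ≫ g)
    (hc : c ≫ eqToHom hu ▷ f ≫ (λ_ f).hom = 𝟙 f) (hc' : c' ≫ eqToHom hu' ▷ g ≫ (λ_ g).hom = 𝟙 g) :
    y ≫ c' = c ≫ eqToHom (hu.trans hu'.symm) ▷ f ≫ u' ◁ y := by
  subst hu; subst hu'
  rw [← cancel_mono (eqToHom rfl ▷ g ≫ (λ_ g).hom)]
  have h := congrArg (· ≫ y) hc
  simp only [eqToHom_refl, id_whiskerRight, Category.id_comp, Category.assoc] at hc' h ⊢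
  simp [hc', h]

theorem arrow_comp_of_refl_right {a b : C} {u u' : b ⟶ b} {f g : a ⟶ b} (hu : u = 𝟙 b)
    (hu' : u' = 𝟙 b) (y : f ⟶ g) (c : f ⟶ f ≫ u) (c' : g ⟶ g ≫ u')
    (hc : c ≫ f ◁ eqToHom hu ≫ (ρ_ f).hom = 𝟙 f) (hc' : c' ≫ g ◁ eqToHom hu' ≫ (ρ_ g).hom = 𝟙 g) :
    y ≫ c' = c ≫ y ▷ u ≫ g ◁ eqToHom (hu.trans hu'.symm) := by
  subst hu; subst hu'
  rw [← cancel_mono (g ◁ eqToHom rfl ≫ (ρ_ g).hom)]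
  have h := congrArg (· ≫ y) hc
  simp only [eqToHom_refl, whiskerLeft_id, Category.id_comp, Category.assoc] at hc' h ⊢
  simp [hc', h]

theorem comp_of_refl_left
    (hr : ∀ k, t (le_refl k) = eqToHom ((arrow_refl γ rfl rfl).trans (arrow_refl γ' _ _).symm))
    {i k : J} (h : i ≤ k) :
    t h ≫ (arrowComp γ' (le_refl i) h (e i) (e i) (e k)).hom =
      (arrowComp γ (le_refl i) h rfl rfl rfl).hom ≫ t (le_refl i) ▷ arrow γ h rfl rfl ≫
        arrow γ' (le_refl i) (e i) (e i) ◁ t h := by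
  rw [hr]
  exact arrow_comp_of_refl_left _ _ _ _ _ (arrowComp_refl_left γ h _ _ _)
    (arrowComp_refl_left γ' h _ _ _)

theorem comp_of_refl_right
    (hr : ∀ k, t (le_refl k) = eqToHom ((arrow_refl γ rfl rfl).trans (arrow_refl γ' _ _).symm))
    {i k : J} (h : i ≤ k) :
    t h ≫ (arrowComp γ' h (le_refl k) (e i) (e k) (e k)).hom =
      (arrowComp γ h (le_refl k) rfl rfl rfl).hom ≫ t h ▷ arrow γ (le_refl k) rfl rfl ≫
        arrow γ' h (e i) (e k) ◁ t (le_refl k) := by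
  rw [hr]
  exact arrow_comp_of_refl_right _ _ _ _ _ (arrowComp_refl_right γ h _ _ _)
    (arrowComp_refl_right γ' h _ _ _)

end IconsOfArrows

theorem exists_hom_of_obj_eq (γ γ' : StrictlyUnitaryPseudofunctor (LocallyDiscrete (Fin (0 + 1))) C)
    (e : γ.obj ⟨0⟩ = γ'.obj ⟨0⟩) : Nonempty (γ ⟶ γ') := by
  have e' : ∀ k : Fin 1, γ.obj ⟨k⟩ = γ'.obj ⟨k⟩ := fun k => match k with
    | 0 => e
  let t : ∀ {k l : Fin 1} (h : k ≤ l), arrow γ h rfl rfl ⟶ arrow γ' h (e' k) (e' l) :=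
    fun {k l} h => match k, l, h with
    | 0, 0, _ => eqToHom ((arrow_refl γ rfl rfl).trans (arrow_refl γ' _ _).symm)
  have hr : ∀ k, t (le_refl k) =
      eqToHom ((arrow_refl γ rfl rfl).trans (arrow_refl γ' _ _).symm) :=
    fun k => match k with
    | 0 => rfl
  refine ⟨iconOfArrows e' t hr ?_⟩
  intro i j k h h'
  obtain rfl : i = j := Subsingleton.elim (α := Fin 1) i j
  exact comp_of_refl_left e' t hr h'

/-- The components at identities are forced by normalization, and the one nontrivial component is
free, since no nondegenerate composition occurs in `[1]`. -/
theorem exists_hom_of_arrow (γ γ' : StrictlyUnitaryPseudofunctor (LocallyDiscrete (Fin (1 + 1))) C)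
    (e₀ : γ.obj ⟨0⟩ = γ'.obj ⟨0⟩) (e₁ : γ.obj ⟨1⟩ = γ'.obj ⟨1⟩)
    (θ : arrow γ (Fin.zero_le 1) rfl rfl ⟶ arrow γ' (Fin.zero_le 1) e₀ e₁) :
    ∃ α : γ ⟶ γ', Icon.app α (seg (Fin.zero_le 1)) = θ := by
  have e' : ∀ k : Fin 2, γ.obj ⟨k⟩ = γ'.obj ⟨k⟩ := fun k => match k with
    | 0 => e₀
    | 1 => e₁
  let t : ∀ {k l : Fin 2} (h : k ≤ l), arrow γ h rfl rfl ⟶ arrow γ' h (e' k) (e' l) :=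
    fun {k l} h => match k, l, h with
    | 0, 0, _ => eqToHom ((arrow_refl γ rfl rfl).trans (arrow_refl γ' _ _).symm)
    | 0, 1, _ => θ
    | 1, 1, _ => eqToHom ((arrow_refl γ rfl rfl).trans (arrow_refl γ' _ _).symm)
    | 1, 0, h => absurd h (by decide)
  have hr : ∀ k, t (le_refl k) =
      eqToHom ((arrow_refl γ rfl rfl).trans (arrow_refl γ' _ _).symm) :=
    fun k => match k with
    | 0 => rfl
    | 1 => rfl
  refine ⟨iconOfArrows e' t hr ?_, rfl⟩
  intro i j k h h'
  -- A chain of three elements in a two-element order has a repetition, so only the unit laws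
  -- remain.
  have : i = j ∨ j = k := by omega
  obtain rfl | rfl := this
  · exact comp_of_refl_left e' t hr h'
  · exact comp_of_refl_right e' t hr h

theorem hom_ext_of_app {γ γ' : StrictlyUnitaryPseudofunctor (LocallyDiscrete (Fin (1 + 1))) C}
    {α β : γ ⟶ γ'} (h : Icon.app α (seg (Fin.zero_le 1)) = Icon.app β (seg (Fin.zero_le 1))) :
    α = β := by
  have hid : ∀ a, Icon.app α (𝟙 a) = Icon.app β (𝟙 a) := by
    intro a
    rw [← cancel_mono ((homCast (Icon.obj_eq α a) (Icon.obj_eq α a)).map (γ'.mapId a).hom)]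
    exact (Icon.app_id α a).trans (Icon.app_id β a).symm
  apply Icon.ext_app
  rintro ⟨a⟩ ⟨b⟩ f
  have hab : a ≤ b := leOfHom f.as
  match a, b, hab with
  | 0, 0, _ => exact hid ⟨0⟩
  | 0, 1, _ => exact h
  | 1, 1, _ => exact hid ⟨1⟩

/-- The 2-functor from the one-element ordinal with the given value. -/
def PreorderData.point (c : C) : PreorderData (Fin (0 + 1)) C where
  obj _ := c
  hom _ := 𝟙 c
  hom_refl _ := rfl
  comp _ _ := (λ_ (𝟙 c)).symm
  assoc _ _ _ := by simp
  refl_comp _ := by simp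
  comp_refl _ := by simp

/-- The 2-functor from the two-element ordinal with the given value. -/
def PreorderData.edge {a b : C} (f : a ⟶ b) : PreorderData (Fin (1 + 1)) C where
  obj := vec₂ a b
  hom {i j} h := match i, j, h with
    | 0, 0, _ => 𝟙 a
    | 0, 1, _ => f
    | 1, 1, _ => 𝟙 b
    | 1, 0, h => absurd h (by decide)
  hom_refl i := match i with
    | 0 => rfl
    | 1 => rfl
  comp {i j k} h h' := match i, j, k, h, h' with
    | 0, 0, 0, _, _ => (λ_ (𝟙 a)).symm
    | 0, 0, 1, _, _ => (λ_ f).symm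
    | 0, 1, 1, _, _ => (ρ_ f).symm
    | 1, 1, 1, _, _ => (λ_ (𝟙 b)).symm
    | 1, 0, _, h, _ => absurd h (by decide)
    | 0, 1, 0, _, h => absurd h (by decide)
    | 1, 1, 0, _, h => absurd h (by decide)
  assoc {i j k l} h h' h'' := match i, j, k, l, h, h', h'' with
    | 0, 0, 0, 0, _, _, _ =>
      show (λ_ (𝟙 a)).inv ≫ (λ_ (𝟙 a)).inv ▷ 𝟙 a ≫ (α_ _ _ _).hom =
        (λ_ (𝟙 a)).inv ≫ 𝟙 a ◁ (λ_ (𝟙 a)).inv by simp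
    | 0, 0, 0, 1, _, _, _ =>
      show (λ_ f).inv ≫ (λ_ (𝟙 a)).inv ▷ f ≫ (α_ _ _ _).hom =
        (λ_ f).inv ≫ 𝟙 a ◁ (λ_ f).inv by simp
    | 0, 0, 1, 1, _, _, _ =>
      show (ρ_ f).inv ≫ (λ_ f).inv ▷ 𝟙 b ≫ (α_ _ _ _).hom =
        (λ_ f).inv ≫ 𝟙 a ◁ (ρ_ f).inv by simp
    | 0, 1, 1, 1, _, _, _ =>
      show (ρ_ f).inv ≫ (ρ_ f).inv ▷ 𝟙 b ≫ (α_ _ _ _).hom =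
        (ρ_ f).inv ≫ f ◁ (λ_ (𝟙 b)).inv by simp [unitors_inv_equal]
    | 1, 1, 1, 1, _, _, _ =>
      show (λ_ (𝟙 b)).inv ≫ (λ_ (𝟙 b)).inv ▷ 𝟙 b ≫ (α_ _ _ _).hom =
        (λ_ (𝟙 b)).inv ≫ 𝟙 b ◁ (λ_ (𝟙 b)).inv by simp
    | 1, 0, _, _, h, _, _ => absurd h (by decide)
    | 0, 1, 0, _, _, h, _ => absurd h (by decide)
    | 1, 1, 0, _, _, h, _ => absurd h (by decide)
    | 0, 0, 1, 0, _, _, h => absurd h (by decide)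
    | 0, 1, 1, 0, _, _, h => absurd h (by decide)
    | 1, 1, 1, 0, _, _, h => absurd h (by decide)
  refl_comp {i j} h := match i, j, h with
    | 0, 0, _ => show (λ_ (𝟙 a)).inv ≫ eqToHom (rfl : 𝟙 a = 𝟙 a) ▷ 𝟙 a ≫ (λ_ (𝟙 a)).hom = 𝟙 _ by simp
    | 0, 1, _ => show (λ_ f).inv ≫ eqToHom (rfl : 𝟙 a = 𝟙 a) ▷ f ≫ (λ_ f).hom = 𝟙 _ by simp
    | 1, 1, _ => show (λ_ (𝟙 b)).inv ≫ eqToHom (rfl : 𝟙 b = 𝟙 b) ▷ 𝟙 b ≫ (λ_ (𝟙 b)).hom = 𝟙 _ by simp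
    | 1, 0, h => absurd h (by decide)
  comp_refl {i j} h := match i, j, h with
    | 0, 0, _ => show (λ_ (𝟙 a)).inv ≫ 𝟙 a ◁ eqToHom (rfl : 𝟙 a = 𝟙 a) ≫ (ρ_ (𝟙 a)).hom = 𝟙 _ by
      simp [unitors_inv_equal]
    | 0, 1, _ => show (ρ_ f).inv ≫ f ◁ eqToHom (rfl : 𝟙 b = 𝟙 b) ≫ (ρ_ f).hom = 𝟙 _ by simp
    | 1, 1, _ => show (λ_ (𝟙 b)).inv ≫ 𝟙 b ◁ eqToHom (rfl : 𝟙 b = 𝟙 b) ≫ (ρ_ (𝟙 b)).hom = 𝟙 _ by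
      simp [unitors_inv_equal]
    | 1, 0, h => absurd h (by decide)

end Ordinals

/-- Isomorphic ordinals are equal and have no nontrivial automorphisms. Thus a triangle commuting up
to isomorphism over `Δ` loses nothing on vertices. -/
theorem toOrderHom_val_of_iso {c d : SimplexCategory} (e : c ≅ d)
    (i : Fin (c.len + 1)) : (e.hom.toOrderHom i).val = i.val := by
  obtain rfl : c = d := SimplexCategory.skeletal ⟨e⟩
  rw [SimplexCategory.eq_id_of_isIso e.hom]
  rfl

namespace SimplicialReplacement

variable {C : Type u₂} [Bicategory.{w₂, v₂} C] {X Y : SimplicialReplacement C}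

theorem len_eq_of_iso (e : X ≅ Y) : X.base.len = Y.base.len :=
  congrArg SimplexCategory.len (SimplexCategory.skeletal ⟨(proj C).mapIso e⟩)

theorem val_of_iso (e : X ≅ Y) (i : Fin (X.base.len + 1)) :
    (e.hom.base.toOrderHom i).val = i.val :=
  toOrderHom_val_of_iso ((proj C).mapIso e) i

theorem isCartesian_of_iso (e : X ≅ Y) : (proj C).IsCartesian ((proj C).map e.hom) e.hom :=
  inferInstance

theorem invertible_of_iso (e : X ≅ Y) : Icon.Invertible e.hom.fiber :=
  Icon.invertible_of_isIso _ (isIso_fiber_of_isCartesian _ (isCartesian_of_iso e))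

theorem exists_hom_of_obj_eq (hX : X.base.len = 0) (hY : Y.base.len = 0)
    (i : Fin (X.base.len + 1)) (j : Fin (Y.base.len + 1))
    (e : X.fiber.obj ⟨i⟩ = Y.fiber.obj ⟨j⟩) : Nonempty (X ⟶ Y) := by
  obtain ⟨c, γ⟩ := X
  obtain ⟨d, γ'⟩ := Y
  obtain rfl : c = ⦋0⦌ := SimplexCategory.ext hX
  obtain rfl : d = ⦋0⦌ := SimplexCategory.ext hY
  obtain rfl : i = 0 := Subsingleton.elim (α := Fin 1) i 0
  obtain rfl : j = 0 := Subsingleton.elim (α := Fin 1) j 0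
  obtain ⟨α⟩ := SegalTwoCat.exists_hom_of_obj_eq γ γ' e
  exact ⟨Hom.mk (𝟙 ⦋0⦌) α⟩

section

variable {a b : C} {i j : Fin (X.base.len + 1)} {i' j' : Fin (Y.base.len + 1)}
  {h : i ≤ j} {h' : i' ≤ j'}
  {ha : a = X.fiber.obj ⟨i⟩} {hb : b = X.fiber.obj ⟨j⟩}
  {ha' : a = Y.fiber.obj ⟨i'⟩} {hb' : b = Y.fiber.obj ⟨j'⟩}

theorem exists_arrowMap_eq (hX : X.base.len = 1) (hY : Y.base.len = 1) (hi : i.val = 0)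
    (hj : j.val = 1) (hi' : i'.val = 0) (hj' : j'.val = 1)
    (θ : arrow X.fiber h ha hb ⟶ arrow Y.fiber h' ha' hb') :
    ∃ (φ : X ⟶ Y) (e : φ.base.toOrderHom i = i') (e' : φ.base.toOrderHom j = j'),
      arrowMap φ e e' = θ := by
  obtain ⟨c, γ⟩ := X
  obtain ⟨d, γ'⟩ := Y
  obtain rfl : c = ⦋1⦌ := SimplexCategory.ext hX
  obtain rfl : d = ⦋1⦌ := SimplexCategory.ext hY
  obtain rfl : i = 0 := Fin.ext hi
  obtain rfl : j = 1 := Fin.ext hj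
  obtain rfl : i' = 0 := Fin.ext hi'
  obtain rfl : j' = 1 := Fin.ext hj'
  subst ha; subst hb
  obtain ⟨α, hα⟩ := exists_hom_of_arrow γ γ' ha' hb' θ
  exact ⟨Hom.mk (𝟙 ⦋1⦌) α, rfl, rfl, (Category.comp_id _).trans hα⟩

theorem hom_ext_of_arrowMap (hX : X.base.len = 1) (hi : i.val = 0) (hj : j.val = 1)
    {φ ψ : X ⟶ Y} (e₀ : φ.base.toOrderHom i = i') (e₁ : φ.base.toOrderHom j = j')
    (e₀' : ψ.base.toOrderHom i = i') (e₁' : ψ.base.toOrderHom j = j')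
    (H : (arrowMap φ e₀ e₁ : arrow X.fiber h ha hb ⟶ arrow Y.fiber h' ha' hb') =
      arrowMap ψ e₀' e₁') : φ = ψ := by
  obtain ⟨c, γ⟩ := X
  obtain rfl : c = ⦋1⦌ := SimplexCategory.ext hX
  obtain rfl : i = 0 := Fin.ext hi
  obtain rfl : j = 1 := Fin.ext hj
  obtain ⟨b, α⟩ := φ
  obtain ⟨b', β⟩ := ψ
  obtain rfl : b = b' := SimplexCategory.Hom.ext _ _ (OrderHom.ext _ _ (funext
    (Fin.forall_fin_two.2 ⟨e₀.trans e₀'.symm, e₁.trans e₁'.symm⟩)))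
  subst ha; subst hb; subst e₀; subst e₁
  have : α = β := hom_ext_of_app
    ((Category.comp_id _).symm.trans (Eq.trans H (Category.comp_id _)))
  rw [this]

end

theorem exists_point (c : C) : ∃ X : SimplicialReplacement C, X.base.len = 0 ∧
    ∀ i, X.fiber.obj ⟨i⟩ = c :=
  ⟨⟨⦋0⦌, (PreorderData.point c).toPseudofunctor⟩, rfl, fun _ => rfl⟩

theorem exists_edge {a b : C} (f : a ⟶ b) : ∃ (X : SimplicialReplacement C)
    (i j : Fin (X.base.len + 1)) (h : i ≤ j) (ha : a = X.fiber.obj ⟨i⟩) (hb : b = X.fiber.obj ⟨j⟩),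
      X.base.len = 1 ∧ i.val = 0 ∧ j.val = 1 ∧ arrow X.fiber h ha hb = f :=
  ⟨⟨⦋1⦌, (PreorderData.edge f).toPseudofunctor⟩, (0 : Fin 2), (1 : Fin 2), Fin.zero_le _, rfl, rfl,
    rfl, rfl, rfl, rfl⟩

end SimplicialReplacement

/-! ### An equivalence of fibrations gives a local equivalence. -/

namespace Comparison

open Framed Rect

variable {E : Type u₁} [Category.{v₁} E] {p : E ⥤ SimplexCategory}
  {C : Type u₂} [Bicategory.{w₂, v₂} C] (T : Comparison p C)

theorem base_len (A : Framed p) : (T.functor.obj A).base.len = A.len :=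
  (Nat.succ_injective (T.len_eq A)).symm

theorem obj_surjective [T.functor.EssSurj] : Function.Surjective T.obj := by
  intro c
  obtain ⟨Z, hZ, h⟩ := SimplicialReplacement.exists_point c
  let A := T.functor.objPreimage Z
  let e := T.functor.objObjPreimageIso Z
  exact ⟨⟨A.vtx 0⟩, (T.obj_eq A 0 rfl).trans
    ((SimplicialReplacement.obj_eq_of_hom e.hom rfl).trans (h _))⟩

variable [hp : p.IsFibered] [hs : IsSegal p] [hd : IsDiscrete (p.Fiber ⦋0⦌)]

omit hs in
-- Equal values yield a morphism between the images of the two points; fullness lifts it to a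
-- morphism of points, which preserves the vertex.
theorem obj_injective [T.functor.Full] : Function.Injective T.obj := by
  rintro ⟨x⟩ ⟨y⟩ h
  obtain ⟨φ⟩ := SimplicialReplacement.exists_hom_of_obj_eq (T.base_len _) (T.base_len _) _ _ h
  exact congrArg Rect.mk (vtx_eq (T.functor.preimage φ) 0)

theorem map₂_injective [T.functor.Faithful] {X Y : Rect p} {P Q : X ⟶ Y} {η θ : P ⟶ Q}
    (h : T.map₂ η = T.map₂ θ) : η = θ :=
  Chain.hom_ext_mor (T.functor.map_injective
    (SimplicialReplacement.hom_ext_of_arrowMap (T.base_len _) rfl rfl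
      (T.cast_base (mor η) (Chain.base_mor_zero (P := P) (Q := Q) η))
      (T.cast_base (mor η) (Chain.base_mor_last (P := P) (Q := Q) η))
      (T.cast_base (mor θ) (Chain.base_mor_zero (P := P) (Q := Q) θ))
      (T.cast_base (mor θ) (Chain.base_mor_last (P := P) (Q := Q) θ)) h))

theorem map₂_surjective [T.functor.Full] {X Y : Rect p} {P Q : X ⟶ Y}
    (θ : T.map P ⟶ T.map Q) : ∃ η : P ⟶ Q, T.map₂ η = θ := by
  obtain ⟨φ, e, e', h⟩ := SimplicialReplacement.exists_arrowMap_eq (T.base_len (comps P))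
    (T.base_len (comps Q)) rfl rfl rfl rfl θ
  obtain ⟨κ, rfl⟩ := T.functor.map_surjective φ
  have h₀ : base κ 0 = 0 := Fin.cast_injective _ ((T.base_eq κ 0).symm.trans e)
  have h₁ : base κ (Fin.last _) = Fin.last _ :=
    Fin.cast_injective _ ((T.base_eq κ (Fin.last _)).symm.trans e')
  exact ⟨(⟨κ, h₀, h₁⟩ : Chain.Cell P Q), h⟩

/-- The 1-morphism `f` is an object of the replacement over `[1]`. A preimage of it is an edge, with
the right endpoints by `obj_injective`, and this edge is represented by a chain. -/
theorem exists_map_iso [T.functor.Full] [T.functor.EssSurj] {X Y : Rect p}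
    (f : T.obj X ⟶ T.obj Y) : ∃ P : X ⟶ Y, Nonempty (T.map P ≅ f) := by
  obtain ⟨Z, i, j, h, ha, hb, hZ, hi, hj, rfl⟩ := SimplicialReplacement.exists_edge f
  let A := T.functor.objPreimage Z
  let e : T.functor.obj A ≅ Z := T.functor.objObjPreimageIso Z
  have hA : A.len = 1 := (T.base_len A).symm.trans
    ((SimplicialReplacement.len_eq_of_iso e).trans hZ)
  let k : Fin (A.len + 1) := ⟨0, by omega⟩
  let l : Fin (A.len + 1) := ⟨1, by omega⟩
  have hkl : k ≤ l := Nat.zero_le 1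
  have hk : e.hom.base.toOrderHom (Fin.cast (T.len_eq A) k) = i :=
    Fin.ext ((SimplicialReplacement.val_of_iso e _).trans hi.symm)
  have hl : e.hom.base.toOrderHom (Fin.cast (T.len_eq A) l) = j :=
    Fin.ext ((SimplicialReplacement.val_of_iso e _).trans hj.symm)
  have hX : A.vtx k = X.pt := congrArg Rect.pt (T.obj_injective (a₁ := ⟨A.vtx k⟩)
    ((T.obj_eq A k rfl).trans
      ((SimplicialReplacement.obj_eq_of_hom e.hom hk).trans ha.symm)))
  have hY : A.vtx l = Y.pt := congrArg Rect.pt (T.obj_injective (a₁ := ⟨A.vtx l⟩)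
    ((T.obj_eq A l rfl).trans
      ((SimplicialReplacement.obj_eq_of_hom e.hom hl).trans hb.symm)))
  obtain ⟨P, κ, hκ, h₀, h₁⟩ := exists_edge_of_lt A hkl hX hY
  have i₁ : IsIso (T.toArr κ h₀ h₁ : T.map P ⟶ T.arr A hkl hX hY) := T.isIso_toArr hκ _ _
  let x : T.arr A hkl hX hY ⟶ arrow Z.fiber h ha hb :=
    SimplicialReplacement.arrowMap e.hom hk hl
  have i₂ : IsIso x := SimplicialReplacement.isIso_arrowMap e.hom
    (SimplicialReplacement.invertible_of_iso e) _ _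
  exact ⟨P, ⟨asIso (T.toArr κ h₀ h₁ : T.map P ⟶ T.arr A hkl hX hY) ≪≫ asIso x⟩⟩

theorem isLocalEquivalence [T.functor.IsEquivalence] : IsLocalEquivalence T.pseudofunctor where
  obj_bijective := ⟨T.obj_injective, T.obj_surjective⟩
  map₂_bijective _ _ := ⟨fun _ _ h => T.map₂_injective h, T.map₂_surjective⟩
  exists_iso := T.exists_map_iso

end Comparison

/-! ### From 2-functors over `Δ` to comparisons, and the theorem. -/

section TwoFunctors

open Framed

variable {E : Type u₁} [Category.{v₁} E] {p : E ⥤ SimplexCategory}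

/-- The underlying object of the total category. -/
def Framed.forget (p : E ⥤ SimplexCategory) : Framed p ⥤ E where
  obj X := X.obj.1
  map f := f.hom

theorem Framed.forget_isEquivalence [p.IsFibered] : (forget p).IsEquivalence :=
  have : (framing p ⋙ forget p).IsEquivalence := inferInstanceAs (𝟭 E).IsEquivalence
  Functor.isEquivalence_of_comp_left (framing p) (forget p)

theorem isCartesian_map_of_isCartesian {x y : E} {φ : x ⟶ y} {c d : SimplexCategory} {f : c ⟶ d}
    (h : p.IsCartesian f φ) : p.IsCartesian (p.map φ) φ := by
  obtain rfl := CategoryTheory.IsHomLift.domain_eq p f φ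
  obtain rfl := CategoryTheory.IsHomLift.codomain_eq p f φ
  obtain rfl := CategoryTheory.IsHomLift.eq_of_isHomLift p f φ
  exact h

/-- Up to an isomorphism over the identity, `f` is the chosen pullback map, which is cartesian. -/
theorem Framed.Cart.isCartesian [p.IsFibered] {X Y : Framed p} {f : X ⟶ Y} (hf : Cart f) :
    p.IsCartesian (p.map f.hom) f.hom := by
  let χ : X ⟶ Y.pull (base f) := (Y.cart_pullMap (base f)).lift f OrderHom.id (fun _ => rfl)
  have hb : base χ = OrderHom.id := Cart.lift_base _ _ _ _
  have e : χ ≫ Y.pullMap (base f) = f := Cart.lift_comp _ _ _ _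
  have hχ : IsIso χ := Cart.isIso_of_base_id (X := X) (Y := Y.pull (base f)) (φ := χ) rfl
    (Cart.of_comp (φ := χ) (Y.cart_pullMap (base f)) (e.symm ▸ hf : Cart (χ ≫ Y.pullMap (base f))))
    (fun i => congrArg (fun g => (g i).val) hb)
  have hl : p.IsHomLift (𝟙 ⦋X.len⦌) χ.hom := by
    have := χ.lift
    rw [show χ.base = OrderHom.id from hb] at this
    exact this
  let χ' : X.obj.1 ≅ (Y.pull (base f)).obj.1 := (forget p).mapIso (asIso χ)
  have hl' : p.IsHomLift (𝟙 ⦋X.len⦌) χ'.hom := hl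
  have h : p.IsCartesian (SimplexCategory.mkHom (base f)) (Y.pullMap (base f)).hom :=
    Functor.IsPreFibered.pullbackMap.IsCartesian Y.obj.2 (SimplexCategory.mkHom (base f))
  have h' := Functor.IsCartesian.of_iso_comp p (SimplexCategory.mkHom (base f))
    (Y.pullMap (base f)).hom χ'
  have e' : χ'.hom ≫ (Y.pullMap (base f)).hom = f.hom := congrArg (fun f => f.hom) e
  rw [e'] at h'
  exact isCartesian_map_of_isCartesian h'

theorem Framed.map_hom_val {X Y : Framed p} (f : X ⟶ Y) (i : Fin (X.len + 1))
    (j : Fin ((p.obj X.obj.1).len + 1)) (h : j.val = i.val) :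
    ((p.map f.hom).toOrderHom j).val = (base f i).val := by
  obtain ⟨n, ⟨x, hx⟩, v, hv⟩ := X
  obtain ⟨m, ⟨y, hy⟩, w, hw⟩ := Y
  obtain rfl : n = (p.obj x).len := congrArg SimplexCategory.len hx.symm
  obtain rfl : m = (p.obj y).len := congrArg SimplexCategory.len hy.symm
  obtain rfl : j = i := Fin.ext h
  obtain ⟨b, φ, l⟩ := f
  have := CategoryTheory.IsHomLift.eq_of_isHomLift p (a := x) (b := y) (SimplexCategory.mkHom b) φ
  exact congrArg (fun g => (SimplexCategory.Hom.toOrderHom g j).val) this.symm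

variable {C : Type u₂} [Bicategory.{w₂, v₂} C]
  (F : TwoFunctor p (SimplicialReplacement.proj C))

theorem TwoFunctor.len_eq (x : E) : (p.obj x).len = (F.functor.obj x).base.len :=
  congrArg SimplexCategory.len (SimplexCategory.skeletal ⟨(F.comm.app x).symm⟩)

theorem TwoFunctor.base_val {x y : E} (f : x ⟶ y) (i : Fin ((p.obj x).len + 1)) :
    ((F.functor.map f).base.toOrderHom (Fin.cast (congrArg (· + 1) (F.len_eq x)) i)).val =
      ((p.map f).toOrderHom i).val := by
  have h := congrArg (fun g => (SimplexCategory.Hom.toOrderHom g i).val) (F.comm.inv.naturality f)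
  have h₁ : ((F.comm.app x).symm.hom).toOrderHom i =
      Fin.cast (congrArg (· + 1) (F.len_eq x)) i :=
    Fin.ext (toOrderHom_val_of_iso (F.comm.app x).symm i)
  rw [← h₁]
  exact h.symm.trans (toOrderHom_val_of_iso (F.comm.app y).symm _)

/-- The comparison given by a 2-functor to a simplicial replacement. -/
def TwoFunctor.comparison [p.IsFibered] : Comparison p C where
  functor := forget p ⋙ F.functor
  len_eq X := (congrArg (fun c => SimplexCategory.len c + 1) X.obj.2).symm.trans
    (congrArg (· + 1) (F.len_eq X.obj.1))
  base_eq {X _} f i := Fin.ext ((F.base_val f.hom (Fin.cast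
    (congrArg (fun c => SimplexCategory.len c + 1) X.obj.2).symm i)).trans
      (Framed.map_hom_val f i _ rfl))
  invertible {_ _ f} hf := Icon.invertible_of_isIso _
    (isIso_fiber_of_isCartesian _ (F.cartesian f.hom hf.isCartesian))

theorem exists_isLocalEquivalence [p.IsFibered] [IsSegal p] [IsDiscrete (p.Fiber ⦋0⦌)]
    (hF : F.functor.IsEquivalence) : ∃ G : Rect p ⥤ᵖ C, IsLocalEquivalence G :=
  have := Framed.forget_isEquivalence (p := p)
  have : F.comparison.functor.IsEquivalence :=
    inferInstanceAs (forget p ⋙ F.functor).IsEquivalence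
  ⟨_, F.comparison.isLocalEquivalence⟩

end TwoFunctors

end SegalTwoCat

theorem theorem2 {E : Type u} [Category.{u} E] (p : E ⥤ SimplexCategory)
    (hp : SegalTwoCat.IsTwoCategory p) :
    (∃ (R : Type u) (_ : Bicategory.{u, u} R) (_ : Bicategory.Strict R),
      SegalTwoCat.Equivalent p (SegalTwoCat.SimplicialReplacement.proj R)) ∧
    (∀ (R R' : Type u) [Bicategory.{u, u} R] [Bicategory.{u, u} R']
      [Bicategory.Strict R] [Bicategory.Strict R'],
      SegalTwoCat.Equivalent p (SegalTwoCat.SimplicialReplacement.proj R) →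
      SegalTwoCat.Equivalent p (SegalTwoCat.SimplicialReplacement.proj R') →
      SegalTwoCat.StronglyEquivalent R R') := by
  have := hp.isFibered
  have : SegalTwoCat.IsSegal p := ⟨fun n => hp.segal n 1⟩
  have := hp.discrete
  refine ⟨⟨SegalTwoCat.Rect p, inferInstance, inferInstance, SegalTwoCat.Rect.equivalent⟩, ?_⟩
  rintro R R' _ _ _ _ ⟨F, hF⟩ ⟨F', hF'⟩
  obtain ⟨G, hG⟩ := SegalTwoCat.exists_isLocalEquivalence F hF
  obtain ⟨G', hG'⟩ := SegalTwoCat.exists_isLocalEquivalence F' hF'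
  -- The span from the rectification to `R` and `R'` is turned into a single local equivalence by
  -- inverting its first leg.
  obtain ⟨S, -, hS, -⟩ := hG.exists_section
  exact (hS.comp hG').stronglyEquivalent
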